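/- Let $X$ be a closed connected Riemann surface and $\omega$ a holomorphic $1$-form on $X$ that is not identically zero and has at least one zero. The line element $|\omega|$ induces a flat metric on $X$ with cone points at the zeros of $\omega$. A saddle connection is a geodesic segment for this metric that joins a pair of (possibly equal) zeros of $\omega$ and contains no zero in its interior. For $t\in\mathbb R$ let $X_t$ be the surface obtained from $X$ by post-composing the natural parameters of $\omega$ (the local charts $\varphi$ away from the zeros with $d\varphi=\omega$) with the $\mathbb R$-linear map $z\mapsto e^{t/2}\,\mathrm{Re}\,z+i\,e^{-t/2}\,\mathrm{Im}\,z$, and let $\ell(X_t)$ be the length of the shortest saddle connection of $X_t$. If $\ell(X_t)$ does not tend to $0$ as $t\to\infty$, then the vertical foliation $\mathcal F_v$ of $X$, defined by $\mathrm{Re}\,\omega=0$, is uniquely ergodic: up to multiplication by a constant it has exactly one nonzero invariant transverse measure. Here an invariant transverse measure assigns to every compact horizontal arc that contains no zero of $\omega$ a finite Borel measure on the arc, compatibly with passing to subarcs and invariantly under sliding arcs along vertical leaves. -/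

import Mathlib

open Set Filter Topology MeasureTheory
open scoped Manifold ContDiff NNReal ENNReal

noncomputable section

/-- A holomorphic `1`-form on a Riemann surface `X`: a complex-linear form on every tangent space,
whose coefficient `f` in the local expression `f(z) dz` is holomorphic in every chart of `X`. -/
structure HolomorphicOneForm (X : Type*) [TopologicalSpace X] [ChartedSpace ℂ X] where
  /-- the value of the form at a point -/
  form : ∀ x : X, TangentSpace 𝓘(ℂ) x →L[ℂ] ℂ
  /-- holomorphy of the coefficient in charts -/
  holomorphic : ∀ e ∈ atlas ℂ X,
    DifferentiableOn ℂ (fun z : ℂ => form (e.symm z) (mfderiv 𝓘(ℂ) 𝓘(ℂ) e.symm z (1 : ℂ))) e.target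

/-- The data of the flat structure of a translation surface: its singular points, and the charts
to `ℂ` defined away from them whose differentials are the `1`-form of the surface. -/
structure FlatStructure (X : Type*) [TopologicalSpace X] where
  /-- the singular points -/
  sing : Set X
  /-- the charts away from the singular points -/
  charts : Set (OpenPartialHomeomorph X ℂ)

/-- The flat structure of `(X, η)`: its singular points are the zeros of `η`, its charts are all
natural parameters of `η`, that is, all injective holomorphic functions `φ` on open sets of `X` with
`dφ = η` (such a set contains no zero of `η`). -/
def HolomorphicOneForm.flat {X : Type*} [TopologicalSpace X] [ChartedSpace ℂ X]
    (η : HolomorphicOneForm X) : FlatStructure X where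
  sing := {x | η.form x = 0}
  charts := {φ | ∀ x ∈ φ.source, HasMFDerivAt 𝓘(ℂ) 𝓘(ℂ) φ x (η.form x)}

/-- The real-linear map `z ↦ e^{t/2} Re z + i e^{-t/2} Im z`, as a homeomorphism of the plane. -/
def teichmullerMap (t : ℝ) : ℂ ≃ₜ ℂ where
  toFun z := ⟨Real.exp (t / 2) * z.re, Real.exp (-t / 2) * z.im⟩
  invFun z := ⟨Real.exp (-t / 2) * z.re, Real.exp (t / 2) * z.im⟩
  left_inv z := by
    apply Complex.ext <;> simp [← mul_assoc, ← Real.exp_add, neg_div]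
  right_inv z := by
    apply Complex.ext <;> simp [← mul_assoc, ← Real.exp_add, neg_div]
  continuous_toFun := by
    have : (fun z : ℂ => (⟨Real.exp (t / 2) * z.re, Real.exp (-t / 2) * z.im⟩ : ℂ)) =
        fun z : ℂ => ((Real.exp (t / 2) * z.re : ℝ) : ℂ)
          + ((Real.exp (-t / 2) * z.im : ℝ) : ℂ) * Complex.I := by
      funext z; apply Complex.ext <;> simp [-Complex.ofReal_mul, -Complex.ofReal_exp]
    rw [this]; fun_prop
  continuous_invFun := by
    have : (fun z : ℂ => (⟨Real.exp (-t / 2) * z.re, Real.exp (t / 2) * z.im⟩ : ℂ)) =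
        fun z : ℂ => ((Real.exp (-t / 2) * z.re : ℝ) : ℂ)
          + ((Real.exp (t / 2) * z.im : ℝ) : ℂ) * Complex.I := by
      funext z; apply Complex.ext <;> simp [-Complex.ofReal_mul, -Complex.ofReal_exp]
    rw [this]; fun_prop

namespace FlatStructure

variable {X : Type*} [TopologicalSpace X]

/-- The evolution under the Teichmüller flow: the flat structure of `X_t`, obtained by
post-composing the charts with `z ↦ e^{t/2} Re z + i e^{-t/2} Im z`. The underlying topological
space and the singular points stay the same, so the Teichmüller map `X → X_t` is the identity. -/
def evolve (F : FlatStructure X) (t : ℝ) : FlatStructure X where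
  sing := F.sing
  charts := (fun φ => φ.transHomeomorph (teichmullerMap t)) '' F.charts

/-- `γ` restricted to `J` is a straight path with constant velocity `v` that avoids the singular
points, that is, a path with velocity `v` which is geodesic for the flat metric `|dφ|`. -/
structure IsStraightOn (F : FlatStructure X) (γ : ℝ → X) (J : Set ℝ) (v : ℂ) : Prop where
  continuousOn : ContinuousOn γ J
  notMem_sing : ∀ s ∈ J, γ s ∉ F.sing
  straight : ∀ s ∈ J, ∀ φ ∈ F.charts, γ s ∈ φ.source →
    ∀ᶠ u in 𝓝[J] s, φ (γ u) = φ (γ s) + ((u - s : ℝ) : ℂ) * v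

/-- `γ` restricted to `[0, 1]` is a saddle connection with holonomy `v`: a geodesic segment for the
flat metric, parametrized proportionally to arc length, that joins a pair of singular points
(possibly equal) and contains no singular point in its interior. Its length is `‖v‖`. -/
structure IsSaddleConnection (F : FlatStructure X) (γ : ℝ → X) (v : ℂ) : Prop where
  ne_zero : v ≠ 0
  continuousOn : ContinuousOn γ (Icc 0 1)
  start_mem : γ 0 ∈ F.sing
  end_mem : γ 1 ∈ F.sing
  straight : F.IsStraightOn γ (Ioo 0 1) v

/-- The length of the shortest saddle connection (infinite if there is none). -/
def shortestSaddle (F : FlatStructure X) : ℝ≥0∞ :=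
  sInf {r | ∃ γ v, F.IsSaddleConnection γ v ∧ r = ENNReal.ofReal ‖v‖}

/-- `R` restricted to `[a, b] × [c, d] ⊆ ℂ` is a rectangle with horizontal and vertical edges: a map
to the surface without its singular points along which the `1`-form pulls back to `dz`. -/
structure IsRectangle (F : FlatStructure X) (R : ℂ → X) (a b c d : ℝ) : Prop where
  continuousOn : ContinuousOn R (Icc a b ×ℂ Icc c d)
  notMem_sing : ∀ z ∈ Icc a b ×ℂ Icc c d, R z ∉ F.sing
  translation : ∀ z ∈ Icc a b ×ℂ Icc c d, ∀ φ ∈ F.charts, R z ∈ φ.source →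
    ∀ᶠ w in 𝓝[Icc a b ×ℂ Icc c d] z, φ (R w) = φ (R z) + (w - z)

/-- A compact horizontal arc without singular points, parametrized by arc length on `[a, b]`. -/
structure HorizontalArc (F : FlatStructure X) where
  /-- the parametrization, relevant on `[a, b]` only -/
  path : ℝ → X
  /-- the left end of the parameter interval -/
  a : ℝ
  /-- the right end of the parameter interval -/
  b : ℝ
  le : a ≤ b
  straight : F.IsStraightOn path (Icc a b) 1

/-- An invariant transverse measure of the vertical foliation. It assigns to every compact
horizontal arc a finite Borel measure on the arc (written in the arc length parameter), compatibly
with passing to subarcs, and invariantly under sliding arcs along vertical leaves. -/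
structure TransverseMeasure (F : FlatStructure X) where
  /-- the measure on an arc -/
  meas : F.HorizontalArc → Measure ℝ
  finite : ∀ I, IsFiniteMeasure (meas I)
  carried : ∀ I, meas I (Icc I.a I.b)ᶜ = 0
  subarc : ∀ I J : F.HorizontalArc, I.a ≤ J.a → J.b ≤ I.b → EqOn J.path I.path (Icc J.a J.b) →
    meas J = (meas I).restrict (Icc J.a J.b)
  /-- If `I` and `J` are the bottom and the top edge of a rectangle (possibly of height zero, and
  with the parameter of `J` shifted by `k`), then they carry the same measure. -/
  invariant : ∀ (I J : F.HorizontalArc) (R : ℂ → X) (c d k : ℝ), c ≤ d →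
    F.IsRectangle R I.a I.b c d → J.a = I.a + k → J.b = I.b + k →
    (∀ s ∈ Icc I.a I.b, I.path s = R ⟨s, c⟩) →
    (∀ s ∈ Icc I.a I.b, J.path (s + k) = R ⟨s, d⟩) →
    meas J = (meas I).map (fun s => s + k)

/-- The vertical foliation is uniquely ergodic: it has a nonzero invariant transverse measure, and
every invariant transverse measure is a multiple of it. -/
def VerticalUniquelyErgodic (F : FlatStructure X) : Prop :=
  ∃ μ : F.TransverseMeasure, (∃ I, μ.meas I ≠ 0) ∧
    ∀ ν : F.TransverseMeasure, ∃ c : ℝ≥0, ∀ I, ν.meas I = c • μ.meas I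

end FlatStructure

end

/-!
# Masur's criterion for unique ergodicity

The proof reduces the vertical foliation to a first return map on an interval and combines the
length estimate for saddle connections with Boshernitzan's criterion for interval exchanges.

Away from its zeros the form has natural parameters, and at a zero it has a primitive which is open
with finite fibres; the zeros are finite in number and do not disconnect the surface. These
properties, `FlatStructure.IsTranslation`, are all that is used of the complex structure
(`HolomorphicOneForm.isTranslation_flat`). They suffice to show that a straight path which cannot
be prolonged runs into a zero (`exists_tendsto_sing`).

Suppose that at arbitrarily large times `t` all saddle connections of `X_t` have length at least
`ε`. A vertical saddle connection would be contracted to length zero, so there is none. Hence the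
foliation is minimal (`exists_flow_mem`): the boundary of the set of leaves that meet an open set
would contain an infinite vertical ray with leaves of the set on one side; a strip beside such a
ray either comes back to itself, or is cut by infinitely many zeros, and both are impossible
(`false_of_boundary_ray`). Therefore the leaves cross every horizontal arc within a bounded time
`H`, unless they run into a zero before. Choose a short horizontal arc whose ends run upwards into
zeros. The first return map to it is an interval exchange, and the discontinuities of its `n`-th
iterate run into zeros within the time `S = n * H + m`, where `m` is the time in which the ends do.
The crucial estimate is that two such points at distance `δ` produce a saddle connection with
horizontal part at most `δ` and vertical part at most `S` (`IsDisc.exists_saddle_of_blocked`). With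
`exp (t / 2) = 2 * S / ε` the length of the vertical part in `X_t` is at most `ε / 2`, so the
horizontal part has length at least `ε / 2`, which gives `δ ≥ ε ^ 2 / (4 * S)`. So for infinitely
many `n` the discontinuities of the `n`-th iterate are `c / n`-separated (`IsDisc.exists_arc`).

Boshernitzan's criterion (`IsIntervalExchange.eq_smul_volume`) says that then every invariant
measure without atoms is a multiple of Lebesgue measure. By separation, short intervals have about
`n / 2` disjoint translates among their iterates, and so, near a density point, an invariant set of
positive Lebesgue measure has measure at least `c / 16` (`le_volume_of_invariant`). If an invariant
measure and Lebesgue measure gave different frequencies to `(a, d)`, for a discontinuity `d` of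
some iterate, then, as the number of visits to `(a, d)` changes by at most one along an orbit, each
intermediate number of visits would occur on an interval of length `c / n`. The limit of the
averages in the mean ergodic theorem would take values in each part of the interval between the two
frequencies with positive probability, which gives infinitely many disjoint invariant sets of
positive measure (`false_of_visits_lt`).

An invariant transverse measure restricts to an invariant measure on the arc. It has no atoms,
since no leaf is closed and every leaf crosses the arc infinitely often. So it is a multiple of
length on the arc, and since every leaf meets the arc, it is the same multiple of length on every
horizontal arc (`IsDisc.meas_eq_smul`).
-/

noncomputable section

/-! ### Developed maps and the exponential map -/

/-- A locally constant function on a preconnected set is constant. It is applied mostly to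
propositions, in which case it says that a clopen condition which holds at one point holds
everywhere. -/
theorem IsPreconnected.eq_of_locally_eq {E Y : Type*} [TopologicalSpace E] {C : Set E}
    (hC : IsPreconnected C) {f : E → Y} (hf : ∀ z ∈ C, ∀ᶠ w in 𝓝[C] z, f w = f z)
    {x y : E} (hx : x ∈ C) (hy : y ∈ C) : f x = f y := by
  let _ : TopologicalSpace Y := ⊥
  have : DiscreteTopology Y := ⟨rfl⟩
  refine hC.constant (f := f) ?_ hx hy
  intro z hz
  exact (tendsto_const_nhds (x := f z)).congr' ((hf z hz).mono fun w hw => hw.symm)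

namespace FlatStructure

variable {X : Type*} [TopologicalSpace X]

/-- The properties of the flat structure of a closed translation surface that the argument uses: the
singular points are finite in number and do not separate the surface, the charts cover the other
points and differ by translations, and each singular point has a neighbourhood with a primitive of
the form that is open there and has finite fibres. -/
structure IsTranslation (F : FlatStructure X) : Prop where
  finite_sing : F.sing.Finite
  nonempty_sing : F.sing.Nonempty
  preconnected : IsPreconnected F.singᶜ
  exists_chart : ∀ x ∉ F.sing, ∃ φ ∈ F.charts, x ∈ φ.source
  compat : ∀ φ ∈ F.charts, ∀ ψ ∈ F.charts, ∀ x ∈ φ.source, x ∈ ψ.source →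
    ∀ᶠ y in 𝓝 x, φ y - φ x = ψ y - ψ x
  primitive : ∀ p ∈ F.sing, ∃ (U : Set X) (G : X → ℂ), IsOpen U ∧ p ∈ U ∧
    ContinuousOn G (closure U) ∧ (∀ x ∈ closure U, x ≠ p → x ∉ F.sing ∧ G x ≠ G p) ∧
    (∀ c, (U ∩ G ⁻¹' {c}).Finite) ∧ 𝓝 (G p) ≤ map G (𝓝 p) ∧
    ∀ x ∈ U, x ≠ p → ∀ φ ∈ F.charts, x ∈ φ.source → ∀ᶠ y in 𝓝 x, G y - G x = φ y - φ x

/-- `R` maps `C` to the regular part of the surface, and `d` is a developing map of it: in the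
charts `R` agrees with `d` up to translations. Straight paths (`isDev_line_iff`) and rectangles
(`isDev_rectangle_iff`) are special cases. -/
structure IsDev (F : FlatStructure X) {E : Type*} [TopologicalSpace E] (R : E → X) (d : E → ℂ)
    (C : Set E) : Prop where
  continuousOn : ContinuousOn R C
  notMem_sing : ∀ z ∈ C, R z ∉ F.sing
  dev : ∀ z ∈ C, ∀ φ ∈ F.charts, R z ∈ φ.source →
    ∀ᶠ w in 𝓝[C] z, φ (R w) = φ (R z) + (d w - d z)

variable {F : FlatStructure X} {E : Type*} [TopologicalSpace E]

theorem isDev_line_iff {γ : ℝ → X} {J : Set ℝ} {v : ℂ} :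
    F.IsDev γ (fun s : ℝ => (s : ℂ) * v) J ↔ F.IsStraightOn γ J v := by
  constructor
  · rintro ⟨h1, h2, h3⟩
    refine ⟨h1, h2, fun s hs φ hφ hx => (h3 s hs φ hφ hx).mono fun u hu => ?_⟩
    rw [hu]; push_cast; ring
  · rintro ⟨h1, h2, h3⟩
    refine ⟨h1, h2, fun s hs φ hφ hx => (h3 s hs φ hφ hx).mono fun u hu => ?_⟩
    rw [hu]; push_cast; ring

theorem isDev_rectangle_iff {R : ℂ → X} {a b c d : ℝ} :
    F.IsDev R id (Icc a b ×ℂ Icc c d) ↔ F.IsRectangle R a b c d :=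
  ⟨fun h => ⟨h.1, h.2, h.3⟩, fun h => ⟨h.1, h.2, h.3⟩⟩

namespace IsDev

theorem mono {R : E → X} {d : E → ℂ} {C C' : Set E} (h : F.IsDev R d C) (hC : C' ⊆ C) :
    F.IsDev R d C' :=
  ⟨h.1.mono hC, fun z hz => h.2 z (hC hz), fun z hz φ hφ hx =>
    (h.3 z (hC hz) φ hφ hx).filter_mono (nhdsWithin_mono _ hC)⟩

theorem comp {E' : Type*} [TopologicalSpace E'] {R : E → X} {d : E → ℂ} {C : Set E}
    (h : F.IsDev R d C) {f : E' → E} {C' : Set E'} (hf : ContinuousOn f C') (hm : MapsTo f C' C) :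
    F.IsDev (R ∘ f) (d ∘ f) C' :=
  ⟨h.1.comp hf hm, fun _ hz => h.2 _ (hm hz), fun z hz φ hφ hx =>
    (tendsto_nhdsWithin_iff.2 ⟨hf z hz, eventually_mem_nhdsWithin.mono fun _ hw => hm hw⟩
      ).eventually (h.3 _ (hm hz) φ hφ hx)⟩

theorem congr {R R' : E → X} {d d' : E → ℂ} {C : Set E} (h : F.IsDev R d C) (hR : EqOn R' R C)
    (c : ℂ) (hd : ∀ z ∈ C, d' z = d z + c) : F.IsDev R' d' C := by
  refine ⟨h.1.congr hR, fun z hz => hR hz ▸ h.2 z hz, fun z hz φ hφ hx => ?_⟩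
  rw [hR hz] at hx
  filter_upwards [h.3 z hz φ hφ hx, eventually_mem_nhdsWithin] with w hw hwC
  rw [hR hz, hR hwC, hw, hd z hz, hd w hwC]; ring

theorem congr_dev {R : E → X} {d d' : E → ℂ} {C : Set E} (h : F.IsDev R d C)
    (c : ℂ) (hd : ∀ z ∈ C, d' z = d z + c) : F.IsDev R d' C :=
  h.congr (fun _ _ => rfl) c hd

/-- Being developed by `d` is a local property. -/
theorem of_locally {R : E → X} {d : E → ℂ} {C : Set E}
    (h : ∀ z ∈ C, ∃ V ∈ 𝓝[C] z, z ∈ V ∧ F.IsDev R d V) : F.IsDev R d C := by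
  refine ⟨fun z hz => ?_, fun z hz => ?_, fun z hz φ hφ hx => ?_⟩
  · obtain ⟨V, hV, hzV, hd⟩ := h z hz
    exact (hd.1 z hzV).mono_of_mem_nhdsWithin hV
  · obtain ⟨V, hV, hzV, hd⟩ := h z hz
    exact hd.2 z hzV
  · obtain ⟨V, hV, hzV, hd⟩ := h z hz
    exact (hd.3 z hzV φ hφ hx).filter_mono (nhdsWithin_le_iff.2 hV)

/-- Maps with the same developing map that agree at one point agree. -/
theorem eqOn [T2Space X] (hF : F.IsTranslation) {R R' : E → X} {d : E → ℂ} {C : Set E}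
    (h : F.IsDev R d C) (h' : F.IsDev R' d C) (hC : IsPreconnected C) {z₀ : E} (hz₀ : z₀ ∈ C)
    (h0 : R z₀ = R' z₀) : EqOn R R' C := by
  intro z hz
  have key : (R z₀ = R' z₀) = (R z = R' z) := by
    refine hC.eq_of_locally_eq (f := fun z => (R z = R' z)) ?_ hz₀ hz
    intro z hz
    by_cases hzz : R z = R' z
    · obtain ⟨φ, hφ, hx⟩ := hF.exists_chart _ (h.2 z hz)
      have hx' : R' z ∈ φ.source := hzz ▸ hx
      filter_upwards [h.3 z hz φ hφ hx, h'.3 z hz φ hφ hx',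
        (h.1 z hz).eventually (φ.open_source.mem_nhds hx),
        (h'.1 z hz).eventually (φ.open_source.mem_nhds hx')] with w h1 h2 h3 h4
      simp only [hzz, eq_iff_iff, iff_true]
      exact φ.injOn h3 h4 (by rw [h1, h2, hzz])
    · filter_upwards [((h.1 z hz).prodMk_nhds (h'.1 z hz)).eventually
        (isClosed_diagonal.isOpen_compl.mem_nhds (show (R z, R' z) ∈ (diagonal X)ᶜ from hzz))]
        with w hw
      simp only [hzz, eq_iff_iff, iff_false]
      exact hw
  exact key.mp h0

open Classical in
/-- Maps developed by the same `d` on two open sets can be glued if they agree at one point of a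
connected intersection. -/
theorem union [T2Space X] (hF : F.IsTranslation) {R R' : E → X} {d : E → ℂ} {C C' : Set E}
    (h : F.IsDev R d C) (h' : F.IsDev R' d C') (hC : IsOpen C) (hC' : IsOpen C')
    (hcon : IsPreconnected (C ∩ C')) {z₀ : E} (hz₀ : z₀ ∈ C ∩ C') (h0 : R z₀ = R' z₀) :
    ∃ R'' : E → X, F.IsDev R'' d (C ∪ C') ∧ EqOn R'' R C ∧ EqOn R'' R' C' := by
  have e : EqOn R R' (C ∩ C') :=
    (h.mono inter_subset_left).eqOn hF (h'.mono inter_subset_right) hcon hz₀ h0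
  have e1 : EqOn (C.piecewise R R') R C := fun z hz => by simp [hz]
  have e2 : EqOn (C.piecewise R R') R' C' := fun z hz => by
    by_cases hc : z ∈ C
    · simp [hc, e ⟨hc, hz⟩]
    · simp [hc]
  refine ⟨C.piecewise R R', ?_, e1, e2⟩
  refine of_locally ?_
  rintro z (hz | hz)
  · exact ⟨C, mem_nhdsWithin_of_mem_nhds (hC.mem_nhds hz), hz, h.congr e1 0 (by simp)⟩
  · exact ⟨C', mem_nhdsWithin_of_mem_nhds (hC'.mem_nhds hz), hz, h'.congr e2 0 (by simp)⟩

/-- A primitive of the form, composed with a developed map, is the developing map. -/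
theorem primitive_sub {R : E → X} {d : E → ℂ} {C : Set E} (hF : F.IsTranslation)
    (h : F.IsDev R d C) (hC : IsPreconnected C) {G : X → ℂ}
    (hG : ∀ z ∈ C, ∀ φ ∈ F.charts, R z ∈ φ.source → ∀ᶠ y in 𝓝 (R z), G y - G (R z) = φ y - φ (R z))
    {z w : E} (hz : z ∈ C) (hw : w ∈ C) : G (R w) - G (R z) = d w - d z := by
  have := hC.eq_of_locally_eq (f := fun z => G (R z) - d z) ?_ hz hw
  · linear_combination -this
  · intro z hz
    obtain ⟨φ, hφ, hx⟩ := hF.exists_chart _ (h.2 z hz)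
    filter_upwards [h.3 z hz φ hφ hx, (h.1 z hz).eventually (hG z hz φ hφ hx)] with w h1 h2
    rw [h1] at h2
    linear_combination h2

end IsDev

/-- The vectors `v` such that the straight segment with holonomy `v` from the point `p` exists. This
is expressed by a developed map of a star-shaped open set, which makes the domain open by
definition. -/
def dom (F : FlatStructure X) (p : X) : Set ℂ :=
  {v | ∃ (C : Set ℂ) (R : ℂ → X), IsOpen C ∧ StarConvex ℝ 0 C ∧ v ∈ C ∧ 0 ∈ C ∧ R 0 = p ∧
    F.IsDev R id C}

open Classical in
/-- The exponential map: the end of the straight segment with holonomy `v` from `p`. Its value is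
`p` if this segment does not exist. -/
def exp (F : FlatStructure X) (p : X) (v : ℂ) : X :=
  if h : v ∈ F.dom p then h.choose_spec.choose v else p

theorem isOpen_dom (p : X) : IsOpen (F.dom p) := by
  rw [isOpen_iff_mem_nhds]
  rintro v ⟨C, R, h1, h2, h3, h4⟩
  filter_upwards [h1.mem_nhds h3] with w hw
  exact ⟨C, R, h1, h2, hw, h4⟩

theorem starConvex_dom (p : X) : StarConvex ℝ 0 (F.dom p) := by
  rintro v ⟨C, R, h1, h2, h3, h4⟩ a b ha hb hab
  exact ⟨C, R, h1, h2, h2 h3 ha hb hab, h4⟩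

theorem zero_mem_dom_of_mem {p : X} {v : ℂ} (hv : v ∈ F.dom p) : 0 ∈ F.dom p := by
  obtain ⟨C, R, h1, h2, h3, h4, h5⟩ := hv
  exact ⟨C, R, h1, h2, h4, h4, h5⟩

theorem exp_zero (p : X) : F.exp p 0 = p := by
  rw [exp]
  split_ifs with h
  · exact h.choose_spec.choose_spec.2.2.2.2.1
  · rfl

theorem segment_subset_dom {p : X} {v : ℂ} (hv : v ∈ F.dom p) : segment ℝ 0 v ⊆ F.dom p :=
  (starConvex_dom p).segment_subset hv

theorem segment_smul_subset (v : ℂ) (a b : ℝ) :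
    segment ℝ 0 (a • v + b • v) ⊆ segment ℝ 0 (a • v) ∪ segment ℝ (a • v) (a • v + b • v) := by
  have key : ∀ x y : ℝ, segment ℝ (x • v) (y • v) = (fun t : ℝ => t • v) '' uIcc x y := by
    intro x y
    rw [← segment_eq_uIcc]
    exact (image_segment ℝ (LinearMap.toSpanSingleton ℝ ℂ v).toAffineMap x y).symm
  have h0 : (0:ℂ) = (0:ℝ) • v := by simp
  rw [← add_smul, h0, key, key, key, ← image_union]
  exact image_mono uIcc_subset_uIcc_union_uIcc

section T2
variable [T2Space X]

theorem exp_eq_of_starConvex (hF : F.IsTranslation) {p : X} {C : Set ℂ} {R : ℂ → X} (hC : IsOpen C)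
    (hs : StarConvex ℝ 0 C) (h0 : 0 ∈ C) (hR : R 0 = p) (hd : F.IsDev R id C) :
    C ⊆ F.dom p ∧ EqOn (F.exp p) R C := by
  have hsub : C ⊆ F.dom p := fun v hv => ⟨C, R, hC, hs, hv, h0, hR, hd⟩
  refine ⟨hsub, fun v hv => ?_⟩
  have hv' := hsub hv
  rw [exp, dif_pos hv']
  obtain ⟨h1, h2, h3, h4, h5, h6⟩ := hv'.choose_spec.choose_spec
  refine IsDev.eqOn hF (h6.mono (inter_subset_left (t := C))) (hd.mono inter_subset_right)
    ((h2.inter hs).isPathConnected ⟨h4, h0⟩).isConnected.isPreconnected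
    (z₀ := 0) ⟨h4, h0⟩ (h5.trans hR.symm) ⟨h3, hv⟩

theorem isDev_exp (hF : F.IsTranslation) (p : X) : F.IsDev (F.exp p) id (F.dom p) := by
  refine IsDev.of_locally ?_
  rintro z ⟨C, R, h1, h2, h3, h4, h5, h6⟩
  refine ⟨C, mem_nhdsWithin_of_mem_nhds (h1.mem_nhds h3), h3, ?_⟩
  exact h6.congr (exp_eq_of_starConvex hF h1 h2 h4 h5 h6).2 0 (by simp)

theorem notMem_sing_of_mem_dom (hF : F.IsTranslation) {p : X} {v : ℂ} (hv : v ∈ F.dom p) :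
    p ∉ F.sing := by
  have := (isDev_exp hF p).2 0 (zero_mem_dom_of_mem hv)
  rwa [exp_zero] at this

theorem exp_notMem_sing (hF : F.IsTranslation) {p : X} {v : ℂ} (hv : v ∈ F.dom p) :
    F.exp p v ∉ F.sing := (isDev_exp hF p).2 v hv

theorem exp_continuousOn (hF : F.IsTranslation) (p : X) : ContinuousOn (F.exp p) (F.dom p) :=
  (isDev_exp hF p).1

theorem exp_continuousAt (hF : F.IsTranslation) {p : X} {v : ℂ} (hv : v ∈ F.dom p) :
    ContinuousAt (F.exp p) v :=
  (exp_continuousOn hF p).continuousAt ((isOpen_dom p).mem_nhds hv)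

/-- The segment to `v` exists if a neighbourhood of it can be developed. -/
theorem mem_dom_of_segment (hF : F.IsTranslation) {p : X} {C : Set ℂ} {R : ℂ → X} (hC : IsOpen C)
    {v : ℂ} (hv : segment ℝ 0 v ⊆ C) (hR : R 0 = p) (hd : F.IsDev R id C) :
    v ∈ F.dom p ∧ F.exp p v = R v := by
  have hcomp : IsCompact (segment ℝ (0:ℂ) v) := by
    rw [segment_eq_image_lineMap]
    exact isCompact_Icc.image (by fun_prop)
  obtain ⟨δ, hδ, hsub⟩ := hcomp.exists_thickening_subset_open hC hv
  have hconv : Convex ℝ (Metric.thickening δ (segment ℝ (0:ℂ) v)) :=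
    (convex_segment _ _).thickening δ
  have hs := Metric.self_subset_thickening hδ (segment ℝ (0:ℂ) v)
  have h0 : (0:ℂ) ∈ Metric.thickening δ (segment ℝ (0:ℂ) v) := hs (left_mem_segment ℝ _ _)
  have := exp_eq_of_starConvex hF Metric.isOpen_thickening (hconv.starConvex h0) h0 hR
    (hd.mono hsub)
  exact ⟨this.1 (hs (right_mem_segment ℝ _ _)), this.2 (hs (right_mem_segment ℝ _ _))⟩

/-- Change of the base point of the exponential map. -/
theorem exp_exp (hF : F.IsTranslation) {p : X} {v u : ℂ} (h : segment ℝ v (v + u) ⊆ F.dom p) :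
    u ∈ F.dom (F.exp p v) ∧ F.exp (F.exp p v) u = F.exp p (v + u) := by
  have hc : Continuous fun z : ℂ => v + z := by fun_prop
  have hd : F.IsDev (fun z => F.exp p (v + z)) id ((fun z : ℂ => v + z) ⁻¹' F.dom p) :=
    ((isDev_exp hF p).comp (f := fun z : ℂ => v + z) hc.continuousOn
      (fun z hz => hz)).congr_dev (-v)
      (by intro z _; simp)
  refine mem_dom_of_segment hF ((isOpen_dom p).preimage hc) ?_ (by simp) hd
  rintro z hz
  apply h
  have := (mem_segment_translate ℝ v (x := z) (b := 0) (c := u)).2 hz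
  simpa using this

theorem exp_exp_of_convex (hF : F.IsTranslation) {p : X} {A : Set ℂ} (hA : Convex ℝ A)
    (hAd : A ⊆ F.dom p) {v w : ℂ} (hv : v ∈ A) (hw : w ∈ A) :
    w - v ∈ F.dom (F.exp p v) ∧ F.exp (F.exp p v) (w - v) = F.exp p w := by
  have := exp_exp hF (p := p) (v := v) (u := w - v)
    (by rw [add_sub_cancel]; exact (hA.segment_subset hv hw).trans hAd)
  rwa [add_sub_cancel] at this

/-- Concatenation of straight segments. -/
theorem mem_dom_concat (hF : F.IsTranslation) {p : X} {v u : ℂ} (hv : v ∈ F.dom p)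
    (hu : u ∈ F.dom (F.exp p v))
    (hs : segment ℝ 0 (v + u) ⊆ segment ℝ 0 v ∪ segment ℝ v (v + u)) :
    v + u ∈ F.dom p ∧ F.exp p (v + u) = F.exp (F.exp p v) u := by
  have hcomp : ∀ a b : ℂ, IsCompact (segment ℝ a b) := fun a b => by
    rw [segment_eq_image_lineMap]
    exact isCompact_Icc.image (by fun_prop)
  have hc : Continuous fun z : ℂ => z - v := by fun_prop
  have hopen := (isOpen_dom (F := F) (F.exp p v)).preimage hc
  have hsub2 : segment ℝ v (v + u) ⊆ (fun z : ℂ => z - v) ⁻¹' F.dom (F.exp p v) := by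
    intro z hz
    apply segment_subset_dom hu
    have := (mem_segment_translate ℝ v (x := z - v) (b := 0) (c := u)).1 (by simpa using hz)
    exact this
  obtain ⟨δ, hδ, h1⟩ := (hcomp 0 v).exists_thickening_subset_open (isOpen_dom p)
    (segment_subset_dom hv)
  obtain ⟨δ', hδ', h2⟩ := (hcomp v (v + u)).exists_thickening_subset_open hopen hsub2
  have d2 : F.IsDev (fun z => F.exp (F.exp p v) (z - v)) id
      ((fun z : ℂ => z - v) ⁻¹' F.dom (F.exp p v)) :=
    ((isDev_exp hF _).comp (f := fun z : ℂ => z - v) hc.continuousOn (fun z hz => hz)).congr_dev v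
      (by intro z _; simp)
  have m1 := Metric.self_subset_thickening hδ (segment ℝ (0:ℂ) v)
  have m2 := Metric.self_subset_thickening hδ' (segment ℝ v (v + u))
  obtain ⟨R, hR, e1, e2⟩ := IsDev.union hF ((isDev_exp hF p).mono h1) (d2.mono h2)
    Metric.isOpen_thickening Metric.isOpen_thickening
    (((convex_segment _ _).thickening δ).inter ((convex_segment _ _).thickening δ')).isPreconnected
    (z₀ := v) ⟨m1 (right_mem_segment ℝ _ _), m2 (left_mem_segment ℝ _ _)⟩ (by simp [exp_zero])
  have := mem_dom_of_segment hF (Metric.isOpen_thickening.union Metric.isOpen_thickening)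
    (hs.trans (union_subset_union m1 m2)) (R := R) (p := p)
    (by rw [e1 (m1 (left_mem_segment ℝ _ _)), exp_zero]) hR
  refine ⟨this.1, ?_⟩
  rw [this.2, e2 (m2 (right_mem_segment ℝ _ _))]
  simp

/-- Collinear segments can be concatenated. -/
theorem exp_smul_add (hF : F.IsTranslation) {p : X} {v : ℂ} {a b : ℝ} (ha : a • v ∈ F.dom p)
    (hb : b • v ∈ F.dom (F.exp p (a • v))) :
    (a + b) • v ∈ F.dom p ∧ F.exp p ((a + b) • v) = F.exp (F.exp p (a • v)) (b • v) := by
  rw [add_smul]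
  exact mem_dom_concat hF ha hb (segment_smul_subset v a b)

end T2

end FlatStructure

/-! ### Discs, exits and saddle connections -/

namespace FlatStructure

variable {X : Type*} [TopologicalSpace X] {F : FlatStructure X}

/-- The first time at which a straight path ends exists, since the domain is open. -/
theorem exists_exit {p : X} {v : ℂ} (h0 : 0 ∈ F.dom p) (hv : v ∉ F.dom p) :
    ∃ β ∈ Ioc (0:ℝ) 1, β • v ∉ F.dom p ∧ ∀ s ∈ Ico (0:ℝ) β, s • v ∈ F.dom p := by
  have hcl : IsClosed {s : ℝ | s • v ∉ F.dom p} :=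
    ((isOpen_dom p).preimage (by fun_prop : Continuous fun s : ℝ => s • v)).isClosed_compl
  obtain ⟨β, ⟨hβ1, hβ2⟩, hβ3⟩ := (isCompact_Icc.inter_right hcl).exists_isLeast
    ⟨(1:ℝ), right_mem_Icc.2 zero_le_one, by simpa using hv⟩
  refine ⟨β, ⟨lt_of_le_of_ne hβ1.1 ?_, hβ1.2⟩, hβ2, fun s hs => ?_⟩
  · rintro rfl
    exact hβ2 (by simpa using h0)
  · by_contra hc
    exact absurd (hβ3 ⟨⟨hs.1, hs.2.le.trans hβ1.2⟩, hc⟩) (not_le.2 hs.2)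

section T2
variable [T2Space X]

/-- Around a regular point the exponential map is injective and open on a small disc. -/
theorem exists_disc (hF : F.IsTranslation) {p : X} (hp : p ∉ F.sing) :
    ∃ r > 0, Metric.ball 0 r ⊆ F.dom p ∧ InjOn (F.exp p) (Metric.ball 0 r) ∧
      ∀ V ⊆ Metric.ball (0 : ℂ) r, IsOpen V → IsOpen (F.exp p '' V) := by
  obtain ⟨φ, hφ, hpφ⟩ := hF.exists_chart p hp
  have hop := φ.isOpen_inter_preimage_symm hF.finite_sing.isClosed.isOpen_compl
  obtain ⟨r, hr, hsub⟩ := Metric.isOpen_iff.1 hop (φ p)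
    ⟨φ.map_source hpφ, by simpa [φ.left_inv hpφ] using hp⟩
  have hm : ∀ z ∈ Metric.ball (0 : ℂ) r, φ p + z ∈ Metric.ball (φ p) r := by
    intro z hz; simpa using hz
  have hc : ContinuousOn (fun z => φ.symm (φ p + z)) (Metric.ball 0 r) :=
    φ.symm.continuousOn.comp (by fun_prop) fun z hz => (hsub (hm z hz)).1
  have hd : F.IsDev (fun z => φ.symm (φ p + z)) id (Metric.ball 0 r) := by
    refine ⟨hc, fun z hz => (hsub (hm z hz)).2, fun z hz ψ hψ hx => ?_⟩
    have h1 := hF.compat ψ hψ φ hφ _ hx (φ.symm.map_source (hsub (hm z hz)).1)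
    filter_upwards [(hc z hz).eventually h1, eventually_mem_nhdsWithin] with w hw hwr
    rw [φ.right_inv (hsub (hm z hz)).1, φ.right_inv (hsub (hm w hwr)).1] at hw
    simp only [id]
    linear_combination hw
  have h0 : (0:ℂ) ∈ Metric.ball (0:ℂ) r := by simpa using hr
  obtain ⟨h1, h2⟩ := exp_eq_of_starConvex hF Metric.isOpen_ball
    ((convex_ball (0:ℂ) r).starConvex h0) h0 (p := p) (by simp [φ.left_inv hpφ]) hd
  refine ⟨r, hr, h1, ?_, ?_⟩
  · intro z hz w hw hzw
    rw [h2 hz, h2 hw] at hzw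
    have := φ.symm.injOn (hsub (hm z hz)).1 (hsub (hm w hw)).1 hzw
    exact add_left_cancel this
  · intro V hV hVo
    have : F.exp p '' V = φ.symm '' ((fun z => φ p + z) '' V) := by
      rw [image_image]
      exact image_congr fun z hz => h2 (hV hz)
    rw [this]
    apply φ.isOpen_image_symm_of_subset_target
    · exact (Homeomorph.addLeft (φ p)).isOpenMap V hVo
    · rintro _ ⟨z, hz, rfl⟩
      exact (hsub (hm z (hV hz))).1

theorem zero_mem_dom (hF : F.IsTranslation) {p : X} (hp : p ∉ F.sing) : 0 ∈ F.dom p := by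
  obtain ⟨r, hr, h, _⟩ := exists_disc hF hp
  exact h (by simpa using hr)

/-- The exponential map is open. -/
theorem isOpen_image_exp (hF : F.IsTranslation) {p : X} {V : Set ℂ} (hV : V ⊆ F.dom p)
    (hVo : IsOpen V) : IsOpen (F.exp p '' V) := by
  rw [isOpen_iff_mem_nhds]
  rintro _ ⟨v, hv, rfl⟩
  obtain ⟨r, hr, h1, h2, h3⟩ := exists_disc hF (exp_notMem_sing hF (hV hv))
  obtain ⟨ρ, hρ, hsub⟩ := Metric.isOpen_iff.1 hVo v hv
  have hmin : 0 < min r ρ := lt_min hr hρ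
  have := (h3 (Metric.ball 0 (min r ρ)) (Metric.ball_subset_ball (min_le_left _ _))
    Metric.isOpen_ball).mem_nhds ⟨0, by simpa using hmin, exp_zero _⟩
  refine mem_of_superset this ?_
  rintro _ ⟨z, hz, rfl⟩
  have hz' : v + z ∈ Metric.ball v ρ := by
    simpa using (Metric.ball_subset_ball (min_le_right r ρ) hz)
  refine ⟨v + z, hsub hz', ?_⟩
  have := exp_exp_of_convex hF (convex_ball v ρ) (hsub.trans hV) (Metric.mem_ball_self hρ) hz'
  rw [add_sub_cancel_left] at this
  exact this.2.symm

theorem exp_image_mem_nhds (hF : F.IsTranslation) {p : X} {V : Set ℂ}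
    (hV : V ∈ 𝓝 (0:ℂ)) (hVd : V ⊆ F.dom p) : F.exp p '' V ∈ 𝓝 p := by
  have h := isOpen_image_exp hF (interior_subset.trans hVd) (isOpen_interior (s := V))
  exact mem_of_superset (h.mem_nhds ⟨0, mem_interior_iff_mem_nhds.2 hV, exp_zero p⟩)
    (image_mono interior_subset)

/-- A straight path that cannot be prolonged runs into a singular point. -/
theorem exists_tendsto_sing [CompactSpace X] (hF : F.IsTranslation) {p : X} {v : ℂ}
    (h : ∀ s ∈ Ico (0:ℝ) 1, s • v ∈ F.dom p) (hv : v ∉ F.dom p) :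
    ∃ P ∈ F.sing, Tendsto (fun s : ℝ => F.exp p (s • v)) (𝓝[<] 1) (𝓝 P) := by
  have hl : ∀ᶠ s : ℝ in 𝓝[<] 1, s ∈ Ico (0:ℝ) 1 := Ico_mem_nhdsLT (by norm_num)
  -- A regular limit point has a disc around it, in which the path could be prolonged.
  have hcl : ∀ q, MapClusterPt q (𝓝[<] (1:ℝ)) (fun s : ℝ => F.exp p (s • v)) → q ∈ F.sing := by
    intro q hq
    by_contra hqs
    obtain ⟨r, hr, h1, h2, h3⟩ := exists_disc hF hqs
    have hn : F.exp q '' Metric.ball 0 (r/2) ∈ 𝓝 q :=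
      exp_image_mem_nhds hF (Metric.ball_mem_nhds _ (by positivity))
        ((Metric.ball_subset_ball (by linarith)).trans h1)
    have hsm : ∀ᶠ s : ℝ in 𝓝[<] 1, ‖(1 - s) • v‖ < r / 2 := by
      have : Tendsto (fun s : ℝ => ‖(1 - s) • v‖) (𝓝[<] 1) (𝓝 ‖(1 - (1:ℝ)) • v‖) :=
        ((by fun_prop : Continuous fun s : ℝ => ‖(1 - s) • v‖).tendsto 1).mono_left
          nhdsWithin_le_nhds
      exact this.eventually (gt_mem_nhds (by simpa using hr))
    obtain ⟨s, ⟨z, hz, hzs⟩, hs1, hs2⟩ := ((hq.frequently hn).and_eventually (hl.and hsm)).exists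
    apply hv
    have hb : (1 - s) • v ∈ F.dom (F.exp q z) := by
      have := exp_exp_of_convex hF (convex_ball (0:ℂ) r) h1 (v := z) (w := z + (1 - s) • v)
        (Metric.ball_subset_ball (by linarith) hz) (by
          rw [mem_ball_zero_iff] at hz ⊢
          linarith [norm_add_le z ((1 - s) • v)])
      rw [add_sub_cancel_left] at this
      exact this.1
    rw [hzs] at hb
    have := (exp_smul_add hF (h s hs1) hb).1
    simpa using this
  obtain ⟨P, -, hP⟩ := isCompact_univ.exists_mapClusterPt_of_frequently
    (l := 𝓝[<] (1:ℝ)) (f := fun s : ℝ => F.exp p (s • v)) (Frequently.of_forall fun _ => mem_univ _)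
  refine ⟨P, hcl P hP, ?_⟩
  -- Since the path is connected and the singular points are isolated, there is only one limit
  -- point.
  obtain ⟨U, V, hU, hV, hPU, hsV, hUV⟩ := SeparatedNhds.of_isCompact_isCompact
    (isCompact_singleton (x := P)) (hF.finite_sing.sdiff (t := {P})).isCompact
    disjoint_sdiff_right
  rw [tendsto_nhds]
  intro N hN hPN
  have ho : IsOpen ((N ∩ U) ∪ V) := (hN.inter hU).union hV
  have hev : ∀ᶠ s : ℝ in 𝓝[<] 1, F.exp p (s • v) ∈ (N ∩ U) ∪ V := by
    by_contra hcon
    obtain ⟨Q, hQ, hQc⟩ := ho.isClosed_compl.isCompact.exists_mapClusterPt_of_frequently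
      (not_eventually.1 hcon)
    apply hQ
    by_cases hQP : Q = P
    · exact Or.inl (hQP ▸ ⟨hPN, hPU rfl⟩)
    · exact Or.inr (hsV ⟨hcl Q hQc, hQP⟩)
  obtain ⟨s₀, hs₀, hs₀'⟩ := (mem_nhdsLT_iff_exists_Ioo_subset).1 (hev.and hl)
  have hpre : IsPreconnected ((fun s : ℝ => F.exp p (s • v)) '' Ioo s₀ 1) := by
    refine isPreconnected_Ioo.image _ ((exp_continuousOn hF p).comp (by fun_prop) ?_)
    intro s hs
    exact h s (hs₀' hs).2
  obtain ⟨s₁, hs₁, hs₁'⟩ : ∃ s ∈ Ioo s₀ 1, F.exp p (s • v) ∈ N ∩ U := by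
    have := (hP.frequently ((hN.inter hU).mem_nhds ⟨hPN, hPU rfl⟩)).and_eventually
      (Ioo_mem_nhdsLT hs₀)
    obtain ⟨s, h1, h2⟩ := this.exists
    exact ⟨s, h2, h1⟩
  have hsub : (fun s : ℝ => F.exp p (s • v)) '' Ioo s₀ 1 ⊆ N ∩ U :=
    hpre.subset_left_of_subset_union (hN.inter hU) hV
    (hUV.mono_left inter_subset_right) (by rintro _ ⟨s, hs, rfl⟩; exact (hs₀' hs).1)
    ⟨F.exp p (s₁ • v), mem_image_of_mem _ hs₁, hs₁'⟩
  filter_upwards [Ioo_mem_nhdsLT hs₀] with s hs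
  exact (hsub (mem_image_of_mem _ hs)).1

/-- A straight path through a regular point that ends in both directions is a saddle connection. -/
theorem exists_saddle [CompactSpace X] (hF : F.IsTranslation) {p : X} {v : ℂ} (hp : p ∉ F.sing)
    {α β : ℝ} (hα : 0 < α) (hβ : 0 < β)
    (h1 : ∀ s ∈ Ico (0:ℝ) β, s • v ∈ F.dom p) (h2 : β • v ∉ F.dom p)
    (h3 : ∀ s ∈ Ico (0:ℝ) α, (-s) • v ∈ F.dom p) (h4 : (-α) • v ∉ F.dom p) :
    ∃ γ, F.IsSaddleConnection γ ((α + β) • v) := by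
  have hab : 0 < α + β := by positivity
  obtain ⟨P, hP, hPt⟩ := exists_tendsto_sing hF (v := β • v) (p := p) (fun s hs => by
    rw [smul_smul]; exact h1 _ ⟨by nlinarith [hs.1], by nlinarith [hs.2]⟩) h2
  obtain ⟨Q, hQ, hQt⟩ := exists_tendsto_sing hF (v := (-α) • v) (p := p) (fun s hs => by
    rw [smul_smul, mul_neg]; exact h3 _ ⟨by nlinarith [hs.1], by nlinarith [hs.2]⟩) h4
  -- The segment from `-α • v` to `β • v`, parametrized by `[0, 1]`.
  set a : ℝ → ℂ := fun u => (-α + u * (α + β)) • v with ha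
  have hac : Continuous a := by fun_prop
  have had : ∀ u ∈ Ioo (0:ℝ) 1, a u ∈ F.dom p := by
    intro u hu
    rcases le_total 0 (-α + u * (α + β)) with h | h
    · exact h1 _ ⟨h, by nlinarith [hu.2]⟩
    · have := h3 (-(-α + u * (α + β))) ⟨by linarith, by nlinarith [hu.1]⟩
      rwa [neg_neg] at this
  have hfc : ContinuousOn (F.exp p ∘ a) (Ioo 0 1) :=
    (exp_continuousOn hF p).comp hac.continuousOn had
  have hR : Tendsto (F.exp p ∘ a) (𝓝[<] 1) (𝓝 P) := by
    have : Tendsto (fun u : ℝ => (-α + u * (α + β)) / β) (𝓝[<] 1) (𝓝[<] 1) := by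
      rw [tendsto_nhdsWithin_iff]
      constructor
      · have := (by fun_prop : Continuous fun u : ℝ => (-α + u * (α + β)) / β).tendsto 1
        have h : (-α + 1 * (α + β)) / β = 1 := by field_simp; ring
        rw [h] at this
        exact this.mono_left nhdsWithin_le_nhds
      · filter_upwards [self_mem_nhdsWithin] with u hu
        rw [mem_Iio, div_lt_one hβ]
        have : u < 1 := hu
        nlinarith
    refine (hPt.comp this).congr fun u => ?_
    simp only [Function.comp, ha]
    rw [smul_smul, div_mul_cancel₀ _ hβ.ne']
  have hL : Tendsto (F.exp p ∘ a) (𝓝[>] 0) (𝓝 Q) := by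
    have : Tendsto (fun u : ℝ => -(-α + u * (α + β)) / α) (𝓝[>] 0) (𝓝[<] 1) := by
      rw [tendsto_nhdsWithin_iff]
      constructor
      · have := (by fun_prop : Continuous fun u : ℝ => -(-α + u * (α + β)) / α).tendsto 0
        have h : -(-α + 0 * (α + β)) / α = 1 := by field_simp; ring
        rw [h] at this
        exact this.mono_left nhdsWithin_le_nhds
      · filter_upwards [self_mem_nhdsWithin] with u hu
        rw [mem_Iio, div_lt_one hα]
        have : 0 < u := hu
        nlinarith
    refine (hQt.comp this).congr fun u => ?_
    simp only [Function.comp, ha]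
    rw [smul_smul, mul_neg, div_mul_cancel₀ _ hα.ne', neg_neg]
  have hex : EqOn (extendFrom (Ioo 0 1) (F.exp p ∘ a)) (F.exp p ∘ a) (Ioo 0 1) := fun u hu =>
    extendFrom_eq (subset_closure hu) (hfc u hu)
  refine ⟨extendFrom (Ioo 0 1) (F.exp p ∘ a), ?_, ?_, ?_, ?_, ?_⟩
  · intro h0
    rcases smul_eq_zero.1 h0 with h | h
    · exact hab.ne' h
    · subst h
      exact h2 (by simpa using zero_mem_dom hF hp)
  · exact continuousOn_Icc_extendFrom_Ioo hfc hL hR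
  · rw [eq_lim_at_left_extendFrom_Ioo zero_lt_one hL]; exact hQ
  · rw [eq_lim_at_right_extendFrom_Ioo zero_lt_one hR]; exact hP
  · rw [← isDev_line_iff]
    refine (((isDev_exp hF p).comp hac.continuousOn had).congr hex (α • v) ?_)
    intro u _
    simp only [Function.comp, ha, id, Complex.real_smul]
    push_cast; ring

end T2

/-- Post-composition of the charts with a real-linear map. Only reflections are used, to exchange up
and down or left and right. -/
def post (F : FlatStructure X) (L : ℂ ≃L[ℝ] ℂ) : FlatStructure X where
  sing := F.sing
  charts := (fun φ => φ.transHomeomorph L.toHomeomorph) '' F.charts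

theorem isDev_post_iff {E : Type*} [TopologicalSpace E] {R : E → X} {d : E → ℂ} {C : Set E}
    (L : ℂ ≃L[ℝ] ℂ) : (F.post L).IsDev R (L ∘ d) C ↔ F.IsDev R d C := by
  constructor
  · rintro ⟨h1, h2, h3⟩
    refine ⟨h1, h2, fun z hz φ hφ hx => ?_⟩
    filter_upwards [h3 z hz _ ⟨φ, hφ, rfl⟩ hx] with w hw
    apply L.injective
    rw [map_add, map_sub]
    exact hw
  · rintro ⟨h1, h2, h3⟩
    refine ⟨h1, h2, ?_⟩
    rintro z hz _ ⟨φ, hφ, rfl⟩ hx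
    filter_upwards [h3 z hz _ hφ hx] with w hw
    change L (φ (R w)) = L (φ (R z)) + (L (d w) - L (d z))
    rw [hw, map_add, map_sub]

theorem IsTranslation.post (hF : F.IsTranslation) (L : ℂ ≃L[ℝ] ℂ) : (F.post L).IsTranslation where
  finite_sing := hF.finite_sing
  nonempty_sing := hF.nonempty_sing
  preconnected := hF.preconnected
  exists_chart x hx := by
    obtain ⟨φ, hφ, h⟩ := hF.exists_chart x hx
    exact ⟨_, ⟨φ, hφ, rfl⟩, h⟩
  compat := by
    rintro _ ⟨φ, hφ, rfl⟩ _ ⟨ψ, hψ, rfl⟩ x hx hx'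
    filter_upwards [hF.compat φ hφ ψ hψ x hx hx'] with y hy
    change L (φ y) - L (φ x) = L (ψ y) - L (ψ x)
    rw [← map_sub, hy, map_sub]
  primitive := by
    intro p hp
    obtain ⟨U, G, h1, h2, h3, h4, h5, h6, h7⟩ := hF.primitive p hp
    refine ⟨U, L ∘ G, h1, h2, L.continuous.comp_continuousOn h3, fun x hx hxp => ?_, fun c => ?_,
      ?_, ?_⟩
    · exact ⟨(h4 x hx hxp).1, fun h => (h4 x hx hxp).2 (L.injective h)⟩
    · refine (h5 (L.symm c)).subset ?_
      rintro x ⟨hx, hc⟩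
      exact ⟨hx, by rw [← (hc : L (G x) = c)]; simp⟩
    · rw [← Filter.map_map, Function.comp, ← L.map_nhds_eq]
      exact map_mono h6
    · rintro x hx hxp _ ⟨φ, hφ, rfl⟩ hs
      filter_upwards [h7 x hx hxp φ hφ hs] with y hy
      change L (G y) - L (G x) = L (φ y) - L (φ x)
      rw [← map_sub, hy, map_sub]

theorem mem_dom_post (L : ℂ ≃L[ℝ] ℂ) {p : X} {v : ℂ} (h : v ∈ F.dom p) :
    L v ∈ (F.post L).dom p := by
  obtain ⟨C, R, h1, h2, h3, h4, h5, h6⟩ := h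
  refine ⟨L '' C, R ∘ L.symm, L.toHomeomorph.isOpenMap C h1, ?_, ⟨v, h3, rfl⟩, ⟨0, h4, by simp⟩,
    by simpa using h5, ?_⟩
  · have := h2.linear_image (L : ℂ →ₗ[ℝ] ℂ)
    simpa using this
  · have := (isDev_post_iff L).2 (h6.comp (f := L.symm) (C' := L '' C)
      L.symm.continuous.continuousOn
      (by rintro _ ⟨x, hx, rfl⟩; simpa using hx))
    refine this.congr_dev 0 ?_
    intro z _; simp

section T2
variable [T2Space X]

theorem mem_dom_post_iff (hF : F.IsTranslation) (L : ℂ ≃L[ℝ] ℂ) {p : X} {v : ℂ} :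
    L v ∈ (F.post L).dom p ↔ v ∈ F.dom p := by
  refine ⟨fun h => ?_, mem_dom_post L⟩
  have hF' := hF.post L
  have hd : F.IsDev ((F.post L).exp p ∘ L) id (L ⁻¹' (F.post L).dom p) := by
    rw [← isDev_post_iff L]
    exact (isDev_exp hF' p).comp L.continuous.continuousOn (fun _ h => h)
  refine (mem_dom_of_segment hF ((isOpen_dom p).preimage L.continuous) ?_
    (by simp [exp_zero]) hd).1
  intro z hz
  refine segment_subset_dom h ?_
  have := image_segment ℝ (L : ℂ →ₗ[ℝ] ℂ).toAffineMap 0 v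
  simp only [LinearMap.coe_toAffineMap, map_zero] at this
  exact this ▸ mem_image_of_mem _ hz

theorem exp_post (hF : F.IsTranslation) (L : ℂ ≃L[ℝ] ℂ) {p : X} {v : ℂ} (h : v ∈ F.dom p) :
    (F.post L).exp p (L v) = F.exp p v := by
  have hF' := hF.post L
  have hd : F.IsDev ((F.post L).exp p ∘ L) id (F.dom p) := by
    rw [← isDev_post_iff L]
    exact (isDev_exp hF' p).comp L.continuous.continuousOn (fun _ h => mem_dom_post L h)
  have := (exp_eq_of_starConvex hF (isOpen_dom p) (starConvex_dom p) (zero_mem_dom_of_mem h)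
    (p := p) (by simp [exp_zero]) hd).2 h
  exact this.symm

end T2

end FlatStructure

/-! ### The vertical flow -/

namespace FlatStructure

variable {X : Type*} [TopologicalSpace X] {F : FlatStructure X}

/-- The times for which the unit speed vertical flow is defined at `q`. -/
def flowDom (F : FlatStructure X) (q : X) : Set ℝ := {s | s • Complex.I ∈ F.dom q}

/-- The unit speed vertical flow. Its value is `q` at times that are not in `F.flowDom q`. -/
def flow (F : FlatStructure X) (q : X) (s : ℝ) : X := F.exp q (s • Complex.I)

theorem zero_mem_flowDom_of_mem {q : X} {s : ℝ} (h : s ∈ F.flowDom q) : 0 ∈ F.flowDom q := by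
  have := zero_mem_dom_of_mem h
  simpa [flowDom] using this

theorem flow_zero (q : X) : F.flow q 0 = q := by simp [flow, exp_zero]

theorem ordConnected_flowDom (q : X) : (F.flowDom q).OrdConnected := by
  rcases (F.flowDom q).eq_empty_or_nonempty with h | ⟨s, hs⟩
  · rw [h]; exact ordConnected_empty
  · have : StarConvex ℝ 0 (F.flowDom q) := by
      intro s hs a b ha hb hab
      have := starConvex_dom q hs ha hb hab
      simp only [smul_zero, zero_add] at this ⊢
      rwa [smul_smul] at this
    exact (starConvex_iff_ordConnected (zero_mem_flowDom_of_mem hs)).1 this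

theorem smul_I_eq (s : ℝ) : s • Complex.I = (⟨0, s⟩ : ℂ) := by
  apply Complex.ext <;> simp

/-- A local primitive at a singular point, with a lower bound at the boundary of its domain. -/
theorem exists_primitive [CompactSpace X] (hF : F.IsTranslation) {p : X} (hp : p ∈ F.sing) :
    ∃ (U : Set X) (G : X → ℂ) (ρ : ℝ), 0 < ρ ∧ IsOpen U ∧ p ∈ U ∧
    ContinuousOn G (closure U) ∧ (∀ x ∈ closure U, x ≠ p → x ∉ F.sing ∧ G x ≠ G p) ∧
    (∀ c, (U ∩ G ⁻¹' {c}).Finite) ∧ 𝓝 (G p) ≤ map G (𝓝 p) ∧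
    (∀ x ∈ U, x ≠ p → ∀ φ ∈ F.charts, x ∈ φ.source → ∀ᶠ y in 𝓝 x, G y - G x = φ y - φ x) ∧
    ∀ x ∈ frontier U, ρ ≤ ‖G x - G p‖ := by
  obtain ⟨U, G, h1, h2, h3, h4, h5, h6, h7⟩ := hF.primitive p hp
  have hfs : frontier U ⊆ closure U := frontier_subset_closure
  rcases (frontier U).eq_empty_or_nonempty with he | hne
  · exact ⟨U, G, 1, one_pos, h1, h2, h3, h4, h5, h6, h7, by simp [he]⟩
  · obtain ⟨x, hx, hmin⟩ := isClosed_frontier.isCompact.exists_isMinOn hne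
      (((h3.mono hfs).sub continuousOn_const).norm (f := fun x => G x - G p))
    refine ⟨U, G, ‖G x - G p‖, ?_, h1, h2, h3, h4, h5, h6, h7, fun y hy => hmin hy⟩
    rw [norm_pos_iff, sub_ne_zero]
    refine (h4 x (hfs hx) ?_).2
    rintro rfl
    rw [h1.frontier_eq] at hx
    exact hx.2 h2

section T2
variable [T2Space X]

theorem flow_continuousOn (hF : F.IsTranslation) (q : X) : ContinuousOn (F.flow q) (F.flowDom q) :=
  (exp_continuousOn hF q).comp (by fun_prop) fun _ h => h

theorem isDev_flow (hF : F.IsTranslation) (q : X) :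
    F.IsDev (F.flow q) (fun s : ℝ => s • Complex.I) (F.flowDom q) :=
  (isDev_exp hF q).comp (f := fun s : ℝ => s • Complex.I) (by fun_prop) fun _ h => h

theorem zero_mem_flowDom (hF : F.IsTranslation) {q : X} (hq : q ∉ F.sing) : 0 ∈ F.flowDom q := by
  simpa [flowDom] using zero_mem_dom hF hq

theorem flow_notMem_sing (hF : F.IsTranslation) {q : X} {s : ℝ} (h : s ∈ F.flowDom q) :
    F.flow q s ∉ F.sing := exp_notMem_sing hF h

theorem notMem_sing_of_mem_flowDom (hF : F.IsTranslation) {q : X} {s : ℝ} (h : s ∈ F.flowDom q) :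
    q ∉ F.sing := notMem_sing_of_mem_dom hF h

theorem flow_add (hF : F.IsTranslation) {q : X} {s r : ℝ} (hs : s ∈ F.flowDom q)
    (hr : r ∈ F.flowDom (F.flow q s)) :
    s + r ∈ F.flowDom q ∧ F.flow q (s + r) = F.flow (F.flow q s) r :=
  exp_smul_add hF hs hr

theorem flow_sub (hF : F.IsTranslation) {q : X} {s t : ℝ} (hs : s ∈ F.flowDom q)
    (ht : t ∈ F.flowDom q) :
    t - s ∈ F.flowDom (F.flow q s) ∧ F.flow (F.flow q s) (t - s) = F.flow q t := by
  have hA : Convex ℝ ((fun r : ℝ => r • Complex.I) '' (F.flowDom q)) :=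
    (ordConnected_flowDom q).convex.linear_image (LinearMap.toSpanSingleton ℝ ℂ Complex.I)
  have := exp_exp_of_convex hF (p := q) hA (by rintro _ ⟨r, hr, rfl⟩; exact hr)
    (mem_image_of_mem _ hs) (mem_image_of_mem _ ht)
  simp only [← sub_smul] at this
  exact this

theorem flow_neg (hF : F.IsTranslation) {q : X} {s : ℝ} (hs : s ∈ F.flowDom q) :
    -s ∈ F.flowDom (F.flow q s) ∧ F.flow (F.flow q s) (-s) = q := by
  have := flow_sub hF hs (zero_mem_flowDom_of_mem hs)
  rwa [zero_sub, flow_zero] at this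

theorem eventually_nhds_of_exp (hF : F.IsTranslation) {q : X} (hq : q ∉ F.sing) {P : X → Prop}
    (h : ∀ᶠ z in 𝓝 (0 : ℂ), P (F.exp q z)) : ∀ᶠ q' in 𝓝 q, P q' := by
  have := exp_image_mem_nhds hF (p := q)
    (h.and ((isOpen_dom q).mem_nhds (zero_mem_dom hF hq))) (fun z hz => hz.2)
  filter_upwards [this]
  rintro _ ⟨z, hz, rfl⟩
  exact hz.1

theorem isCompact_segment (a b : ℂ) : IsCompact (segment ℝ a b) := by
  rw [segment_eq_image_lineMap]
  exact isCompact_Icc.image (by fun_prop)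

/-- A neighbourhood of a vertical segment is a flow box. -/
theorem flow_box (hF : F.IsTranslation) {q : X} {σ : ℝ} (hσ : σ ∈ F.flowDom q) :
    ∀ᶠ z in 𝓝 (0 : ℂ), z ∈ F.dom q ∧ σ ∈ F.flowDom (F.exp q z) ∧ z + σ • Complex.I ∈ F.dom q ∧
      F.flow (F.exp q z) σ = F.exp q (z + σ • Complex.I) ∧ z ∈ F.dom (F.flow q σ) ∧
      F.exp (F.flow q σ) z = F.exp q (z + σ • Complex.I) := by
  obtain ⟨δ, hδ, hsub⟩ := (isCompact_segment 0 (σ • Complex.I)).exists_thickening_subset_open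
    (isOpen_dom q) (segment_subset_dom hσ)
  have hconv : Convex ℝ (Metric.thickening δ (segment ℝ (0:ℂ) (σ • Complex.I))) :=
    (convex_segment _ _).thickening δ
  have hm := Metric.self_subset_thickening hδ (segment ℝ (0:ℂ) (σ • Complex.I))
  filter_upwards [Metric.ball_mem_nhds (0:ℂ) hδ] with z hz
  have h1 : z ∈ Metric.thickening δ (segment ℝ (0:ℂ) (σ • Complex.I)) :=
    Metric.mem_thickening_iff.2 ⟨0, left_mem_segment ℝ _ _, hz⟩
  have h2 : z + σ • Complex.I ∈ Metric.thickening δ (segment ℝ (0:ℂ) (σ • Complex.I)) :=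
    Metric.mem_thickening_iff.2 ⟨σ • Complex.I, right_mem_segment ℝ _ _, by simpa using hz⟩
  have e1 := exp_exp_of_convex hF hconv hsub h1 h2
  have e2 := exp_exp_of_convex hF hconv hsub (hm (right_mem_segment ℝ _ _)) h2
  rw [add_sub_cancel_left] at e1
  rw [add_sub_cancel_right] at e2
  exact ⟨hsub h1, e1.1, hsub h2, e1.2, e2.1, e2.2⟩

/-- The coordinates of the points reached from `p` by a horizontal segment followed by a vertical
one. -/
def columns (F : FlatStructure X) (p : X) : Set ℂ :=
  {z | (z.re : ℂ) ∈ F.dom p ∧ z.im ∈ F.flowDom (F.exp p z.re)}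

theorem columns_local (hF : F.IsTranslation) {p : X} {z₀ : ℂ} (h : z₀ ∈ F.columns p) :
    ∀ᶠ z in 𝓝 z₀, z ∈ F.columns p ∧ z - z₀.re ∈ F.dom (F.exp p z₀.re) ∧
      F.flow (F.exp p z.re) z.im = F.exp (F.exp p z₀.re) (z - z₀.re) := by
  obtain ⟨h1, h2⟩ := h
  obtain ⟨δ, hδ, hsub⟩ := (isCompact_segment 0 (z₀.im • Complex.I)).exists_thickening_subset_open
    (isOpen_dom _) (segment_subset_dom h2)
  obtain ⟨ρ, hρ, hsub'⟩ := Metric.isOpen_iff.1 (isOpen_dom p) _ h1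
  have hconv : Convex ℝ (Metric.thickening δ (segment ℝ (0:ℂ) (z₀.im • Complex.I))) :=
    (convex_segment _ _).thickening δ
  filter_upwards [Metric.ball_mem_nhds z₀ (lt_min hδ hρ)] with z hz
  rw [Metric.mem_ball, dist_eq_norm] at hz
  have hre : ‖(z.re : ℂ) - z₀.re‖ < min δ ρ := by
    rw [← Complex.ofReal_sub, Complex.norm_real]
    exact (Complex.abs_re_le_norm (z - z₀)).trans_lt hz
  have hz1 : (z.re : ℂ) ∈ Metric.ball (z₀.re : ℂ) ρ := by
    rw [Metric.mem_ball, dist_eq_norm]; exact hre.trans_le (min_le_right _ _)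
  have e1 := exp_exp_of_convex hF (convex_ball (z₀.re : ℂ) ρ) hsub' (Metric.mem_ball_self hρ) hz1
  have m1 : (z.re : ℂ) - z₀.re ∈ Metric.thickening δ (segment ℝ (0:ℂ) (z₀.im • Complex.I)) :=
    Metric.mem_thickening_iff.2 ⟨0, left_mem_segment ℝ _ _, by
      rw [dist_zero_right]; exact hre.trans_le (min_le_left _ _)⟩
  have m2 : z - z₀.re ∈ Metric.thickening δ (segment ℝ (0:ℂ) (z₀.im • Complex.I)) :=
    Metric.mem_thickening_iff.2 ⟨_, right_mem_segment ℝ _ _, by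
      rw [dist_eq_norm]
      have : z - z₀.re - z₀.im • Complex.I = z - z₀ := by
        apply Complex.ext <;> simp
      rw [this]; exact hz.trans_le (min_le_left _ _)⟩
  have e2 := exp_exp_of_convex hF hconv hsub m1 m2
  have hz3 : z - z₀.re - (z.re - z₀.re) = z.im • Complex.I := by
    apply Complex.ext <;> simp
  rw [hz3, e1.2] at e2
  exact ⟨⟨hsub' hz1, e2.1⟩, hsub m2, e2.2⟩

theorem isOpen_columns (hF : F.IsTranslation) (p : X) : IsOpen (F.columns p) := by
  rw [isOpen_iff_mem_nhds]
  intro z hz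
  exact (columns_local hF hz).mono fun w hw => hw.1

theorem isDev_columns (hF : F.IsTranslation) (p : X) :
    F.IsDev (fun z => F.flow (F.exp p z.re) z.im) id (F.columns p) := by
  refine IsDev.of_locally fun z hz => ?_
  have hl := columns_local hF hz
  refine ⟨_, mem_nhdsWithin_of_mem_nhds hl, hl.self_of_nhds, ?_⟩
  refine IsDev.congr ((isDev_exp hF (F.exp p z.re)).comp (f := fun w : ℂ => w - z.re)
    (by fun_prop) (fun w hw => hw.2.1)) (fun w hw => hw.2.2) z.re ?_
  intro w _; simp

theorem columns_convex (hF : F.IsTranslation) {p : X} {A : Set ℂ} (hA : Convex ℝ A) (h0 : 0 ∈ A)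
    (hAc : A ⊆ F.columns p) :
    A ⊆ F.dom p ∧ ∀ z ∈ A, F.exp p z = F.flow (F.exp p z.re) z.im := by
  have key : ∀ z ∈ A, z ∈ F.dom p ∧ F.exp p z = F.flow (F.exp p z.re) z.im := fun z hz =>
    mem_dom_of_segment hF (isOpen_columns hF p) ((hA.segment_subset h0 hz).trans hAc)
      (by simp [flow_zero, exp_zero]) (isDev_columns hF p)
  exact ⟨fun z hz => (key z hz).1, fun z hz => (key z hz).2⟩

/-- A vertical path along which the primitive stays small cannot leave the neighbourhood. -/
theorem flow_mem_of_primitive (hF : F.IsTranslation) {p : X} (hp : p ∈ F.sing) {U : Set X}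
    {G : X → ℂ} {ρ : ℝ} (hU : IsOpen U) (hG : ContinuousOn G (closure U))
    (hd : ∀ x ∈ U, x ≠ p → ∀ φ ∈ F.charts, x ∈ φ.source → ∀ᶠ y in 𝓝 x, G y - G x = φ y - φ x)
    (hρ : ∀ x ∈ frontier U, ρ ≤ ‖G x - G p‖) {q : X} {J : Set ℝ} (hJ : J.OrdConnected)
    (hJd : J ⊆ F.flowDom q) {s₀ : ℝ} (hs₀ : s₀ ∈ J) (hqU : F.flow q s₀ ∈ U)
    (hsm : ∀ s ∈ J, ‖G (F.flow q s₀) + (s - s₀) • Complex.I - G p‖ < ρ) {s : ℝ} (hs : s ∈ J) :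
    F.flow q s ∈ U ∧ G (F.flow q s) = G (F.flow q s₀) + (s - s₀) • Complex.I := by
  have hc := (flow_continuousOn hF q).mono hJd
  have key := hJ.isPreconnected.eq_of_locally_eq (x := s₀) (y := s)
    (f := fun s => (F.flow q s ∈ U ∧ G (F.flow q s) = G (F.flow q s₀) + (s - s₀) • Complex.I))
    ?_ hs₀ hs
  · exact key.mp ⟨hqU, by simp⟩
  intro s hs
  by_cases hP : F.flow q s ∈ U ∧ G (F.flow q s) = G (F.flow q s₀) + (s - s₀) • Complex.I
  · obtain ⟨φ, hφ, hx⟩ := hF.exists_chart _ (flow_notMem_sing hF (hJd hs))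
    filter_upwards [(hc s hs).eventually (hU.mem_nhds hP.1),
      ((isDev_flow hF q).mono hJd).3 s hs φ hφ hx,
      (hc s hs).eventually (hd _ hP.1 (fun h => flow_notMem_sing hF (hJd hs) (h ▸ hp)) φ hφ hx)]
      with w h1 h2 h3
    simp only [eq_iff_iff, hP, and_self, iff_true]
    refine ⟨h1, ?_⟩
    rw [h2, sub_eq_iff_eq_add] at h3
    rw [h3, hP.2]
    module
  · have : ∀ᶠ w in 𝓝[J] s,
        ¬ (F.flow q w ∈ U ∧ G (F.flow q w) = G (F.flow q s₀) + (w - s₀) • Complex.I) := by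
      by_contra hcon
      rw [not_eventually] at hcon
      simp only [not_not] at hcon
      set l := 𝓝[J] s ⊓ 𝓟 {w | F.flow q w ∈ U ∧
        G (F.flow q w) = G (F.flow q s₀) + (w - s₀) • Complex.I} with hl
      have : l.NeBot := frequently_mem_iff_neBot.1 hcon
      have hfl : Tendsto (F.flow q) l (𝓝 (F.flow q s)) := (hc s hs).mono_left inf_le_left
      have hml : ∀ᶠ w in l, F.flow q w ∈ U ∧
        G (F.flow q w) = G (F.flow q s₀) + (w - s₀) • Complex.I :=
          mem_inf_of_right (mem_principal_self _)
      have hcl : F.flow q s ∈ closure U :=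
        mem_closure_of_tendsto hfl (hml.mono fun w hw => hw.1)
      have t1 : Tendsto (fun w => G (F.flow q w)) l (𝓝 (G (F.flow q s))) :=
        (hG _ hcl).tendsto.comp (tendsto_nhdsWithin_iff.2
          ⟨hfl, hml.mono fun w hw => subset_closure hw.1⟩)
      have t2 : Tendsto (fun w : ℝ => G (F.flow q s₀) + (w - s₀) • Complex.I) l
          (𝓝 (G (F.flow q s₀) + (s - s₀) • Complex.I)) :=
        ((by fun_prop : Continuous fun w : ℝ => G (F.flow q s₀) + (w - s₀) • Complex.I).tendsto
          s).mono_left (inf_le_left.trans nhdsWithin_le_nhds)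
      have heq := tendsto_nhds_unique (t1.congr' (hml.mono fun w hw => hw.2)) t2
      refine hP ⟨?_, heq⟩
      by_contra hnU
      have := hρ _ (by rw [hU.frontier_eq]; exact ⟨hcl, hnU⟩ : F.flow q s ∈ frontier U)
      rw [heq] at this
      exact absurd (hsm s hs) (not_lt.2 this)
    filter_upwards [this] with w hw
    simp only [hP, hw]

section Compact
variable [CompactSpace X]

/-- Vertical segments of length `3` leave a fixed neighbourhood of the singular points: on its
components the primitives vary by less than `2`. -/
theorem exists_compact_recurrent (hF : F.IsTranslation) : ∃ K : Set X, IsCompact K ∧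
    (∀ q ∈ K, q ∉ F.sing) ∧ ∀ q, 3 ∈ F.flowDom q → ∃ s ∈ Icc (0:ℝ) 3, F.flow q s ∈ K := by
  obtain ⟨W, hW, hWd⟩ := hF.finite_sing.t2_separation
  choose! U G h1 h2 h3 h4 h5 h6 h7 using hF.primitive
  set V : X → Set X := fun p => (U p ∩ G p ⁻¹' Metric.ball (G p p) 1) ∩ W p with hV
  have hVo : ∀ p ∈ F.sing, IsOpen (V p) := fun p hp =>
    (((h3 p hp).mono subset_closure).isOpen_inter_preimage (h1 p hp) Metric.isOpen_ball).inter
      (hW p).2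
  have hpV : ∀ p ∈ F.sing, p ∈ V p := fun p hp => ⟨⟨h2 p hp, by simp⟩, (hW p).1⟩
  refine ⟨(⋃ p ∈ F.sing, V p)ᶜ, (isOpen_biUnion hVo).isClosed_compl.isCompact, ?_, ?_⟩
  · intro q hq hqs
    exact hq (mem_biUnion hqs (hpV q hqs))
  · intro q hq
    by_contra! hcon
    have h0 := zero_mem_flowDom_of_mem hq
    have hsubD : Icc (0:ℝ) 3 ⊆ F.flowDom q := (ordConnected_flowDom q).out h0 hq
    have hU : ∀ s ∈ Icc (0:ℝ) 3, F.flow q s ∈ ⋃ p ∈ F.sing, V p := fun s hs =>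
      not_not.1 (hcon s hs)
    obtain ⟨p, hp, hqp⟩ := mem_iUnion₂.1 (hU 0 (by norm_num))
    have hpre : IsPreconnected (F.flow q '' Icc (0:ℝ) 3) :=
      isPreconnected_Icc.image _ ((flow_continuousOn hF q).mono hsubD)
    have hsub : F.flow q '' Icc (0:ℝ) 3 ⊆ V p := by
      refine hpre.subset_left_of_subset_union (hVo p hp)
        (isOpen_biUnion (s := F.sing \ {p}) fun p' hp' => hVo p' hp'.1) ?_ ?_
        ⟨_, mem_image_of_mem _ (by norm_num : (0:ℝ) ∈ Icc (0:ℝ) 3), hqp⟩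
      · rw [disjoint_iUnion₂_right]
        intro p' hp'
        exact (hWd hp hp'.1 (Ne.symm hp'.2)).mono inter_subset_right inter_subset_right
      · rintro _ ⟨s, hs, rfl⟩
        obtain ⟨p', hp', hsp⟩ := mem_iUnion₂.1 (hU s hs)
        by_cases hpp : p' = p
        · exact Or.inl (hpp ▸ hsp)
        · exact Or.inr (mem_biUnion ⟨hp', hpp⟩ hsp)
    have hpr := ((isDev_flow hF q).mono hsubD).primitive_sub hF isPreconnected_Icc (G := G p)
      (fun s hs φ hφ hx => h7 p hp _ (hsub (mem_image_of_mem _ hs)).1.1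
        (fun h => flow_notMem_sing hF (hsubD hs) (h ▸ hp)) φ hφ hx)
      (z := 0) (w := 3) (by norm_num) (by norm_num)
    have d1 : dist (G p (F.flow q 0)) (G p p) < 1 :=
      (hsub (mem_image_of_mem _ (by norm_num : (0:ℝ) ∈ Icc (0:ℝ) 3))).1.2
    have d2 : dist (G p (F.flow q 3)) (G p p) < 1 :=
      (hsub (mem_image_of_mem _ (by norm_num : (3:ℝ) ∈ Icc (0:ℝ) 3))).1.2
    have d3 : dist (G p (F.flow q 3)) (G p (F.flow q 0)) = 3 := by
      rw [dist_eq_norm, hpr]; simp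
    linarith [dist_triangle_right (G p (F.flow q 3)) (G p (F.flow q 0)) (G p p)]

/-- Some vertical ray ends at a singular point: since the primitive `G` at a singular point `p` is
open, it takes the value `G p - i τ` for small `τ`, and the ray from there runs into `p` after
the time `τ`. -/
theorem exists_exit_up (hF : F.IsTranslation) : ∃ q ∉ F.sing, ∃ τ > 0, τ ∉ F.flowDom q := by
  obtain ⟨p, hp⟩ := hF.nonempty_sing
  obtain ⟨U, G, ρ, hρ, h1, h2, h3, h4, h5, h6, h7, h8⟩ := exists_primitive hF hp
  have hn : G '' U ∈ 𝓝 (G p) := h6 (mem_map.2 (mem_of_superset (h1.mem_nhds h2)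
    (subset_preimage_image _ _)))
  obtain ⟨ε, hε, hsub⟩ := Metric.mem_nhds_iff.1 hn
  set τ := min ε ρ / 2 with hτ
  have hτ0 : 0 < τ := by positivity
  have hτε : τ < ε := by have := min_le_left ε ρ; linarith
  have hτρ : τ < ρ := by have := min_le_right ε ρ; linarith
  obtain ⟨q, hqU, hq⟩ := hsub (show G p - τ • Complex.I ∈ Metric.ball (G p) ε by
    simpa [dist_eq_norm, abs_of_pos hτ0] using hτε)
  have hqp : q ≠ p := by
    rintro rfl
    have : τ • Complex.I = 0 := by linear_combination hq
    simp [hτ0.ne'] at this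
  refine ⟨q, (h4 q (subset_closure hqU) hqp).1, τ, hτ0, fun hmem => ?_⟩
  have := flow_mem_of_primitive hF hp h1 h3 h7 h8 (q := q) (J := Icc 0 τ) ordConnected_Icc
    ((ordConnected_flowDom q).out (zero_mem_flowDom_of_mem hmem) hmem) (s₀ := 0)
    (left_mem_Icc.2 hτ0.le) (by rwa [flow_zero]) (fun s hs => by
      rw [flow_zero, hq]
      have : G p - τ • Complex.I + (s - 0) • Complex.I - G p = (s - τ) • Complex.I := by module
      rw [this, norm_smul, Complex.norm_I, mul_one, Real.norm_eq_abs, abs_lt]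
      constructor <;> linarith [hs.1, hs.2]) (right_mem_Icc.2 hτ0.le)
  rw [flow_zero, hq] at this
  refine (h4 _ (subset_closure this.1) ?_).2 (by rw [this.2]; module)
  exact fun h => flow_notMem_sing hF hmem (h ▸ hp)

theorem flow_tendsto_sing (hF : F.IsTranslation) {q : X} {τ : ℝ} (hτ : 0 < τ)
    (hq1 : τ ∉ F.flowDom q) (hq2 : ∀ s ∈ Ico 0 τ, s ∈ F.flowDom q) :
    ∃ P ∈ F.sing, Tendsto (F.flow q) (𝓝[<] τ) (𝓝 P) := by
  obtain ⟨P, hP, hPt⟩ := exists_tendsto_sing hF (p := q) (v := τ • Complex.I) (fun s hs => by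
    rw [smul_smul]
    exact hq2 _ ⟨by nlinarith [hs.1], by nlinarith [hs.2]⟩) hq1
  have : Tendsto (fun u : ℝ => u / τ) (𝓝[<] τ) (𝓝[<] 1) := by
    rw [tendsto_nhdsWithin_iff]
    constructor
    · have := (by fun_prop : Continuous fun u : ℝ => u / τ).tendsto τ
      rw [div_self hτ.ne'] at this
      exact this.mono_left nhdsWithin_le_nhds
    · filter_upwards [self_mem_nhdsWithin] with u hu
      rw [mem_Iio, div_lt_one hτ]
      exact hu
  refine ⟨P, hP, (hPt.comp this).congr fun u => ?_⟩
  simp only [Function.comp, flow]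
  rw [smul_smul, div_mul_cancel₀ _ hτ.ne']

/-- The points whose upward vertical ray ends at a singular point exactly after a given short time
`τ` are finite in number: they are in the fibres of the primitives `G` over `G p - i τ`. -/
theorem finite_exit (hF : F.IsTranslation) : ∃ τ₁ > 0, ∀ τ ∈ Ioo 0 τ₁,
    {q | τ ∉ F.flowDom q ∧ ∀ s ∈ Ico 0 τ, s ∈ F.flowDom q}.Finite := by
  choose! U G ρ hρ h1 h2 h3 h4 h5 h6 h7 h8 using fun p => exists_primitive hF (p := p)
  obtain ⟨τ₁, hτ₁, hlt⟩ : ∃ τ₁ > 0, ∀ p ∈ F.sing, τ₁ ≤ ρ p := by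
    obtain ⟨p, hp, hmin⟩ := exists_min_image F.sing ρ hF.finite_sing hF.nonempty_sing
    exact ⟨ρ p, hρ p hp, hmin⟩
  refine ⟨τ₁, hτ₁, fun τ hτ => ?_⟩
  refine (hF.finite_sing.biUnion (t := fun p => U p ∩ G p ⁻¹' {G p p - τ • Complex.I})
    fun p hp => h5 p hp _).subset ?_
  rintro q ⟨hq1, hq2⟩
  obtain ⟨P, hP, hPt'⟩ := flow_tendsto_sing hF hτ.1 hq1 hq2
  have hev : ∀ᶠ u in 𝓝[<] τ, F.flow q u ∈ U P ∧ u ∈ Ico 0 τ :=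
    (hPt'.eventually ((h1 P hP).mem_nhds (h2 P hP))).and (Ico_mem_nhdsLT hτ.1)
  -- Compute the primitive close to the end of the ray, then trace the ray back to `q`.
  obtain ⟨a, ha, ha'⟩ := (mem_nhdsLT_iff_exists_Ioo_subset).1 hev
  have ha2 : a < τ := ha
  set s₀ := (a + τ) / 2 with hs₀
  have hs₀m : s₀ ∈ Ioo a τ := ⟨by linarith, by linarith⟩
  have hJd : Ioo a τ ⊆ F.flowDom q := fun s hs => hq2 s (ha' hs).2
  have hpr : ∀ s ∈ Ioo a τ, G P (F.flow q s) - G P (F.flow q s₀) = (s - s₀) • Complex.I := by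
    intro s hs
    have := ((isDev_flow hF q).mono hJd).primitive_sub hF isPreconnected_Ioo (G := G P)
      (fun s hs φ hφ hx => h7 P hP _ (ha' hs).1
        (fun h => flow_notMem_sing hF (hJd hs) (h ▸ hP)) φ hφ hx) hs₀m hs
    rw [this, sub_smul]
  have hGlim : G P P - G P (F.flow q s₀) = (τ - s₀) • Complex.I := by
    have t1 : Tendsto (fun s => G P (F.flow q s) - G P (F.flow q s₀)) (𝓝[<] τ)
        (𝓝 (G P P - G P (F.flow q s₀))) := by
      refine Tendsto.sub_const ?_ _
      refine ((h3 P hP) P (subset_closure (h2 P hP))).tendsto.comp (tendsto_nhdsWithin_iff.2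
          ⟨hPt', hev.mono fun w hw => subset_closure hw.1⟩)
    have t2 : Tendsto (fun s : ℝ => (s - s₀) • Complex.I) (𝓝[<] τ) (𝓝 ((τ - s₀) • Complex.I)) :=
      ((by fun_prop : Continuous fun s : ℝ => (s - s₀) • Complex.I).tendsto τ).mono_left
        nhdsWithin_le_nhds
    refine tendsto_nhds_unique (t1.congr' ?_) t2
    filter_upwards [Ioo_mem_nhdsLT ha2] with s hs using hpr s hs
  have hG0 : G P (F.flow q s₀) = G P P - (τ - s₀) • Complex.I := by
    rw [← hGlim]; ring
  have := flow_mem_of_primitive hF hP (h1 P hP) (h3 P hP) (h7 P hP) (h8 P hP) (q := q)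
    (J := Ico 0 τ) ordConnected_Ico hq2 (s₀ := s₀) (ha' hs₀m).2 (ha' hs₀m).1 (fun s hs => by
      rw [hG0]
      have : G P P - (τ - s₀) • Complex.I + (s - s₀) • Complex.I - G P P = (s - τ) • Complex.I := by
        module
      rw [this, norm_smul, Complex.norm_I, mul_one, Real.norm_eq_abs, abs_lt]
      have := hlt P hP
      constructor <;> linarith [hs.1, hs.2, hτ.2]) (left_mem_Ico.2 hτ.1)
  rw [flow_zero, hG0] at this
  exact mem_biUnion hP ⟨this.1, by rw [mem_preimage, this.2, mem_singleton_iff]; module⟩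

end Compact
end T2
end FlatStructure

/-! ### Leaves without saddle connections -/

namespace FlatStructure

variable {X : Type*} [TopologicalSpace X] {F : FlatStructure X}

/-- No vertical leaf ends at singular points in both directions. -/
def NoVerticalSaddle (F : FlatStructure X) : Prop :=
  ∀ q ∉ F.sing, Ici 0 ⊆ F.flowDom q ∨ Iic 0 ⊆ F.flowDom q

theorem convex_reProdIm {s t : Set ℝ} (hs : Convex ℝ s) (ht : Convex ℝ t) : Convex ℝ (s ×ℂ t) :=
  (hs.linear_preimage Complex.reLm).inter (ht.linear_preimage Complex.imLm)

section T2
variable [T2Space X] [CompactSpace X]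

/-- There are no closed vertical leaves: otherwise all leaves would be closed, but some leaf ends at
a singular point. -/
theorem flow_ne_self (hF : F.IsTranslation) (hN : F.NoVerticalSaddle) {q : X} {τ : ℝ} (hτ : 0 < τ)
    (hq : τ ∈ F.flowDom q) : F.flow q τ ≠ q := by
  intro heq
  -- Otherwise the points of closed leaves of length `τ` form a clopen set of regular points.
  have key : ∀ q' ∉ F.sing, τ ∈ F.flowDom q' ∧ F.flow q' τ = q' := by
    intro q' hq'
    have := hF.preconnected.eq_of_locally_eq (x := q) (y := q')
      (f := fun q => (τ ∈ F.flowDom q ∧ F.flow q τ = q)) ?_ (notMem_sing_of_mem_flowDom hF hq) hq'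
    · exact this.mp ⟨hq, heq⟩
    intro q hq
    refine Eventually.filter_mono nhdsWithin_le_nhds ?_
    refine eventually_nhds_of_exp hF hq ?_
    -- If the flow for the time `σ` moves `q`, then it moves all points near `q`.
    have hmove : ∀ σ : ℝ, σ ∈ F.flowDom q → F.flow q σ ≠ q → ∀ᶠ z in 𝓝 (0 : ℂ),
        σ ∈ F.flowDom (F.exp q z) ∧ F.flow (F.exp q z) σ ≠ F.exp q z := by
      intro σ hσ hne
      have c1 : Tendsto (fun z => F.exp q (z + σ • Complex.I)) (𝓝 0) (𝓝 (F.flow q σ)) := by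
        have := (exp_continuousAt hF (v := 0 + σ • Complex.I)
          (by rw [zero_add]; exact hσ)).tendsto.comp
          ((by fun_prop : Continuous fun z : ℂ => z + σ • Complex.I).tendsto 0)
        rwa [zero_add] at this
      have c2 : Tendsto (F.exp q) (𝓝 0) (𝓝 q) := by
        have := (exp_continuousAt hF (zero_mem_dom hF hq)).tendsto
        rwa [exp_zero] at this
      filter_upwards [flow_box hF hσ, (c1.prodMk_nhds c2).eventually
        (isClosed_diagonal.isOpen_compl.mem_nhds (show (F.flow q σ, q) ∈ (diagonal X)ᶜ from hne))]
        with z hz hz'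
      refine ⟨hz.2.1, fun h => hz' ?_⟩
      rw [hz.2.2.2.1] at h
      exact h
    by_cases hτq : τ ∈ F.flowDom q
    · by_cases hqq : F.flow q τ = q
      · filter_upwards [flow_box hF hτq] with z hz
        rw [eq_iff_iff]
        refine iff_of_true ⟨hz.2.1, ?_⟩ ⟨hτq, hqq⟩
        rw [hz.2.2.2.1, ← hz.2.2.2.2.2, hqq]
      · filter_upwards [hmove τ hτq hqq] with z hz
        rw [eq_iff_iff]
        exact iff_of_false (fun h => hz.2 h.2) (fun h => hqq h.2)
    -- If the flow for the time `τ` is not defined at `q`, then downwards it is, and moves `q`.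
    · have hneg : -τ ∈ F.flowDom q := by
        rcases hN q hq with h | h
        · exact absurd (h hτ.le) hτq
        · exact h (by simpa using hτ.le)
      have hqq : F.flow q (-τ) ≠ q := by
        intro h
        have := (flow_neg hF hneg).1
        rw [h, neg_neg] at this
        exact hτq this
      filter_upwards [hmove _ hneg hqq] with z hz
      rw [eq_iff_iff]
      refine iff_of_false (fun h => hz.2 ?_) (fun h => hτq h.1)
      have := (flow_neg hF h.1).2
      rwa [h.2] at this
  obtain ⟨q₀, hq₀, t, ht, hnot⟩ := exists_exit_up hF
  have hk : ∀ k : ℕ, (k : ℝ) * τ ∈ F.flowDom q₀ ∧ F.flow q₀ (k * τ) = q₀ := by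
    intro k
    induction k with
    | zero => simpa [flow_zero] using zero_mem_flowDom hF hq₀
    | succ k ih =>
      have := flow_add hF ih.1 (r := τ) (by rw [ih.2]; exact (key q₀ hq₀).1)
      rw [ih.2, (key q₀ hq₀).2] at this
      push_cast
      rwa [add_one_mul]
  obtain ⟨k, hkt⟩ := Archimedean.arch t hτ
  rw [nsmul_eq_mul] at hkt
  exact hnot ((ordConnected_flowDom q₀).out (zero_mem_flowDom hF hq₀) (hk k).1 ⟨ht.le, hkt⟩)

/-- A set of leaves cannot accumulate from one side only on an infinite ray outside it. -/
theorem false_of_boundary_ray (hF : F.IsTranslation) (hN : F.NoVerticalSaddle) {W : Set X}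
    (hsat : ∀ q ∈ W, ∀ s ∈ F.flowDom q, F.flow q s ∈ W) {p : X} (hpW : p ∉ W)
    (hray : Ici 0 ⊆ F.flowDom p) {δ : ℝ} (hδ : 0 < δ)
    (hW : ∀ x : ℝ, 0 < x → x < δ → (x : ℂ) ∈ F.dom p ∧ F.exp p x ∈ W) : False := by
  have hp : p ∉ F.sing := notMem_sing_of_mem_flowDom hF (hray (mem_Ici.2 le_rfl))
  have hout : ∀ y : ℝ, 0 ≤ y → F.flow p y ∉ W := by
    intro y hy hyW
    obtain ⟨h1, h2⟩ := flow_neg hF (hray hy)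
    exact hpW (h2 ▸ hsat _ hyW _ h1)
  have hx0 : ∀ x : ℝ, 0 ≤ x → x < δ → (x : ℂ) ∈ F.dom p := by
    intro x hx hxδ
    rcases hx.eq_or_lt with rfl | h
    · simpa using zero_mem_dom hF hp
    · exact (hW x h hxδ).1
  have hin : ∀ z ∈ F.columns p, 0 < z.re → z.re < δ → F.flow (F.exp p z.re) z.im ∈ W :=
    fun z hz h1 h2 => hsat _ (hW _ h1 h2).2 _ hz.2
  have hmk : ∀ x : ℝ, ((⟨x, 0⟩ : ℂ)) = x := fun x => by apply Complex.ext <;> simp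
  by_cases hcase : ∃ δ' ∈ Ioo 0 δ, ∀ x ∈ Icc (0:ℝ) δ', Ici 0 ⊆ F.flowDom (F.exp p x)
  · -- An infinite vertical strip comes back close to itself.
    obtain ⟨δ', hδ', hstrip⟩ := hcase
    set A : Set ℂ := Icc 0 δ' ×ℂ Ici 0 with hA
    have hAconv : Convex ℝ A := convex_reProdIm (convex_Icc 0 δ') (convex_Ici 0)
    have hAc : A ⊆ F.columns p := fun z hz =>
      ⟨hx0 _ hz.1.1 (hz.1.2.trans_lt hδ'.2), hstrip _ hz.1 hz.2⟩
    obtain ⟨hAd, hAe⟩ := columns_convex hF hAconv ⟨by simpa using hδ'.1.le, by simp⟩ hAc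
    have hslide : ∀ d y : ℝ, d ∈ Icc 0 δ' → 0 ≤ y → (d : ℂ) ∈ F.dom (F.flow p y) ∧
        F.exp (F.flow p y) d = F.flow (F.exp p d) y := by
      intro d y hd hy
      have := exp_exp_of_convex hF hAconv hAd (v := ⟨0, y⟩) (w := ⟨d, y⟩)
        ⟨by simpa using hδ'.1.le, hy⟩ ⟨hd, hy⟩
      rw [hAe ⟨d, y⟩ ⟨hd, hy⟩] at this
      have e : (⟨d, y⟩ : ℂ) - ⟨0, y⟩ = d := by apply Complex.ext <;> simp
      rw [e] at this
      rw [flow, smul_I_eq]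
      exact this
    have hslideW : ∀ d y : ℝ, 0 < d → d ≤ δ' → 0 ≤ y → F.exp (F.flow p y) d ∈ W := by
      intro d y h1 h2 hy
      rw [(hslide d y ⟨h1.le, h2⟩ hy).2]
      exact hin ⟨d, y⟩ (hAc ⟨⟨h1.le, h2⟩, hy⟩) h1 (h2.trans_lt hδ'.2)
    obtain ⟨K, hK, hKs, hKr⟩ := exists_compact_recurrent hF
    have hret : ∀ k : ℕ, ∃ t ∈ Icc (3 * k : ℝ) (3 * k + 3), F.flow p t ∈ K := by
      intro k
      have h3k : (3 * k : ℝ) ∈ F.flowDom p := hray (by simp)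
      have h3k' : (3 * k + 3 : ℝ) ∈ F.flowDom p := hray (by simp; positivity)
      have := flow_sub hF h3k h3k'
      rw [add_sub_cancel_left] at this
      obtain ⟨s, hs, hsK⟩ := hKr _ this.1
      have hs' := flow_add hF h3k ((ordConnected_flowDom _).out
        (zero_mem_flowDom_of_mem this.1) this.1 hs)
      exact ⟨3 * k + s, ⟨by linarith [hs.1], by linarith [hs.2]⟩, hs'.2 ▸ hsK⟩
    -- Two passages of the ray near a point `q`, at times `t k₁` and `t k₂`. Changing the second
    -- time by `w.im` puts the points on the same horizontal segment, at the distance `w.re`.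
    choose t ht htK using hret
    obtain ⟨q, hq, hqc⟩ := hK.exists_mapClusterPt_of_frequently (l := atTop)
      (f := fun k => F.flow p (t k)) (Frequently.of_forall htK)
    obtain ⟨r, hr, hd1, -, -⟩ := exists_disc hF (hKs q hq)
    set ρ := min (min (r / 3) (δ' / 2)) 1 with hρ
    have hρ0 : 0 < ρ := lt_min (lt_min (by positivity) (by have := hδ'.1; positivity)) one_pos
    have hρr : ρ ≤ r / 3 := (min_le_left _ _).trans (min_le_left _ _)
    have hρδ : ρ ≤ δ' / 2 := (min_le_left _ _).trans (min_le_right _ _)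
    have hρ1 : ρ ≤ 1 := min_le_right _ _
    have hfr := hqc.frequently (exp_image_mem_nhds hF (Metric.ball_mem_nhds 0 hρ0)
        ((Metric.ball_subset_ball (by linarith)).trans hd1))
    obtain ⟨k₁, z₁, hz₁, hk₁⟩ := hfr.exists
    obtain ⟨k₂, ⟨z₂, hz₂, hk₂⟩, hk12⟩ := (hfr.and_eventually (eventually_ge_atTop (k₁ + 2))).exists
    have htt : t k₁ + 3 ≤ t k₂ := by
      have : ((k₁ + 2 : ℕ) : ℝ) ≤ k₂ := by exact_mod_cast hk12
      push_cast at this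
      linarith [(ht k₁).2, (ht k₂).1]
    have ht1 : 0 ≤ t k₁ := le_trans (by positivity) (ht k₁).1
    rw [mem_ball_zero_iff] at hz₁ hz₂
    set w := z₁ - z₂ with hw
    have hwn : ‖w‖ < 2 * ρ := (norm_sub_le _ _).trans_lt (by linarith)
    have hwi := (Complex.abs_im_le_norm w).trans_lt hwn
    have hwr := (Complex.abs_re_le_norm w).trans_lt hwn
    rw [abs_lt] at hwi hwr
    have ht2 : 0 ≤ t k₂ + w.im := by linarith
    have hz1m : z₁ ∈ Metric.ball (0:ℂ) r := by rw [mem_ball_zero_iff]; linarith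
    have hz2m : z₂ ∈ Metric.ball (0:ℂ) r := by rw [mem_ball_zero_iff]; linarith
    set z₃ := z₂ + w.im • Complex.I with hz₃
    have hz3m : z₃ ∈ Metric.ball (0:ℂ) r := by
      rw [mem_ball_zero_iff]
      refine (norm_add_le _ _).trans_lt ?_
      have : ‖w.im • Complex.I‖ < 2 * ρ := by
        rw [norm_smul, Complex.norm_I, mul_one, Real.norm_eq_abs, abs_lt]; exact hwi
      linarith
    have h3 : F.flow p (t k₂ + w.im) = F.exp q z₃ := by
      have e1 := exp_exp_of_convex hF (convex_ball (0:ℂ) r) hd1 hz2m hz3m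
      rw [hk₂, hz₃, add_sub_cancel_left, ← hz₃] at e1
      exact (flow_add hF (hray (le_trans ht1 (by linarith) : (0:ℝ) ≤ t k₂)) e1.1).2.trans e1.2
    have hdiff : z₁ - z₃ = (w.re : ℂ) := by
      apply Complex.ext <;> simp [hz₃, hw]
    have e31 := exp_exp_of_convex hF (convex_ball (0:ℂ) r) hd1 hz3m hz1m
    have e13 := exp_exp_of_convex hF (convex_ball (0:ℂ) r) hd1 hz1m hz3m
    have hdiff' : z₃ - z₁ = ((-w.re : ℝ) : ℂ) := by
      rw [← neg_sub, hdiff]; push_cast; rfl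
    rw [hdiff, ← h3, hk₁] at e31
    rw [hdiff', ← h3, hk₁] at e13
    -- The right one of the two points is in `W` and on the ray, unless they coincide.
    rcases lt_trichotomy w.re 0 with h | h | h
    · have := hslideW (-w.re) (t k₁) (by linarith) (by linarith) ht1
      rw [e13.2] at this
      exact hout _ ht2 this
    · have h13 : z₃ = z₁ := by
        rw [h] at hdiff
        have := sub_eq_zero.1 (hdiff.trans (by simp))
        exact this.symm
      have heq : F.flow p (t k₂ + w.im) = F.flow p (t k₁) := by rw [h3, h13, hk₁]
      have := flow_sub hF (hray ht1) (hray ht2)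
      rw [heq] at this
      exact flow_ne_self hF hN (by linarith) this.1 this.2
    · have := hslideW w.re (t k₂ + w.im) h (by linarith) ht2
      rw [e31.2] at this
      exact hout _ ht1 this
  · -- The strip is cut by infinitely many singular points, which is impossible.
    push Not at hcase
    obtain ⟨τ₁, hτ₁, hfin⟩ := finite_exit hF
    set τ := τ₁ / 2 with hτ
    have hτ0 : 0 < τ := by positivity
    have hQ := hfin τ ⟨hτ0, by linarith⟩
    -- The lowest point at which the strip of width `x₀` is cut.
    have hclaim : ∀ δ' ∈ Ioo 0 δ, ∃ x ∈ Ioo 0 δ', ∃ S > τ,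
        (Icc 0 x ×ℂ Ico 0 S ⊆ F.columns p) ∧ S ∉ F.flowDom (F.exp p x) := by
      intro δ' hδ'
      have hbox := ((Complex.continuous_ofReal.tendsto 0).eventually
        (flow_box hF (hray (mem_Ici.2 (by positivity : (0:ℝ) ≤ τ + 1)))))
      obtain ⟨η, hη, hbox'⟩ := Metric.eventually_nhds_iff.1 hbox
      obtain ⟨x₀, hx₀, hnot⟩ := hcase (min (η / 2) (δ' / 2))
        ⟨lt_min (by positivity) (by have := hδ'.1; positivity),
          (min_le_right _ _).trans_lt (by linarith [hδ'.1, hδ'.2])⟩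
      obtain ⟨y₀, hy₀, hy₀'⟩ := not_subset.1 hnot
      have hx₀η : x₀ < η := by linarith [hx₀.2, min_le_left (η/2) (δ'/2)]
      have hx₀δ : x₀ < δ' := by linarith [hx₀.2, min_le_right (η/2) (δ'/2), hδ'.1]
      have hcomp : IsCompact ((Icc 0 x₀ ×ℂ Icc 0 y₀) ∩ (F.columns p)ᶜ) :=
        (isCompact_Icc.reProdIm isCompact_Icc).inter_right (isOpen_columns hF p).isClosed_compl
      obtain ⟨z, ⟨hz, hzc⟩, hmin⟩ := hcomp.exists_isMinOn
        ⟨⟨x₀, y₀⟩, ⟨⟨⟨hx₀.1, le_rfl⟩, ⟨hy₀, le_rfl⟩⟩, fun h => hy₀' h.2⟩⟩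
          Complex.continuous_im.continuousOn
      have hlow : Icc 0 x₀ ×ℂ Ico 0 z.im ⊆ F.columns p := by
        intro w hw
        by_contra hwc
        exact absurd (hmin ⟨⟨hw.1, hw.2.1, hw.2.2.le.trans hz.2.2⟩, hwc⟩) (not_le.2 hw.2.2)
      have hnotS : z.im ∉ F.flowDom (F.exp p z.re) := fun h =>
        hzc ⟨hx0 _ hz.1.1 (by linarith [hz.1.2, hδ'.2]), h⟩
      refine ⟨z.re, ⟨lt_of_le_of_ne hz.1.1 ?_, by linarith [hz.1.2]⟩, z.im, ?_, ?_, hnotS⟩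
      · intro h0
        rw [← h0] at hnotS
        simp only [Complex.ofReal_zero, exp_zero] at hnotS
        exact hnotS (hray hz.2.1)
      · by_contra hle
        have := hbox' (y := z.re) (by
          rw [Real.dist_eq, sub_zero, abs_of_nonneg hz.1.1]; linarith [hz.1.2])
        exact hnotS ((ordConnected_flowDom _).out (zero_mem_flowDom_of_mem this.2.1) this.2.1
          ⟨hz.2.1, by linarith⟩)
      · exact (Complex.reProdIm_subset_iff'.2 (Or.inl ⟨Icc_subset_Icc_right hz.1.2,
          subset_rfl⟩)).trans hlow
    set B : Set ℝ := {x | x ∈ Ioo 0 δ ∧ ∃ S > τ, (Icc 0 x ×ℂ Ico 0 S ⊆ F.columns p) ∧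
      S ∉ F.flowDom (F.exp p x)} with hB
    have hBinf : B.Infinite := by
      intro hBf
      obtain ⟨x, hx, S, hS⟩ := hclaim (δ / 2) ⟨by positivity, by linarith⟩
      have hBne : B.Nonempty := ⟨x, ⟨hx.1, by linarith [hx.2]⟩, S, hS⟩
      obtain ⟨m, hm, hmin⟩ := exists_min_image B id hBf hBne
      obtain ⟨x', hx', S', hS'⟩ := hclaim m hm.1
      exact absurd (hmin x' ⟨⟨hx'.1, hx'.2.trans hm.1.2⟩, S', hS'⟩) (not_le.2 hx'.2)
    have hBex : ∀ x ∈ B, ∃ S > τ, (Icc 0 x ×ℂ Ico 0 S ⊆ F.columns p) ∧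
      S ∉ F.flowDom (F.exp p x) := fun x hx => hx.2
    choose! S hS1 hS2 hS3 using hBex
    have hSm : ∀ x ∈ B, ∀ s ∈ Ico 0 (S x), s ∈ F.flowDom (F.exp p x) := fun x hx s hs =>
      (hS2 x hx (show (⟨x, s⟩ : ℂ) ∈ _ from ⟨⟨hx.1.1.le, le_rfl⟩, hs⟩)).2
    -- Just below the cuts there are finitely many points only, so two cuts have the same one.
    have hmaps : MapsTo (fun x : ℝ => F.flow (F.exp p x) (S x - τ)) B
        {q | τ ∉ F.flowDom q ∧ ∀ s ∈ Ico 0 τ, s ∈ F.flowDom q} := by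
      intro x hx
      have hy : S x - τ ∈ F.flowDom (F.exp p x) := hSm x hx _ ⟨by linarith [hS1 x hx], by linarith⟩
      refine ⟨fun h => hS3 x hx ?_, fun s hs => ?_⟩
      · have := (flow_add hF hy h).1
        rwa [sub_add_cancel] at this
      · have := (flow_sub hF hy (hSm x hx (S x - τ + s)
          ⟨by linarith [hS1 x hx, hs.1], by linarith [hs.2]⟩)).1
        rwa [add_sub_cancel_left] at this
    obtain ⟨x₁, hx₁, x₂, hx₂, hne, heq⟩ := hBinf.exists_ne_map_eq_of_mapsTo hmaps hQ
    wlog hlt : x₁ < x₂ generalizing x₁ x₂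
    · exact this x₂ hx₂ x₁ hx₁ hne.symm heq.symm (lt_of_le_of_ne (not_lt.1 hlt) hne.symm)
    -- Slide both vertical segments to the left by `x₁`: the first one becomes part of the ray, the
    -- second one remains in `W`, but their ends coincide.
    have hslide : ∀ x ∈ B, x₁ ≤ x → F.exp (F.flow (F.exp p x) (S x - τ)) ((-x₁ : ℝ) : ℂ)
        = F.flow (F.exp p (x - x₁ : ℝ)) (S x - τ) := by
      intro x hx hxx
      have hAconv : Convex ℝ (Icc 0 x ×ℂ Ico 0 (S x)) :=
        convex_reProdIm (convex_Icc _ _) (convex_Ico _ _)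
      have hSx := hS1 x hx
      obtain ⟨hAd, hAe⟩ := columns_convex hF hAconv
        ⟨by simpa using hx.1.1.le, by
          simp only [Complex.zero_im, mem_preimage, mem_Ico, le_refl, true_and]; linarith⟩
        (hS2 x hx)
      have m1 : (⟨x, S x - τ⟩ : ℂ) ∈ Icc 0 x ×ℂ Ico 0 (S x) :=
        ⟨⟨hx.1.1.le, le_rfl⟩, ⟨by simp; linarith, by simp; linarith⟩⟩
      have m2 : (⟨x - x₁, S x - τ⟩ : ℂ) ∈ Icc 0 x ×ℂ Ico 0 (S x) :=
        ⟨⟨by simp; linarith, by simp; linarith [hx₁.1.1]⟩, ⟨by simp; linarith, by simp; linarith⟩⟩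
      have := (exp_exp_of_convex hF hAconv hAd m1 m2).2
      rw [hAe _ m1, hAe _ m2] at this
      have e : (⟨x - x₁, S x - τ⟩ : ℂ) - ⟨x, S x - τ⟩ = ((-x₁ : ℝ) : ℂ) := by
        apply Complex.ext <;> simp
      rw [e] at this
      exact this
    have e1 := hslide x₁ hx₁ le_rfl
    have e2 := hslide x₂ hx₂ hlt.le
    rw [heq, e2] at e1
    simp only [sub_self, Complex.ofReal_zero, exp_zero] at e1
    refine hout (S x₁ - τ) (by linarith [hS1 x₁ hx₁]) (e1 ▸ ?_)
    refine hin ⟨x₂ - x₁, S x₂ - τ⟩ (hS2 x₂ hx₂ ⟨⟨by simp; linarith, by simp; linarith [hx₁.1.1]⟩,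
      ⟨by simp; linarith [hS1 x₂ hx₂], by simp; linarith⟩⟩) (by simpa using hlt) ?_
    have := hx₂.1.2
    have := hx₁.1.1
    simp only
    linarith

end T2
end FlatStructure

/-! ### Minimality of the vertical foliation -/

namespace FlatStructure

variable {X : Type*} [TopologicalSpace X] {F : FlatStructure X}

section T2
variable [T2Space X]

theorem mem_flowDom_post_iff (hF : F.IsTranslation) {L : ℂ ≃L[ℝ] ℂ} {σ : ℝ}
    (hL : L Complex.I = σ • Complex.I) (hσ : σ * σ = 1) {q : X} {s : ℝ} :
    s ∈ (F.post L).flowDom q ↔ σ * s ∈ F.flowDom q := by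
  have : s • Complex.I = L ((σ * s) • Complex.I) := by
    rw [map_smul, hL, smul_smul, mul_right_comm, hσ, one_mul]
  rw [flowDom, mem_ofPred_eq, this, mem_dom_post_iff hF]
  rfl

theorem flow_post (hF : F.IsTranslation) {L : ℂ ≃L[ℝ] ℂ} {σ : ℝ}
    (hL : L Complex.I = σ • Complex.I) (hσ : σ * σ = 1) {q : X} {s : ℝ}
    (hs : σ * s ∈ F.flowDom q) : (F.post L).flow q s = F.flow q (σ * s) := by
  have : s • Complex.I = L ((σ * s) • Complex.I) := by
    rw [map_smul, hL, smul_smul, mul_right_comm, hσ, one_mul]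
  rw [flow, this, exp_post hF L hs]
  rfl

theorem NoVerticalSaddle.post (hN : F.NoVerticalSaddle) (hF : F.IsTranslation) {L : ℂ ≃L[ℝ] ℂ}
    {σ : ℝ} (hL : L Complex.I = σ • Complex.I) (hσ : σ = 1 ∨ σ = -1) :
    (F.post L).NoVerticalSaddle := by
  intro q hq
  rcases hσ with rfl | rfl
  · refine (hN q hq).imp (fun h s hs => ?_) (fun h s hs => ?_) <;>
    · rw [mem_flowDom_post_iff hF hL (by norm_num), one_mul]; exact h hs
  · refine (hN q hq).symm.imp (fun h s hs => ?_) (fun h s hs => ?_) <;>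
    · rw [mem_flowDom_post_iff hF hL (by norm_num), neg_one_mul]
      exact h (by simpa using hs)

/-- Reflections of the plane with prescribed effect on the horizontal and vertical directions. -/
theorem exists_flip {κ σ : ℝ} (hκ : κ = 1 ∨ κ = -1) (hσ : σ = 1 ∨ σ = -1) :
    ∃ L : ℂ ≃L[ℝ] ℂ, L Complex.I = σ • Complex.I ∧ L 1 = κ := by
  rcases hκ with rfl | rfl <;> rcases hσ with rfl | rfl
  · exact ⟨ContinuousLinearEquiv.refl ℝ ℂ, by simp, by simp⟩
  · exact ⟨Complex.conjCLE, by simp, by simp⟩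
  · exact ⟨Complex.conjCLE.trans (ContinuousLinearEquiv.neg ℝ), by simp, by simp⟩
  · exact ⟨ContinuousLinearEquiv.neg ℝ, by simp, by simp⟩

section Compact
variable [CompactSpace X]

/-- The boundary statement `false_of_boundary_ray` for rays in both vertical directions, with the
set on either side. -/
theorem false_of_boundary_ray_flip (hF : F.IsTranslation) (hN : F.NoVerticalSaddle) {W : Set X}
    (hsat : ∀ q ∈ W, ∀ s ∈ F.flowDom q, F.flow q s ∈ W) {p : X} (hpW : p ∉ W) {κ σ : ℝ}
    (hκ : κ = 1 ∨ κ = -1) (hσ : σ = 1 ∨ σ = -1)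
    (hray : ∀ s, 0 ≤ s → σ * s ∈ F.flowDom p) {δ : ℝ} (hδ : 0 < δ)
    (hW : ∀ x : ℝ, 0 < x → x < δ → ((κ * x : ℝ) : ℂ) ∈ F.dom p ∧ F.exp p (κ * x : ℝ) ∈ W) :
    False := by
  obtain ⟨L, hLI, hL1⟩ := exists_flip hκ hσ
  have hσ2 : σ * σ = 1 := by rcases hσ with rfl | rfl <;> norm_num
  have hκ2 : κ * κ = 1 := by rcases hκ with rfl | rfl <;> norm_num
  refine false_of_boundary_ray (hF.post L) (hN.post hF hLI hσ) (W := W) ?_ hpW ?_ hδ ?_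
  · intro q hq s hs
    rw [mem_flowDom_post_iff hF hLI hσ2] at hs
    rw [flow_post hF hLI hσ2 hs]
    exact hsat q hq _ hs
  · intro s hs
    rw [mem_flowDom_post_iff hF hLI hσ2]
    exact hray s hs
  · intro x h1 h2
    have : (x : ℂ) = L ((κ * x : ℝ) : ℂ) := by
      have e : ((κ * x : ℝ) : ℂ) = (κ * x) • (1 : ℂ) := by simp
      rw [e, map_smul, hL1, Complex.real_smul, ← Complex.ofReal_mul,
        mul_right_comm, hκ2, one_mul]
    obtain ⟨h3, h4⟩ := hW x h1 h2
    rw [this, mem_dom_post_iff hF, exp_post hF L h3]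
    exact ⟨h3, h4⟩

/-- In the absence of vertical saddle connections every leaf meets every nonempty open set. -/
theorem exists_flow_mem (hF : F.IsTranslation) (hN : F.NoVerticalSaddle) {O : Set X}
    (hO : IsOpen O) {x₀ : X} (hx₀ : x₀ ∈ O) (hx₀s : x₀ ∉ F.sing) {q : X} (hq : q ∉ F.sing) :
    ∃ s ∈ F.flowDom q, F.flow q s ∈ O := by
  set W : Set X := {q | ∃ s ∈ F.flowDom q, F.flow q s ∈ O} with hW
  have hsat : ∀ q ∈ W, ∀ s ∈ F.flowDom q, F.flow q s ∈ W := by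
    rintro q ⟨t, ht, htO⟩ s hs
    have := flow_sub hF hs ht
    exact ⟨t - s, this.1, this.2 ▸ htO⟩
  have hWo : ∀ q ∈ W, ∀ᶠ q' in 𝓝 q, q' ∈ W := by
    rintro q ⟨s, hs, hsO⟩
    refine eventually_nhds_of_exp hF (notMem_sing_of_mem_flowDom hF hs) ?_
    have c1 : Tendsto (fun z => F.exp q (z + s • Complex.I)) (𝓝 0) (𝓝 (F.flow q s)) := by
      have := (exp_continuousAt hF (v := 0 + s • Complex.I)
        (by rw [zero_add]; exact hs)).tendsto.comp
        ((by fun_prop : Continuous fun z : ℂ => z + s • Complex.I).tendsto 0)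
      rwa [zero_add] at this
    filter_upwards [flow_box hF hs, c1.eventually (hO.mem_nhds hsO)] with z hz hz'
    exact ⟨s, hz.2.1, hz.2.2.2.1 ▸ hz'⟩
  by_contra hqW
  change q ∉ W at hqW
  have hx₀W : x₀ ∈ W := ⟨0, zero_mem_flowDom hF hx₀s, by rwa [flow_zero]⟩
  -- A regular boundary point `c` of `W`, with a point of `W` on the horizontal line through `c`.
  obtain ⟨c, hc, hcev⟩ : ∃ c ∈ F.singᶜ, ¬ ∀ᶠ w in 𝓝[F.singᶜ] c, (w ∈ W) = (c ∈ W) := by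
    by_contra! hcon
    have := hF.preconnected.eq_of_locally_eq (f := fun x => x ∈ W) hcon hx₀s hq
    exact hqW (this.mp hx₀W)
  have hcW : c ∉ W := by
    intro hcW
    apply hcev
    filter_upwards [(hWo c hcW).filter_mono nhdsWithin_le_nhds] with w hw
    simp [hw, hcW]
  obtain ⟨r, hr, hd, -, -⟩ := exists_disc hF hc
  have hpt : ∃ z ∈ Metric.ball (0:ℂ) r, F.exp c z ∈ W := by
    by_contra! hcon
    apply hcev
    filter_upwards [mem_nhdsWithin_of_mem_nhds
      (exp_image_mem_nhds hF (Metric.ball_mem_nhds (0:ℂ) hr) hd)]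
    rintro _ ⟨z, hz, rfl⟩
    simp [hcW, hcon z hz]
  obtain ⟨z, hz, hzW⟩ := hpt
  have hzr : ‖(z.re : ℂ)‖ < r := by
    rw [mem_ball_zero_iff] at hz
    rw [Complex.norm_real]
    exact (Complex.abs_re_le_norm z).trans_lt hz
  have hzrW : F.exp c z.re ∈ W := by
    have := exp_exp_of_convex hF (convex_ball (0:ℂ) r) hd hz (w := z.re) (by simpa using hzr)
    have e : (z.re : ℂ) - z = (-z.im) • Complex.I := by apply Complex.ext <;> simp
    rw [e] at this
    have h := hsat _ hzW (-z.im) this.1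
    rwa [flow, this.2] at h
  have hz0 : z.re ≠ 0 := by
    intro h
    rw [h] at hzrW
    simp only [Complex.ofReal_zero, exp_zero] at hzrW
    exact hcW hzrW
  -- Reflect so that the set lies on the right.
  obtain ⟨κ, hκ, a, ha, har, haW⟩ : ∃ κ : ℝ, (κ = 1 ∨ κ = -1) ∧ ∃ a : ℝ, 0 < a ∧ a < r ∧
      F.exp c (κ * a : ℝ) ∈ W := by
    rw [Complex.norm_real, Real.norm_eq_abs, abs_lt] at hzr
    rcases lt_or_gt_of_ne hz0 with h | h
    · exact ⟨-1, Or.inr rfl, -z.re, by linarith, by linarith, by simpa using hzrW⟩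
    · exact ⟨1, Or.inl rfl, z.re, h, hzr.2, by simpa using hzrW⟩
  have hκn : ∀ x : ℝ, ‖((κ * x : ℝ) : ℂ)‖ = |x| := by
    intro x
    rcases hκ with rfl | rfl <;> simp
  have hball : ∀ x ∈ Icc 0 a, ((κ * x : ℝ) : ℂ) ∈ Metric.ball (0:ℂ) r := by
    intro x hx
    rw [mem_ball_zero_iff, hκn, abs_of_nonneg hx.1]
    linarith [hx.2]
  have hcont : ContinuousOn (fun x : ℝ => F.exp c (κ * x : ℝ)) (Icc 0 a) :=
    (exp_continuousOn hF c).comp (by fun_prop) fun x hx => hd (hball x hx)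
  have hWopen : IsOpen W := isOpen_iff_mem_nhds.2 hWo
  have hclosed : IsCompact (Icc 0 a ∩ (fun x : ℝ => F.exp c (κ * x : ℝ)) ⁻¹' Wᶜ) :=
    isCompact_Icc.of_isClosed_subset
      (hcont.preimage_isClosed_of_isClosed isClosed_Icc hWopen.isClosed_compl) inter_subset_left
  -- The last point outside `W` before it.
  obtain ⟨b, ⟨hb, hbW⟩, hbmax⟩ := hclosed.exists_isGreatest
    ⟨0, ⟨le_rfl, ha.le⟩, by simpa [exp_zero] using hcW⟩
  have hba : b < a := by
    refine lt_of_le_of_ne hb.2 ?_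
    rintro rfl
    exact hbW haW
  set p := F.exp c (κ * b : ℝ) with hp
  have hps : p ∉ F.sing := exp_notMem_sing hF (hd (hball b hb))
  have hright : ∀ x : ℝ, 0 < x → x < a - b →
      ((κ * x : ℝ) : ℂ) ∈ F.dom p ∧ F.exp p (κ * x : ℝ) ∈ W := by
    intro x h1 h2
    have hm : b + x ∈ Icc 0 a := ⟨by linarith [hb.1], by linarith⟩
    have := exp_exp_of_convex hF (convex_ball (0:ℂ) r) hd (hball b hb) (hball _ hm)
    have e : ((κ * (b + x) : ℝ) : ℂ) - (κ * b : ℝ) = (κ * x : ℝ) := by push_cast; ring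
    rw [e] at this
    refine ⟨this.1, ?_⟩
    rw [this.2]
    by_contra hcon
    have := hbmax ⟨hm, hcon⟩
    linarith
  rcases hN p hps with h | h
  · exact false_of_boundary_ray_flip hF hN hsat hbW hκ (σ := 1) (Or.inl rfl)
      (fun s hs => by rw [one_mul]; exact h hs) (by linarith) hright
  · exact false_of_boundary_ray_flip hF hN hsat hbW hκ (σ := -1) (Or.inr rfl)
      (fun s hs => h (by simpa using hs)) (by linarith) hright

/-- Every sufficiently long vertical segment meets a given nonempty open set. -/
theorem exists_uniform_flow_mem (hF : F.IsTranslation) (hN : F.NoVerticalSaddle) {O : Set X}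
    (hO : IsOpen O) {x₀ : X} (hx₀ : x₀ ∈ O) (hx₀s : x₀ ∉ F.sing) :
    ∃ H > 0, ∀ q, H ∈ F.flowDom q → ∃ s ∈ Icc 0 H, F.flow q s ∈ O := by
  by_contra! hcon
  -- Otherwise there are longer and longer segments outside `O`; a limit of points in their middle
  -- parts, chosen in a compact set of regular points, is on a leaf that does not meet `O`.
  obtain ⟨K, hK, hKs, hKr⟩ := exists_compact_recurrent hF
  have : ∀ m : ℕ, ∃ q t, (m : ℝ) ≤ t ∧ t ≤ m + 3 ∧ (2 * m + 3 : ℝ) ∈ F.flowDom q ∧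
      (∀ s ∈ Icc (0:ℝ) (2 * m + 3), F.flow q s ∉ O) ∧ F.flow q t ∈ K := by
    intro m
    obtain ⟨q, hq, hqO⟩ := hcon (2 * m + 3) (by positivity)
    have hin : ∀ s ∈ Icc (0:ℝ) (2 * m + 3), s ∈ F.flowDom q :=
      fun s hs => (ordConnected_flowDom q).out (zero_mem_flowDom_of_mem hq) hq hs
    have hm : (0:ℝ) ≤ m := by positivity
    have h1 := flow_sub hF (hin m ⟨hm, by linarith⟩) (hin (m + 3) ⟨by linarith, by linarith⟩)
    rw [add_sub_cancel_left] at h1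
    obtain ⟨s, hs, hsK⟩ := hKr _ h1.1
    have h2 := flow_sub hF (hin m ⟨hm, by linarith⟩) (hin (m + s)
      ⟨by linarith [hs.1], by linarith [hs.2]⟩)
    rw [add_sub_cancel_left] at h2
    exact ⟨q, m + s, by linarith [hs.1], by linarith [hs.2], hq, hqO, h2.2 ▸ hsK⟩
  choose q t ht1 ht2 hq hqO hqK using this
  obtain ⟨c, hc, hcc⟩ := hK.exists_mapClusterPt_of_frequently (l := atTop)
      (f := fun m => F.flow (q m) (t m)) (Frequently.of_forall hqK)
  obtain ⟨s, hs, hsO⟩ := exists_flow_mem hF hN hO hx₀ hx₀s (hKs c hc)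
  have hev : ∀ᶠ q' in 𝓝 c, s ∈ F.flowDom q' ∧ F.flow q' s ∈ O := by
    refine eventually_nhds_of_exp hF (hKs c hc) ?_
    have c1 : Tendsto (fun z => F.exp c (z + s • Complex.I)) (𝓝 0) (𝓝 (F.flow c s)) := by
      have := (exp_continuousAt hF (v := 0 + s • Complex.I)
        (by rw [zero_add]; exact hs)).tendsto.comp
        ((by fun_prop : Continuous fun z : ℂ => z + s • Complex.I).tendsto 0)
      rwa [zero_add] at this
    filter_upwards [flow_box hF hs, c1.eventually (hO.mem_nhds hsO)] with z hz hz'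
    exact ⟨hz.2.1, hz.2.2.2.1 ▸ hz'⟩
  obtain ⟨m₀, hm₀⟩ := exists_nat_gt |s|
  obtain ⟨m, ⟨h1, h2⟩, hm⟩ := ((hcc.frequently hev).and_eventually (eventually_ge_atTop m₀)).exists
  have hms : |s| < m := hm₀.trans_le (by exact_mod_cast hm)
  rw [abs_lt] at hms
  have htm : t m ∈ F.flowDom (q m) := (ordConnected_flowDom _).out
    (zero_mem_flowDom_of_mem (hq m)) (hq m) ⟨by linarith [ht1 m, hms.1], by linarith [ht2 m, hms.1]⟩
  have h3 := flow_add hF htm h1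
  exact hqO m (t m + s) ⟨by linarith [ht1 m], by linarith [ht2 m]⟩ (h3.2 ▸ h2)

theorem exists_uniform_flow_mem_down (hF : F.IsTranslation) (hN : F.NoVerticalSaddle) {O : Set X}
    (hO : IsOpen O) {x₀ : X} (hx₀ : x₀ ∈ O) (hx₀s : x₀ ∉ F.sing) :
    ∃ H > 0, ∀ q, -H ∈ F.flowDom q → ∃ s ∈ Icc 0 H, F.flow q (-s) ∈ O := by
  obtain ⟨L, hLI, hL1⟩ := exists_flip (κ := 1) (σ := -1) (Or.inl rfl) (Or.inr rfl)
  obtain ⟨H, hH, h⟩ := exists_uniform_flow_mem (hF.post L) (hN.post hF hLI (Or.inr rfl)) hO hx₀ hx₀s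
  refine ⟨H, hH, fun q hq => ?_⟩
  obtain ⟨s, hs, hsO⟩ := h q (by
    rw [mem_flowDom_post_iff hF hLI (by norm_num), neg_one_mul]; exact hq)
  rw [flow_post hF hLI (by norm_num), neg_one_mul] at hsO
  · exact ⟨s, hs, hsO⟩
  · rw [neg_one_mul]
    exact (ordConnected_flowDom _).out hq (zero_mem_flowDom_of_mem hq)
      ⟨by linarith [hs.2], by linarith [hs.1]⟩

end Compact
end T2
end FlatStructure

/-! ### Blocked points of a horizontal arc -/

namespace FlatStructure

variable {X : Type*} [TopologicalSpace X] {F : FlatStructure X}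

/-- The exponential map at `p` is defined and injective on the disc of radius `r`. -/
structure IsDisc (F : FlatStructure X) (p : X) (r : ℝ) : Prop where
  pos : 0 < r
  subset_dom : Metric.ball 0 r ⊆ F.dom p
  injOn : InjOn (F.exp p) (Metric.ball 0 r)

theorem mk_mem_ball {r x y : ℝ} (hx : |x| < r / 2) (hy : |y| < r / 2) :
    (⟨x, y⟩ : ℂ) ∈ Metric.ball (0:ℂ) r := by
  rw [mem_ball_zero_iff]
  have := Complex.norm_le_abs_re_add_abs_im ⟨x, y⟩
  simp only at this
  linarith

theorem IsDisc.coe_mem {p : X} {r : ℝ} (hD : F.IsDisc p r) {x : ℝ} (hx : |x| < r / 2) :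
    (x : ℂ) ∈ Metric.ball (0:ℂ) r := by
  rw [mem_ball_zero_iff, Complex.norm_real, Real.norm_eq_abs]
  linarith [hD.pos]

section T2
variable [T2Space X]

theorem IsDisc.flow_eq {p : X} {r : ℝ} (hD : F.IsDisc p r) (hF : F.IsTranslation)
    {x y : ℝ} (hx : |x| < r / 2) (hy : |y| < r / 2) :
    y ∈ F.flowDom (F.exp p x) ∧ F.flow (F.exp p x) y = F.exp p ⟨x, y⟩ := by
  have := exp_exp_of_convex hF (convex_ball (0:ℂ) r) hD.subset_dom (hD.coe_mem hx)
    (mk_mem_ball hx hy)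
  have e : (⟨x, y⟩ : ℂ) - x = y • Complex.I := by apply Complex.ext <;> simp
  rwa [e] at this

/-- A leaf cannot return to a short horizontal arc in a short time. -/
theorem IsDisc.eq_of_flow_eq {p : X} {r : ℝ} (hD : F.IsDisc p r) (hF : F.IsTranslation)
    {x x' y : ℝ} (hx : |x| < r / 2) (hx' : |x'| < r / 2) (hy : |y| < r / 2)
    (h : F.flow (F.exp p x) y = F.exp p x') : x = x' ∧ y = 0 := by
  rw [(hD.flow_eq hF hx hy).2] at h
  have := hD.injOn (mk_mem_ball hx hy) (hD.coe_mem hx') h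
  rw [Complex.ext_iff] at this
  simpa using this

theorem exists_exit_flow (hF : F.IsTranslation) {q : X} (hq : q ∉ F.sing) {S : ℝ} (hS : 0 < S)
    (h : S ∉ F.flowDom q) :
    ∃ τ ∈ Ioc 0 S, τ ∉ F.flowDom q ∧ ∀ s ∈ Ico 0 τ, s ∈ F.flowDom q := by
  obtain ⟨β, hβ, h1, h2⟩ := exists_exit (zero_mem_dom hF hq) h
  refine ⟨β * S, ⟨by have := hβ.1; positivity, by nlinarith [hβ.2]⟩, ?_, fun s hs => ?_⟩
  · rwa [flowDom, mem_ofPred_eq, ← smul_smul]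
  · have := h2 (s / S) ⟨div_nonneg hs.1 hS.le, (div_lt_iff₀ hS).2 hs.2⟩
    rwa [smul_smul, div_mul_cancel₀ _ hS.ne'] at this

section Compact
variable [CompactSpace X]

/-- Only finitely many points of a short horizontal arc run upwards into a singular point within a
given time. They are determined by the point reached shortly before the end, for which there are
finitely many possibilities, and by the time of the end up to `r / 4`, since a leaf does not return
to the arc in a shorter time. -/
theorem IsDisc.finite_blocked {p : X} {r : ℝ} (hD : F.IsDisc p r) (hF : F.IsTranslation) {S : ℝ}
    (hS : 0 < S) : {x : ℝ | |x| < r / 2 ∧ S ∉ F.flowDom (F.exp p x)}.Finite := by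
  have hr := hD.pos
  obtain ⟨τ₁, hτ₁, hfin⟩ := finite_exit hF
  set τ := min τ₁ (r / 2) / 2 with hτ
  have hτ0 : 0 < τ := by positivity
  have hτ1 : τ < τ₁ := by have := min_le_left τ₁ (r / 2); linarith
  have hτ2 : τ < r / 2 := by have := min_le_right τ₁ (r / 2); linarith
  have hQ := hfin τ ⟨hτ0, hτ1⟩
  have hex : ∀ x : ℝ, (|x| < r / 2 ∧ S ∉ F.flowDom (F.exp p x)) → ∃ h ∈ Ioc 0 S,
      h ∉ F.flowDom (F.exp p x) ∧ ∀ s ∈ Ico 0 h, s ∈ F.flowDom (F.exp p x) := fun x hx =>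
    exists_exit_flow hF (exp_notMem_sing hF (hD.subset_dom (hD.coe_mem hx.1))) hS hx.2
  choose! h hh h1 h2 using hex
  have hτh : ∀ x : ℝ, (|x| < r / 2 ∧ S ∉ F.flowDom (F.exp p x)) → τ < h x := by
    intro x hx
    by_contra hcon
    refine h1 x hx (hD.flow_eq hF hx.1 ?_).1
    rw [abs_of_pos (hh x hx).1]; linarith
  refine Finite.of_injOn (t := {q | τ ∉ F.flowDom q ∧ ∀ s ∈ Ico 0 τ, s ∈ F.flowDom q} ×ˢ
    Iic ⌊S / (r / 4)⌋₊) (f := fun x : ℝ => (F.flow (F.exp p x) (h x - τ), ⌊h x / (r / 4)⌋₊))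
    ?_ ?_ (hQ.prod (finite_Iic _))
  · intro x hx
    have hy : h x - τ ∈ F.flowDom (F.exp p x) := h2 x hx _ ⟨by linarith [hτh x hx], by linarith⟩
    refine ⟨⟨fun hm => h1 x hx ?_, fun s hs => ?_⟩, ?_⟩
    · have := (flow_add hF hy hm).1
      rwa [sub_add_cancel] at this
    · have := (flow_sub hF hy (h2 x hx (h x - τ + s)
          ⟨by linarith [hτh x hx, hs.1], by linarith [hs.2]⟩)).1
      rwa [add_sub_cancel_left] at this
    · exact Nat.floor_le_floor (div_le_div_of_nonneg_right (hh x hx).2 (by positivity))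
  · intro x hx x' hx' heq
    rw [Prod.mk.injEq] at heq
    obtain ⟨e1, e2⟩ := heq
    have hy : h x - τ ∈ F.flowDom (F.exp p x) := h2 x hx _ ⟨by linarith [hτh x hx], by linarith⟩
    have hy' : h x' - τ ∈ F.flowDom (F.exp p x') :=
      h2 x' hx' _ ⟨by linarith [hτh x' hx'], by linarith⟩
    have hlt : |h x - h x'| < r / 4 := by
      have h4 : 0 < r / 4 := by positivity
      have a1 := Nat.floor_le (div_nonneg (hh x hx).1.le h4.le)
      have a2 := Nat.lt_floor_add_one (h x / (r / 4))
      have a3 := Nat.floor_le (div_nonneg (hh x' hx').1.le h4.le)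
      have a4 := Nat.lt_floor_add_one (h x' / (r / 4))
      rw [e2] at a1 a2
      have : |h x / (r / 4) - h x' / (r / 4)| < 1 := by
        rw [abs_lt]; constructor <;> linarith
      rwa [← sub_div, abs_div, abs_of_pos h4, div_lt_one h4] at this
    have hn := flow_neg hF hy'
    rw [← e1] at hn
    have := flow_add hF hy hn.1
    rw [hn.2] at this
    refine (hD.eq_of_flow_eq hF hx.1 hx'.1 (y := h x - τ + -(h x' - τ)) ?_ this.2).1
    have e : h x - τ + -(h x' - τ) = h x - h x' := by ring
    rw [e]; linarith

/-- A corner of a developed rectangle that is singular for a vertical side is singular for every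
straight path in the rectangle. -/
theorem notMem_dom_corner (hF : F.IsTranslation) {p₀ : X} {x₁ x₂ x h S : ℝ}
    (hx : x ∈ closure (Ioo x₁ x₂)) (hxd : (x : ℂ) ∈ F.dom p₀)
    (hA : Ioo x₁ x₂ ×ℂ Icc 0 S ⊆ F.columns p₀) (hh : 0 < h) (hhS : h ≤ S)
    (h1 : h ∉ F.flowDom (F.exp p₀ x)) (h2 : ∀ s ∈ Ico 0 h, s ∈ F.flowDom (F.exp p₀ x))
    {z : ℂ} (hz : z ∈ Ioo x₁ x₂ ×ℂ Icc 0 S) :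
    ⟨x, h⟩ - z ∉ F.dom (F.flow (F.exp p₀ z.re) z.im) := by
  intro hmem
  set p := F.flow (F.exp p₀ z.re) z.im with hp
  have hconv : Convex ℝ (Ioo x₁ x₂ ×ℂ Icc 0 S) := convex_reProdIm (convex_Ioo _ _) (convex_Icc _ _)
  have hcont : Continuous fun w : ℂ => z + w := by fun_prop
  -- If the corner were regular, both developments of the rectangle would have the same limit there.
  have hagree : ∀ w ∈ Ioo x₁ x₂ ×ℂ Icc 0 S,
      F.exp p (w - z) = F.flow (F.exp p₀ w.re) w.im := by
    intro w hw
    have hd := ((isDev_columns hF p₀).comp (f := fun w : ℂ => z + w)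
      (C' := (fun w : ℂ => z + w) ⁻¹' F.columns p₀) hcont.continuousOn (fun _ h => h)).congr_dev
      (d' := id) (-z) (by intro u _; simp)
    have := mem_dom_of_segment hF ((isOpen_columns hF p₀).preimage hcont) (v := w - z) (p := p) ?_
      (by simp [hp]) hd
    · rw [this.2]; simp
    · intro u hu
      apply hA
      apply hconv.segment_subset hz hw
      have := (mem_segment_translate ℝ z (x := u) (b := 0) (c := w - z)).2 hu
      simpa using this
  have hcl : Tendsto (fun y : ℝ => F.exp p (⟨x, y⟩ - z)) (𝓝[<] h) (𝓝 (F.exp p (⟨x, h⟩ - z))) := by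
    have hc : Continuous fun y : ℝ => (⟨x, y⟩ : ℂ) - z := by
      have : (fun y : ℝ => (⟨x, y⟩ : ℂ) - z) = fun y : ℝ => (x : ℂ) + y * Complex.I - z := by
        funext y; congr 1; apply Complex.ext <;> simp
      rw [this]; fun_prop
    exact ((exp_continuousAt hF hmem).tendsto.comp (hc.tendsto h)).mono_left nhdsWithin_le_nhds
  obtain ⟨ρ, hρ, hsub⟩ := Metric.isOpen_iff.1 (isOpen_dom p) _ hmem
  have hne : (𝓝[Ioo x₁ x₂] x).NeBot := mem_closure_iff_nhdsWithin_neBot.1 hx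
  have heq : ∀ y ∈ Ico 0 h, h - ρ < y → F.exp p (⟨x, y⟩ - z) = F.flow (F.exp p₀ x) y := by
    intro y hy hyρ
    have hcx : Continuous fun x : ℝ => (⟨x, y⟩ : ℂ) := by
      have : (fun x : ℝ => (⟨x, y⟩ : ℂ)) = fun x : ℝ => (x : ℂ) + y * Complex.I := by
        funext x; apply Complex.ext <;> simp
      rw [this]; fun_prop
    have hin : (⟨x, y⟩ : ℂ) - z ∈ F.dom p := by
      apply hsub
      rw [Metric.mem_ball, dist_eq_norm, sub_sub_sub_cancel_right]
      have e : (⟨x, y⟩ : ℂ) - ⟨x, h⟩ = (y - h) • Complex.I := by apply Complex.ext <;> simp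
      rw [e, norm_smul, Complex.norm_I, mul_one, Real.norm_eq_abs, abs_lt]
      constructor <;> linarith [hy.2]
    have t1 : Tendsto (fun x' : ℝ => F.exp p (⟨x', y⟩ - z)) (𝓝[Ioo x₁ x₂] x)
        (𝓝 (F.exp p (⟨x, y⟩ - z))) :=
      ((exp_continuousAt hF hin).tendsto.comp ((hcx.sub continuous_const).tendsto x)).mono_left
        nhdsWithin_le_nhds
    have hcol : (⟨x, y⟩ : ℂ) ∈ F.columns p₀ := ⟨hxd, h2 y hy⟩
    have t2 : Tendsto (fun x' : ℝ => F.flow (F.exp p₀ x') y) (𝓝[Ioo x₁ x₂] x)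
        (𝓝 (F.flow (F.exp p₀ x) y)) :=
      (((isDev_columns hF p₀).1.continuousAt ((isOpen_columns hF p₀).mem_nhds hcol)).tendsto.comp
        (hcx.tendsto x)).mono_left nhdsWithin_le_nhds
    refine tendsto_nhds_unique (t1.congr' ?_) t2
    filter_upwards [self_mem_nhdsWithin] with x' hx'
    exact hagree ⟨x', y⟩ ⟨hx', hy.1, hy.2.le.trans hhS⟩
  obtain ⟨P, hP, hPt⟩ := flow_tendsto_sing hF hh h1 h2
  have hPeq : P = F.exp p (⟨x, h⟩ - z) := by
    refine tendsto_nhds_unique (hPt.congr' ?_) hcl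
    filter_upwards [Ioo_mem_nhdsLT (max_lt hh (by linarith : h - ρ < h))] with y hy
    exact (heq y ⟨(le_max_left _ _).trans hy.1.le, hy.2⟩ ((le_max_right _ _).trans_lt hy.1)).symm
  exact exp_notMem_sing hF hmem (hPeq ▸ hP)

/-- Two points of a short horizontal arc that run upwards into singular points within time `S`
produce a saddle connection: between neighbouring such points the surface contains a rectangle of
height `S`, and the segment in it that joins the two singular points is a saddle connection. -/
theorem IsDisc.exists_saddle_of_blocked {p : X} {r : ℝ} (hD : F.IsDisc p r) (hF : F.IsTranslation)
    {S x₁ x₂ : ℝ} (hS : 0 < S) (h1 : |x₁| < r / 2) (h2 : |x₂| < r / 2) (h12 : x₁ < x₂)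
    (hb1 : S ∉ F.flowDom (F.exp p x₁)) (hb2 : S ∉ F.flowDom (F.exp p x₂)) :
    ∃ γ v, F.IsSaddleConnection γ v ∧ |v.re| ≤ x₂ - x₁ ∧ |v.im| ≤ S := by
  -- The next blocked point `x₃` on the right of `x₁`.
  have hfin := (hD.finite_blocked hF hS).subset (t := {x : ℝ | (|x| < r / 2 ∧
    S ∉ F.flowDom (F.exp p x)) ∧ x ∈ Ioc x₁ x₂}) (fun x hx => hx.1)
  obtain ⟨x₃, ⟨⟨h3, hb3⟩, hx₃⟩, hmin⟩ := exists_min_image _ id hfin ⟨x₂, ⟨h2, hb2⟩, h12, le_rfl⟩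
  have hreg : ∀ x : ℝ, |x| < r / 2 → F.exp p x ∉ F.sing := fun x hx =>
    exp_notMem_sing hF (hD.subset_dom (hD.coe_mem hx))
  have hA : Ioo x₁ x₃ ×ℂ Icc 0 S ⊆ F.columns p := by
    intro z hz
    have hzr : |z.re| < r / 2 := by
      rw [abs_lt] at h1 h3 ⊢
      constructor <;> linarith [hz.1.1, hz.1.2]
    refine ⟨hD.subset_dom (hD.coe_mem hzr), ?_⟩
    have : S ∈ F.flowDom (F.exp p z.re) := by
      by_contra hcon
      have := hmin z.re ⟨⟨hzr, hcon⟩, hz.1.1, hz.1.2.le.trans hx₃.2⟩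
      exact absurd this (not_le.2 hz.1.2)
    exact (ordConnected_flowDom _).out (zero_mem_flowDom_of_mem this) this hz.2
  have hcl : closure (Ioo x₁ x₃) = Icc x₁ x₃ := closure_Ioo hx₃.1.ne
  obtain ⟨y₁, hy₁, e1, e1'⟩ := exists_exit_flow hF (hreg x₁ h1) hS hb1
  obtain ⟨y₃, hy₃, e3, e3'⟩ := exists_exit_flow hF (hreg x₃ h3) hS hb3
  -- The diagonal, and its midpoint as the base point.
  set v : ℂ := ⟨x₃ - x₁, y₃ - y₁⟩ with hv
  set z : ℂ := ⟨(x₁ + x₃) / 2, (y₁ + y₃) / 2⟩ with hz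
  have hpath : ∀ s : ℝ, |s| < 1 / 2 → z + s • v ∈ Ioo x₁ x₃ ×ℂ Icc 0 S := by
    intro s hs
    rw [abs_lt] at hs
    have := hx₃.1
    have := hy₁.1
    have := hy₃.1
    have := hy₁.2
    have := hy₃.2
    refine ⟨⟨?_, ?_⟩, ⟨?_, ?_⟩⟩ <;> simp [hz, hv] <;> nlinarith
  have hzA : z ∈ Ioo x₁ x₃ ×ℂ Icc 0 S := by simpa using hpath 0 (by norm_num)
  have c1 := notMem_dom_corner hF (x := x₁) (by rw [hcl]; exact left_mem_Icc.2 hx₃.1.le)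
    (hD.subset_dom (hD.coe_mem h1)) hA hy₁.1 hy₁.2 e1 e1' hzA
  have c3 := notMem_dom_corner hF (x := x₃) (by rw [hcl]; exact right_mem_Icc.2 hx₃.1.le)
    (hD.subset_dom (hD.coe_mem h3)) hA hy₃.1 hy₃.2 e3 e3' hzA
  set q := F.flow (F.exp p z.re) z.im with hq
  have hconv : Convex ℝ (Ioo x₁ x₃ ×ℂ Icc 0 S) := convex_reProdIm (convex_Ioo _ _) (convex_Icc _ _)
  have hin : ∀ s : ℝ, |s| < 1 / 2 → s • v ∈ F.dom q := by
    intro s hs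
    have hcont : Continuous fun w : ℂ => z + w := by fun_prop
    have hd := ((isDev_columns hF p).comp (f := fun w : ℂ => z + w)
      (C' := (fun w : ℂ => z + w) ⁻¹' F.columns p) hcont.continuousOn (fun _ h => h)).congr_dev
      (d' := id) (-z) (by intro u _; simp)
    refine (mem_dom_of_segment hF ((isOpen_columns hF p).preimage hcont) ?_ (by simp [hq]) hd).1
    intro u hu
    apply hA
    apply hconv.segment_subset hzA (hpath s hs)
    have := (mem_segment_translate ℝ z (x := u) (b := 0) (c := s • v)).2 hu
    simpa using this
  have hqs : q ∉ F.sing := flow_notMem_sing hF (hA hzA).2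
  obtain ⟨γ, hγ⟩ := exists_saddle hF hqs (α := 1 / 2) (β := 1 / 2) (v := v) (by norm_num)
    (by norm_num) (fun s hs => hin s (by rw [abs_of_nonneg hs.1]; exact hs.2))
    (by
      convert c3 using 2
      apply Complex.ext <;> simp [hz, hv] <;> ring)
    (fun s hs => hin (-s) (by rw [abs_neg, abs_of_nonneg hs.1]; exact hs.2))
    (by
      convert c1 using 2
      apply Complex.ext <;> simp [hz, hv] <;> ring)
  refine ⟨γ, _, hγ, ?_, ?_⟩
  · have : ((1 / 2 + 1 / 2 : ℝ) • v).re = x₃ - x₁ := by rw [add_halves, one_smul]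
    rw [this, abs_of_pos (by linarith [hx₃.1])]
    linarith [hx₃.2]
  · have : ((1 / 2 + 1 / 2 : ℝ) • v).im = y₃ - y₁ := by rw [add_halves, one_smul]
    rw [this, abs_le]
    constructor <;> linarith [hy₁.1, hy₁.2, hy₃.1, hy₃.2]

end Compact
end T2
end FlatStructure

/-! ### Interval exchanges and numbers of visits -/

/-- `T` is an injective map of the interval `(a, b)`, defined and locally a translation away from
the set `B` (the values on `B` are irrelevant). -/
structure IsIntervalExchange (a b : ℝ) (T : ℝ → ℝ) (B : Set ℝ) : Prop where
  lt : a < b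
  measurable : Measurable T
  mapsTo : ∀ x ∈ Ioo a b, x ∉ B → T x ∈ Ioo a b
  injOn : InjOn T (Ioo a b \ B)
  eventually : ∀ x ∈ Ioo a b, x ∉ B → ∀ᶠ y in 𝓝 x, y ∉ B ∧ T y = y + (T x - x)

/-- The points whose first `n` iterates do not all exist. -/
def badSet (a b : ℝ) (T : ℝ → ℝ) (B : Set ℝ) (n : ℕ) : Set ℝ :=
  {x | x ∈ Ioo a b ∧ ∃ k < n, T^[k] x ∈ B}

/-- The discontinuities of the `n`-th iterate, together with the ends of the interval, are
`c / n`-separated. -/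
def IsSeparatedAt (a b : ℝ) (T : ℝ → ℝ) (B : Set ℝ) (c : ℝ) (n : ℕ) : Prop :=
  0 < n ∧ ∀ x ∈ badSet a b T B n ∪ {a, b}, ∀ y ∈ badSet a b T B n ∪ {a, b}, x < y → c / n ≤ y - x

namespace IsIntervalExchange

variable {a b : ℝ} {T : ℝ → ℝ} {B : Set ℝ}

theorem badSet_mono {m n : ℕ} (h : m ≤ n) : badSet a b T B m ⊆ badSet a b T B n :=
  fun _ hx => ⟨hx.1, hx.2.imp fun _ hk => ⟨hk.1.trans_le h, hk.2⟩⟩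

theorem iterate_notMem {x : ℝ} {n : ℕ} (hx : x ∈ Ioo a b) (hn : x ∉ badSet a b T B n) {k : ℕ}
    (hk : k < n) : T^[k] x ∉ B := fun h => hn ⟨hx, k, hk, h⟩

theorem iterate_mem (hT : IsIntervalExchange a b T B) {x : ℝ} {n : ℕ} (hx : x ∈ Ioo a b)
    (hn : x ∉ badSet a b T B n) {k : ℕ} (hk : k ≤ n) : T^[k] x ∈ Ioo a b := by
  induction k with
  | zero => exact hx
  | succ k ih =>
    rw [Function.iterate_succ_apply']
    exact hT.mapsTo _ (ih (by omega)) (iterate_notMem hx hn (by omega))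

theorem mem_badSet_of_iterate {x : ℝ} {k m : ℕ} (hx : x ∈ Ioo a b)
    (h : T^[k] x ∈ badSet a b T B m) : x ∈ badSet a b T B (k + m) := by
  obtain ⟨-, j, hj, hjB⟩ := h
  refine ⟨hx, j + k, by omega, ?_⟩
  rwa [Function.iterate_add_apply]

theorem iterate_notMem_badSet {x : ℝ} {k m n : ℕ}
    (hx : x ∈ Ioo a b) (hn : x ∉ badSet a b T B n) (h : k + m ≤ n) :
    T^[k] x ∉ badSet a b T B m := fun hk =>
  hn (badSet_mono h (mem_badSet_of_iterate hx hk))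

theorem iterate_injOn (hT : IsIntervalExchange a b T B) {n k : ℕ} (hk : k ≤ n) :
    InjOn T^[k] (Ioo a b \ badSet a b T B n) := by
  induction k with
  | zero => intro x _ y _ h; exact h
  | succ k ih =>
    intro x hx y hy h
    rw [Function.iterate_succ_apply', Function.iterate_succ_apply'] at h
    apply ih (by omega) hx hy
    refine hT.injOn ⟨hT.iterate_mem hx.1 hx.2 (by omega), iterate_notMem hx.1 hx.2 (by omega)⟩
      ⟨hT.iterate_mem hy.1 hy.2 (by omega), iterate_notMem hy.1 hy.2 (by omega)⟩ h

theorem eventually_iterate (hT : IsIntervalExchange a b T B) {x : ℝ} {n : ℕ} (hx : x ∈ Ioo a b)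
    (hn : x ∉ badSet a b T B n) : ∀ᶠ y in 𝓝 x, T^[n] y = y + (T^[n] x - x) := by
  induction n with
  | zero => simp
  | succ n ih =>
    have h1 := ih (fun h => hn (badSet_mono (Nat.le_succ n) h))
    have h2 := hT.eventually _ (hT.iterate_mem hx hn (Nat.le_succ n))
      (iterate_notMem hx hn (Nat.lt_succ_self n))
    have hc : Tendsto (fun y => T^[n] y) (𝓝 x) (𝓝 (T^[n] x)) := by
      have : Tendsto (fun y => y + (T^[n] x - x)) (𝓝 x) (𝓝 (x + (T^[n] x - x))) :=
        (by fun_prop : Continuous fun y => y + (T^[n] x - x)).tendsto x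
      rw [add_sub_cancel] at this
      exact this.congr' (h1.mono fun y hy => hy.symm)
    filter_upwards [h1, hc.eventually h2] with y h3 h4
    rw [Function.iterate_succ_apply', h4.2, h3, Function.iterate_succ_apply']
    ring

/-- An iterate is a translation on each interval without discontinuities. -/
theorem iterate_eq_add (hT : IsIntervalExchange a b T B) {p q : ℝ} {n : ℕ}
    (hpq : Ioo p q ⊆ Ioo a b) (hd : Disjoint (Ioo p q) (badSet a b T B n)) {x y : ℝ}
    (hx : x ∈ Ioo p q) (hy : y ∈ Ioo p q) {k : ℕ} (hk : k ≤ n) :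
    T^[k] y = y + (T^[k] x - x) := by
  have := isPreconnected_Ioo.eq_of_locally_eq (f := fun y => T^[k] y - y) ?_ hx hy
  · have h : T^[k] x - x = T^[k] y - y := this
    linarith
  · intro z hz
    have hzn : z ∉ badSet a b T B k := fun h => disjoint_left.1 hd hz (badSet_mono hk h)
    filter_upwards [(hT.eventually_iterate (hpq hz) hzn).filter_mono nhdsWithin_le_nhds] with w hw
    rw [hw]; ring

theorem finite_of_isSeparatedAt {c : ℝ} (hc : 0 < c) {n : ℕ}
    (h : IsSeparatedAt a b T B c n) : (badSet a b T B n).Finite := by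
  have hn : (0:ℝ) < n := by exact_mod_cast h.1
  have hcn : 0 < c / n := by positivity
  refine Finite.of_injOn (f := fun x => ⌊x / (c / n)⌋) (t := Icc ⌊a / (c / n)⌋ ⌊b / (c / n)⌋) ?_ ?_
    (finite_Icc _ _)
  · intro x hx
    exact ⟨Int.floor_le_floor (div_le_div_of_nonneg_right hx.1.1.le hcn.le),
      Int.floor_le_floor (div_le_div_of_nonneg_right hx.1.2.le hcn.le)⟩
  · intro x hx y hy hxy
    have hlt := Int.abs_sub_lt_one_of_floor_eq_floor hxy
    rw [← sub_div, abs_div, abs_of_pos hcn, div_lt_one hcn] at hlt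
    rcases lt_trichotomy x y with hl | hl | hl
    · have := h.2 x (Or.inl hx) y (Or.inl hy) hl
      rw [abs_sub_comm, abs_of_pos (by linarith)] at hlt
      linarith
    · exact hl
    · have := h.2 y (Or.inl hy) x (Or.inl hx) hl
      rw [abs_of_pos (by linarith)] at hlt
      linarith

theorem finite_badSet {c : ℝ} (hc : 0 < c)
    (h : ∃ᶠ n in atTop, IsSeparatedAt a b T B c n) (n : ℕ) : (badSet a b T B n).Finite := by
  obtain ⟨m, hm, hnm⟩ := (h.and_eventually (eventually_ge_atTop n)).exists
  exact (finite_of_isSeparatedAt hc hm).subset (badSet_mono hnm)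

/-- The maximal interval around a point on which an iterate is continuous. -/
theorem exists_component (hab : a < b) {n : ℕ} (hfin : (badSet a b T B n).Finite) {x : ℝ}
    (hx : x ∈ Ioo a b) (hn : x ∉ badSet a b T B n) :
    ∃ p ∈ badSet a b T B n ∪ {a, b}, ∃ q ∈ badSet a b T B n ∪ {a, b}, x ∈ Ioo p q ∧
      Ioo p q ⊆ Ioo a b ∧ Disjoint (Ioo p q) (badSet a b T B n) ∧ q ≠ a ∧ p ≠ b := by
  have hf : (badSet a b T B n ∪ {a, b}).Finite := hfin.union (by simp)
  obtain ⟨p, ⟨hp, hpx⟩, hpmax⟩ := exists_max_image _ id (hf.inter_of_left (Iio x))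
    ⟨a, Or.inr (by simp), hx.1⟩
  obtain ⟨q, ⟨hq, hqx⟩, hqmin⟩ := exists_min_image _ id (hf.inter_of_left (Ioi x))
    ⟨b, Or.inr (by simp), hx.2⟩
  have hpa : a ≤ p := hpmax a ⟨Or.inr (by simp), hx.1⟩
  have hqb : q ≤ b := hqmin b ⟨Or.inr (by simp), hx.2⟩
  simp only [mem_Iio, mem_Ioi] at hpx hqx
  refine ⟨p, hp, q, hq, ⟨hpx, hqx⟩, Ioo_subset_Ioo hpa hqb, ?_, ?_, ?_⟩
  · rw [disjoint_left]
    intro z hz hzb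
    rcases lt_trichotomy z x with h | h | h
    · exact absurd (hpmax z ⟨Or.inl hzb, h⟩) (not_le.2 hz.1)
    · exact hn (h ▸ hzb)
    · exact absurd (hqmin z ⟨Or.inl hzb, h⟩) (not_le.2 hz.2)
  · rintro rfl; linarith [hx.1]
  · rintro rfl; linarith [hx.2]

theorem exists_component_of_isSeparatedAt (hab : a < b) {c : ℝ} (hc : 0 < c) {n : ℕ}
    (h : IsSeparatedAt a b T B c n) {x : ℝ} (hx : x ∈ Ioo a b) (hn : x ∉ badSet a b T B n) :
    ∃ p q, x ∈ Ioo p q ∧ Ioo p q ⊆ Ioo a b ∧ Disjoint (Ioo p q) (badSet a b T B n) ∧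
      c / n ≤ q - p := by
  obtain ⟨p, hp, q, hq, hx', h1, h2, -, -⟩ :=
    exists_component hab (finite_of_isSeparatedAt hc h) hx hn
  exact ⟨p, q, hx', h1, h2, h.2 p hp q hq (hx'.1.trans hx'.2)⟩

/-- The orbit of `x₀` never meets `B` and visits every interval. -/
def IsDenseOrbit (a b : ℝ) (T : ℝ → ℝ) (B : Set ℝ) (x₀ : ℝ) : Prop :=
  x₀ ∈ Ioo a b ∧ (∀ k, T^[k] x₀ ∉ B) ∧ ∀ u v, a ≤ u → u < v → v ≤ b → ∃ k, T^[k] x₀ ∈ Ioo u v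

theorem IsDenseOrbit.notMem_badSet {x₀ : ℝ} (h : IsDenseOrbit a b T B x₀) (k n : ℕ) :
    T^[k] x₀ ∉ badSet a b T B n := by
  rintro ⟨-, j, -, hj⟩
  rw [← Function.iterate_add_apply] at hj
  exact h.2.1 _ hj

theorem IsDenseOrbit.iterate_mem {x₀ : ℝ} (h : IsDenseOrbit a b T B x₀)
    (hT : IsIntervalExchange a b T B) (k : ℕ) : T^[k] x₀ ∈ Ioo a b :=
  hT.iterate_mem h.1 (h.notMem_badSet 0 k) le_rfl

/-- No iterate has fixed points, since otherwise it would be the identity on an interval, and the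
dense orbit would be periodic. -/
theorem iterate_ne_self (hT : IsIntervalExchange a b T B) {x₀ : ℝ}
    (h0 : IsDenseOrbit a b T B x₀) {p q : ℝ} {m : ℕ} (hm : 0 < m) (hpq : Ioo p q ⊆ Ioo a b)
    (hd : Disjoint (Ioo p q) (badSet a b T B m)) {x : ℝ} (hx : x ∈ Ioo p q) : T^[m] x ≠ x := by
  intro hfix
  have hlt : p < q := hx.1.trans hx.2
  have hap : a ≤ p ∧ q ≤ b := (Ioo_subset_Ioo_iff hlt).1 hpq
  obtain ⟨k, hk⟩ := h0.2.2 p q hap.1 hlt hap.2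
  have hper : T^[m] (T^[k] x₀) = T^[k] x₀ := by
    have := hT.iterate_eq_add hpq hd hx hk (le_refl m)
    rw [this, hfix]; ring
  have hmul : ∀ j, T^[m * j] (T^[k] x₀) = T^[k] x₀ := by
    intro j
    rw [Function.iterate_mul]
    exact Function.iterate_fixed hper j
  -- The orbit is finite, so it misses some interval.
  have hfin : (range fun i => T^[i] x₀).Finite := by
    refine ((finite_Iio (k + m)).image fun i => T^[i] x₀).subset ?_
    rintro _ ⟨i, rfl⟩
    rcases lt_or_ge i (k + m) with hi | hi
    · exact ⟨i, hi, rfl⟩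
    · refine ⟨k + (i - k) % m, by simpa using Nat.mod_lt _ hm, ?_⟩
      have e : i = (i - k) % m + (m * ((i - k) / m) + k) := by
        have := Nat.mod_add_div (i - k) m
        omega
      change T^[k + (i - k) % m] x₀ = T^[i] x₀
      conv_rhs => rw [e, Function.iterate_add_apply, Function.iterate_add_apply _ (m * _), hmul]
      rw [add_comm, Function.iterate_add_apply]
  have hinf : (Ioo a b \ (range fun i => T^[i] x₀)).Nonempty :=
    ((Ioo_infinite hT.lt).sdiff hfin).nonempty
  obtain ⟨y, hy, hyr⟩ := hinf
  have hopen : IsOpen (Ioo a b \ (range fun i => T^[i] x₀)) := isOpen_Ioo.sdiff hfin.isClosed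
  obtain ⟨u, v, hyuv, huv⟩ := mem_nhds_iff_exists_Ioo_subset.1 (hopen.mem_nhds ⟨hy, hyr⟩)
  have hlt' : u < v := hyuv.1.trans hyuv.2
  have hab' := (Ioo_subset_Ioo_iff hlt').1 (huv.trans sdiff_subset)
  obtain ⟨i, hi⟩ := h0.2.2 u v hab'.1 hlt' hab'.2
  exact (huv hi).2 ⟨i, rfl⟩

/-- Returns in time at most `n / 2` displace by at least `c / n`: the point of the component that is
mapped to its end is a discontinuity, and so is this end. -/
theorem le_abs_iterate_sub (hT : IsIntervalExchange a b T B) {x₀ : ℝ}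
    (h0 : IsDenseOrbit a b T B x₀) {c : ℝ} (hc : 0 < c) {n : ℕ} (hsep : IsSeparatedAt a b T B c n)
    {p q : ℝ} (hpq : Ioo p q ⊆ Ioo a b) (hd : Disjoint (Ioo p q) (badSet a b T B n))
    {m : ℕ} (hm : 0 < m) (hmn : 2 * m ≤ n) {x : ℝ} (hx : x ∈ Ioo p q) (hTx : T^[m] x ∈ Ioo p q) :
    c / n ≤ |T^[m] x - x| := by
  have hfm : (badSet a b T B m).Finite :=
    (finite_of_isSeparatedAt hc hsep).subset (badSet_mono (by omega))
  have hxb : x ∉ badSet a b T B m := fun h => disjoint_left.1 hd hx (badSet_mono (by omega) h)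
  obtain ⟨p', hp', q', hq', hx', h1, h2, hqa, hpb⟩ := exists_component hT.lt hfm (hpq hx) hxb
  -- The point `T^[m] x` lies in the same component, since `(p, q)` avoids the bad set.
  have hTx' : T^[m] x ∈ Ioo p' q' := by
    have hlt : ∀ z ∈ badSet a b T B m ∪ {a, b}, z ∉ Ioo p q := by
      rintro z (hz | hz) hzpq
      · exact disjoint_left.1 hd hzpq (badSet_mono (by omega) hz)
      · rcases hz with rfl | hz
        · exact lt_irrefl _ (hpq hzpq).1
        · rw [mem_singleton_iff] at hz
          subst hz
          exact lt_irrefl _ (hpq hzpq).2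
    constructor
    · by_contra hcon
      exact hlt p' hp' ⟨hTx.1.trans_le (not_lt.1 hcon), hx'.1.trans hx.2⟩
    · by_contra hcon
      exact hlt q' hq' ⟨hx.1.trans hx'.2, (not_lt.1 hcon).trans_lt hTx.2⟩
  have hne := hT.iterate_ne_self h0 hm h1 h2 hx'
  have hmem : ∀ z ∈ badSet a b T B m, z ∈ badSet a b T B n := fun z hz =>
    badSet_mono (by omega) hz
  rcases lt_or_gt_of_ne hne with hlt | hgt
  · set d := T^[m] x - x with hdd
    have hw : p' - d ∈ Ioo p' q' := ⟨by linarith, by linarith [hTx'.1, hx'.2]⟩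
    have hTw : T^[m] (p' - d) = p' := by
      have := hT.iterate_eq_add h1 h2 hx' hw (le_refl m)
      rw [this]; ring
    have hwb : p' - d ∉ badSet a b T B m := disjoint_left.1 h2 hw
    have hp'm : p' ∈ badSet a b T B m := by
      have := hT.iterate_mem (h1 hw) hwb (le_refl m)
      rw [hTw] at this
      rcases hp' with h | h
      · exact h
      · rcases h with h | h
        · exact absurd this.1 (by rw [h]; exact lt_irrefl _)
        · exact absurd h hpb
    have hw2 : p' - d ∈ badSet a b T B n :=
      badSet_mono (by omega) (mem_badSet_of_iterate (k := m) (m := m) (h1 hw) (by rwa [hTw]))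
    have := hsep.2 p' (Or.inl (hmem _ hp'm)) (p' - d) (Or.inl hw2) hw.1
    rw [abs_of_neg (by linarith)]
    linarith
  · set d := T^[m] x - x with hdd
    have hw : q' - d ∈ Ioo p' q' := ⟨by linarith [hTx'.2, hx'.1], by linarith⟩
    have hTw : T^[m] (q' - d) = q' := by
      have := hT.iterate_eq_add h1 h2 hx' hw (le_refl m)
      rw [this]; ring
    have hwb : q' - d ∉ badSet a b T B m := disjoint_left.1 h2 hw
    have hq'm : q' ∈ badSet a b T B m := by
      have := hT.iterate_mem (h1 hw) hwb (le_refl m)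
      rw [hTw] at this
      rcases hq' with h | h
      · exact h
      · rcases h with h | h
        · exact absurd h hqa
        · exact absurd this.2 (by rw [mem_singleton_iff.1 h]; exact lt_irrefl _)
    have hw2 : q' - d ∈ badSet a b T B n :=
      badSet_mono (by omega) (mem_badSet_of_iterate (k := m) (m := m) (h1 hw) (by rwa [hTw]))
    have := hsep.2 (q' - d) (Or.inl hw2) q' (Or.inl (hmem _ hq'm)) hw.2
    rw [abs_of_pos (by linarith)]
    linarith

/-- A discrete intermediate value theorem. -/
theorem _root_.exists_eq_of_steps {g : ℕ → ℕ} (h1 : ∀ k, g (k + 1) ≤ g k + 1)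
    (h2 : ∀ k, g k ≤ g (k + 1) + 1) {k₁ k₂ j : ℕ} (hj1 : g k₁ ≤ j) (hj2 : j ≤ g k₂) :
    ∃ k, g k = j := by
  rcases le_total k₁ k₂ with h | h
  · obtain ⟨d, rfl⟩ := Nat.exists_eq_add_of_le h
    clear h
    induction d with
    | zero => exact ⟨k₁, le_antisymm hj1 hj2⟩
    | succ d ih =>
      rcases le_or_gt j (g (k₁ + d)) with h | h
      · exact ih h
      · exact ⟨k₁ + d + 1, by have := h1 (k₁ + d); have : j ≤ g (k₁ + d + 1) := hj2; omega⟩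
  · obtain ⟨d, rfl⟩ := Nat.exists_eq_add_of_le h
    clear h
    induction d with
    | zero => exact ⟨k₂, le_antisymm hj1 hj2⟩
    | succ d ih =>
      rcases le_or_gt (g (k₂ + d)) j with h | h
      · exact ih h
      · exact ⟨k₂ + d + 1, by have := h2 (k₂ + d); have : g (k₂ + d + 1) ≤ j := hj1; omega⟩

/-- The number of the first `n` points of the orbit of `x` that lie to the left of `d`. -/
def visits (T : ℝ → ℝ) (d : ℝ) (n : ℕ) (x : ℝ) : ℕ :=
  ((Finset.range n).filter fun k => T^[k] x < d).card

theorem visits_apply (T : ℝ → ℝ) (d : ℝ) (n : ℕ) (x : ℝ) :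
    visits T d n (T x) + (if x < d then 1 else 0) =
      visits T d n x + (if T^[n] x < d then 1 else 0) := by
  have h : ∀ y, visits T d n y = ∑ k ∈ Finset.range n, if T^[k] y < d then 1 else 0 := fun y =>
    Finset.card_filter _ _
  rw [h (T x), h x, ← Finset.sum_range_succ (fun k => if T^[k] x < d then 1 else 0),
    Finset.sum_range_succ']
  simp only [Function.iterate_succ_apply, Function.iterate_zero, id]
  rfl

/-- The number of visits is constant on intervals without discontinuities. -/
theorem visits_eq (hT : IsIntervalExchange a b T B) {d : ℝ} {m n : ℕ} (hdm : d ∈ badSet a b T B m)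
    {p q : ℝ} (hpq : Ioo p q ⊆ Ioo a b) (hd : Disjoint (Ioo p q) (badSet a b T B (n + m)))
    {x y : ℝ} (hx : x ∈ Ioo p q) (hy : y ∈ Ioo p q) : visits T d n x = visits T d n y := by
  have key : ∀ x ∈ Ioo p q, ∀ y ∈ Ioo p q, ∀ k < n, T^[k] x < d → T^[k] y < d := by
    intro x hx y hy k hk hxd
    by_contra hyd
    rw [not_lt] at hyd
    have e := hT.iterate_eq_add hpq hd hx hy (k := k) (by omega)
    set w := x + (d - T^[k] x) with hw
    have hwm : w ∈ Ioo p q := ⟨by linarith [hx.1], by linarith [hy.2]⟩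
    have hTw : T^[k] w = d := by
      rw [hT.iterate_eq_add hpq hd hx hwm (k := k) (by omega), hw]; ring
    exact disjoint_left.1 hd hwm (badSet_mono (by omega)
      (mem_badSet_of_iterate (k := k) (hpq hwm) (hTw.symm ▸ hdm)))
  unfold visits
  congr 1
  refine Finset.filter_congr fun k hk => ?_
  rw [Finset.mem_range] at hk
  exact ⟨key x hx y hy k hk, key y hy x hx k hk⟩

/-- Along a dense orbit all intermediate numbers of visits occur, each of them on an interval of
length at least `c / (n + m)`. -/
theorem exists_interval_visits (hT : IsIntervalExchange a b T B) {x₀ : ℝ}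
    (h0 : IsDenseOrbit a b T B x₀) {c : ℝ} (hc : 0 < c) {d : ℝ} {m n : ℕ}
    (hdm : d ∈ badSet a b T B m) (hsep : IsSeparatedAt a b T B c (n + m)) {x₁ x₂ : ℝ}
    (hx₁ : x₁ ∈ Ioo a b) (hx₁b : x₁ ∉ badSet a b T B (n + m)) (hx₂ : x₂ ∈ Ioo a b)
    (hx₂b : x₂ ∉ badSet a b T B (n + m)) {j : ℕ} (hj1 : visits T d n x₁ ≤ j)
    (hj2 : j ≤ visits T d n x₂) :
    ∃ p q, Ioo p q ⊆ Ioo a b ∧ c / (n + m : ℕ) ≤ q - p ∧ ∀ x ∈ Ioo p q, visits T d n x = j := by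
  have hfind : ∀ x ∈ Ioo a b, x ∉ badSet a b T B (n + m) →
      ∃ k, visits T d n (T^[k] x₀) = visits T d n x := by
    intro x hx hxb
    obtain ⟨p, q, hxpq, hpq, hd, -⟩ := exists_component_of_isSeparatedAt hT.lt hc hsep hx hxb
    have hlt := hxpq.1.trans hxpq.2
    have hap := (Ioo_subset_Ioo_iff hlt).1 hpq
    obtain ⟨k, hk⟩ := h0.2.2 p q hap.1 hlt hap.2
    exact ⟨k, hT.visits_eq hdm hpq hd hk hxpq⟩
  obtain ⟨k₁, hk₁⟩ := hfind x₁ hx₁ hx₁b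
  obtain ⟨k₂, hk₂⟩ := hfind x₂ hx₂ hx₂b
  obtain ⟨k, hk⟩ := exists_eq_of_steps (g := fun k => visits T d n (T^[k] x₀)) (k₁ := k₁)
    (k₂ := k₂) (j := j) (fun k => by
      have := visits_apply T d n (T^[k] x₀)
      rw [Function.iterate_succ_apply']
      split_ifs at this <;> omega) (fun k => by
      have := visits_apply T d n (T^[k] x₀)
      rw [Function.iterate_succ_apply']
      split_ifs at this <;> omega) (hk₁.trans_le hj1) (hj2.trans_eq hk₂.symm)
  obtain ⟨p, q, hxpq, hpq, hd, hlen⟩ := exists_component_of_isSeparatedAt hT.lt hc hsep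
    (h0.iterate_mem hT k) (h0.notMem_badSet k _)
  exact ⟨p, q, hpq, hlen, fun x hx => (hT.visits_eq hdm hpq hd hx hxpq).trans hk⟩

end IsIntervalExchange

/-! ### Ergodic averages and invariant measures -/

/-- The averages of the number of visits to a set converge in measure to an invariant function. This
is the mean ergodic theorem of von Neumann. -/
theorem MeasureTheory.MeasurePreserving.exists_tendstoInMeasure {α : Type*} [MeasurableSpace α]
    {μ : Measure α} [IsFiniteMeasure μ] {T : α → α} (hT : MeasurePreserving T μ μ) {s : Set α}
    (hs : MeasurableSet s) :
    ∃ f : α → ℝ, Measurable f ∧ f ∘ T =ᵐ[μ] f ∧ TendstoInMeasure μ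
      (fun n x => (∑ k ∈ Finset.range n, s.indicator (fun _ => (1 : ℝ)) (T^[k] x)) / n)
      atTop f := by
  set U : Lp ℝ 2 μ →L[ℝ] Lp ℝ 2 μ :=
    (Lp.compMeasurePreservingₗᵢ ℝ T hT : Lp ℝ 2 μ →ₗᵢ[ℝ] Lp ℝ 2 μ).toContinuousLinearMap with hU
  set g : Lp ℝ 2 μ := indicatorConstLp 2 hs (measure_ne_top μ s) (1 : ℝ) with hg
  have hUapp : ∀ u : Lp ℝ 2 μ, U u =ᵐ[μ] u ∘ T := fun u => Lp.coeFn_compMeasurePreserving u hT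
  have hnorm : ‖U‖ ≤ 1 := LinearIsometry.norm_toContinuousLinearMap_le _
  have hlim := U.tendsto_birkhoffAverage_orthogonalProjection hnorm g
  set h : ((↑U : Lp ℝ 2 μ →ₗ[ℝ] Lp ℝ 2 μ).eqLocus
    ((1 : Lp ℝ 2 μ →L[ℝ] Lp ℝ 2 μ) : Lp ℝ 2 μ →ₗ[ℝ] Lp ℝ 2 μ)) :=
    Submodule.orthogonalProjectionOnto _ g with hh
  have hfix : U (h : Lp ℝ 2 μ) = h := h.2
  refine ⟨(h : Lp ℝ 2 μ), (Lp.stronglyMeasurable _).measurable, ?_, ?_⟩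
  · have := hUapp h
    rw [hfix] at this
    exact this.symm
  · have hm := tendstoInMeasure_of_tendsto_Lp hlim
    have hiter : ∀ k : ℕ, (U^[k] g : Lp ℝ 2 μ) =ᵐ[μ]
        fun x => s.indicator (fun _ => (1 : ℝ)) (T^[k] x) := by
      intro k
      induction k with
      | zero => exact indicatorConstLp_coeFn (hs := hs) (hμs := measure_ne_top μ s)
      | succ k ih =>
        rw [Function.iterate_succ_apply']
        refine (hUapp _).trans ?_
        exact hT.quasiMeasurePreserving.ae_eq_comp ih
    refine hm.congr_left fun n => ?_
    have hsum : ∀ n : ℕ, ((∑ k ∈ Finset.range n, U^[k] g : Lp ℝ 2 μ) : α → ℝ) =ᵐ[μ]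
        fun x => ∑ k ∈ Finset.range n, s.indicator (fun _ => (1 : ℝ)) (T^[k] x) := by
      intro n
      induction n with
      | zero =>
        simp only [Finset.range_zero, Finset.sum_empty]
        exact Lp.coeFn_zero _ _ _
      | succ n ih =>
        rw [Finset.sum_range_succ]
        filter_upwards [Lp.coeFn_add (∑ k ∈ Finset.range n, U^[k] g) (U^[n] g), ih, hiter n]
          with x h1 h2 h3
        rw [h1, Pi.add_apply, h2, h3, Finset.sum_range_succ]
    rw [birkhoffAverage, birkhoffSum]
    filter_upwards [Lp.coeFn_smul ((n : ℝ)⁻¹) (∑ k ∈ Finset.range n, U^[k] g), hsum n] with x h1 h2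
    simp only [id]
    rw [h1, Pi.smul_apply, h2, smul_eq_mul, div_eq_inv_mul]

namespace IsIntervalExchange

variable {a b : ℝ} {T : ℝ → ℝ} {B : Set ℝ}

theorem visits_eq_sum (T : ℝ → ℝ) (d : ℝ) (n : ℕ) (x : ℝ) : (visits T d n x : ℝ) =
    ∑ k ∈ Finset.range n, (Iio d).indicator (fun _ => (1 : ℝ)) (T^[k] x) := by
  rw [visits, Finset.card_filter]
  push_cast
  rfl

theorem measurable_visits (hT : Measurable T) (d : ℝ) (n : ℕ) :
    Measurable fun x => (visits T d n x : ℝ) := by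
  simp only [visits_eq_sum]
  exact Finset.measurable_sum _ fun k _ =>
    (measurable_const.indicator measurableSet_Iio).comp (hT.iterate k)

theorem integrable_visits {m : Measure ℝ} [IsFiniteMeasure m] (hT : Measurable T) (d : ℝ) (n : ℕ) :
    Integrable (fun x => (visits T d n x : ℝ)) m := by
  refine Integrable.of_bound (measurable_visits hT d n).aestronglyMeasurable n ?_
  refine Eventually.of_forall fun x => ?_
  rw [Real.norm_of_nonneg (Nat.cast_nonneg _)]
  exact_mod_cast (Finset.card_filter_le _ _).trans_eq (Finset.card_range n)

theorem average_visits {m : Measure ℝ} [IsFiniteMeasure m] (hT : MeasurePreserving T m m) (d : ℝ)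
    (n : ℕ) : ⨍ x, (visits T d n x : ℝ) ∂m = n * (m.real (Iio d) / m.real univ) := by
  have : ∫ x, (visits T d n x : ℝ) ∂m = n * m.real (Iio d) := by
    simp only [visits_eq_sum]
    have hint : ∀ k, Integrable (fun x => (Iio d).indicator (fun _ => (1 : ℝ)) (T^[k] x)) m := by
      intro k
      refine ((hT.iterate k).integrable_comp (g := (Iio d).indicator fun _ => (1:ℝ)) ?_).2 ?_
      · exact (measurable_const.indicator measurableSet_Iio).aestronglyMeasurable
      · exact (integrable_const _).indicator measurableSet_Iio
    rw [integral_finsetSum _ fun k _ => hint k]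
    have : ∀ k, ∫ x, (Iio d).indicator (fun _ => (1 : ℝ)) (T^[k] x) ∂m = m.real (Iio d) := by
      intro k
      rw [← integral_map (φ := T^[k]) (f := (Iio d).indicator fun _ => (1:ℝ))
        (hT.iterate k).measurable.aemeasurable
        (measurable_const.indicator measurableSet_Iio).aestronglyMeasurable, (hT.iterate k).map_eq,
        integral_indicator_const _ measurableSet_Iio]
      simp
    simp [this]
  rw [average_eq, this, smul_eq_mul]
  field_simp

/-- A locally translation invariant measure without atoms is invariant. -/
theorem measurePreserving (hT : IsIntervalExchange a b T B) {ν : Measure ℝ} [IsFiniteMeasure ν]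
    (hB : ν (Ioo a b ∩ B) = 0)
    (hν : ∀ x ∈ Ioo a b, x ∉ B → ∃ U ∈ 𝓝 x, ∀ A ⊆ U, MeasurableSet A →
      ν ((fun y => y + (T x - x)) '' A) = ν A) :
    MeasurePreserving T (ν.restrict (Ioo a b)) (ν.restrict (Ioo a b)) := by
  set D := Ioo a b \ B with hD
  have hDo : IsOpen D := by
    rw [isOpen_iff_mem_nhds]
    rintro x ⟨hx, hxB⟩
    filter_upwards [isOpen_Ioo.mem_nhds hx, hT.eventually x hx hxB] with y hy hyB
    exact ⟨hy, hyB.1⟩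
  have hDI : D =ᵐ[ν] Ioo a b := by
    rw [hD, ← sdiff_self_inter]
    exact sdiff_null_ae_eq_self hB
  have key : ∀ A ⊆ D, MeasurableSet A → MeasurableSet (T '' A) ∧ ν (T '' A) = ν A := by
    have hloc : ∀ x ∈ D, ∃ V, IsOpen V ∧ x ∈ V ∧ ∀ A ⊆ V, MeasurableSet A →
        MeasurableSet (T '' A) ∧ ν (T '' A) = ν A := by
      rintro x ⟨hx, hxB⟩
      obtain ⟨U, hU, hUν⟩ := hν x hx hxB
      obtain ⟨V, hVU, hV, hxV⟩ := mem_nhds_iff.1 (inter_mem hU (hT.eventually x hx hxB))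
      refine ⟨V, hV, hxV, fun A hA hAm => ?_⟩
      have : T '' A = (fun y => y + (T x - x)) '' A :=
        image_congr fun y hy => (hVU (hA hy)).2.2
      rw [this]
      exact ⟨(Homeomorph.addRight (T x - x)).toMeasurableEquiv.measurableSet_image.2 hAm,
        hUν A (fun y hy => (hVU (hA hy)).1) hAm⟩
    intro A hA hAm
    rcases A.eq_empty_or_nonempty with rfl | hne
    · simp
    choose! V hVo hxV hVν using hloc
    obtain ⟨t, htD, htc, hcov⟩ := TopologicalSpace.countable_cover_nhdsWithin (f := V) (s := D)
      fun x hx => mem_nhdsWithin_of_mem_nhds ((hVo x hx).mem_nhds (hxV x hx))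
    have htne : t.Nonempty := by
      obtain ⟨x, hx⟩ := hne
      obtain ⟨y, hy, -⟩ := mem_iUnion₂.1 (hcov (hA hx))
      exact ⟨y, hy⟩
    obtain ⟨x, rfl⟩ := htc.exists_eq_range htne
    have hxD : ∀ n, x n ∈ D := fun n => htD ⟨n, rfl⟩
    set A' : ℕ → Set ℝ := fun n => A ∩ disjointed (fun n => V (x n)) n with hA'
    have hA'm : ∀ n, MeasurableSet (A' n) := fun n =>
      hAm.inter (MeasurableSet.disjointed (fun n => (hVo _ (hxD n)).measurableSet) n)
    have hA'V : ∀ n, A' n ⊆ V (x n) := fun n => inter_subset_right.trans (disjointed_subset _ n)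
    have hA'd : Pairwise (Function.onFun Disjoint A') := fun i j hij =>
      (disjoint_disjointed (fun n => V (x n)) hij).mono inter_subset_right inter_subset_right
    have hU : A = ⋃ n, A' n := by
      rw [hA', ← inter_iUnion, iUnion_disjointed]
      refine (inter_eq_left.2 fun y hy => ?_).symm
      obtain ⟨z, ⟨n, rfl⟩, hz⟩ := mem_iUnion₂.1 (hcov (hA hy))
      exact mem_iUnion.2 ⟨n, hz⟩
    have hTd : Pairwise (Function.onFun Disjoint fun n => T '' A' n) := by
      intro i j hij
      refine disjoint_left.2 ?_
      rintro _ ⟨y, hy, rfl⟩ ⟨z, hz, hzy⟩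
      have := hT.injOn (hA hz.1) (hA hy.1) hzy
      subst this
      exact disjoint_left.1 (hA'd hij) hy hz
    have hTm : ∀ n, MeasurableSet (T '' A' n) := fun n => (hVν _ (hxD n) _ (hA'V n) (hA'm n)).1
    have hTA : T '' A = ⋃ n, T '' A' n := by rw [← image_iUnion, ← hU]
    refine ⟨hTA ▸ MeasurableSet.iUnion hTm, ?_⟩
    rw [hTA, measure_iUnion hTd hTm]
    conv_rhs => rw [hU, measure_iUnion hA'd hA'm]
    exact tsum_congr fun n => (hVν _ (hxD n) _ (hA'V n) (hA'm n)).2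
  have hTD : T '' D =ᵐ[ν] Ioo a b := by
    have hsub : T '' D ⊆ Ioo a b := by
      rintro _ ⟨x, hx, rfl⟩
      exact hT.mapsTo x hx.1 hx.2
    obtain ⟨h1, h2⟩ := key D subset_rfl hDo.measurableSet
    refine ae_eq_of_subset_of_measure_ge hsub ?_ h1.nullMeasurableSet (measure_ne_top _ _)
    rw [h2, measure_congr hDI]
  refine ⟨hT.measurable, ?_⟩
  rw [← Measure.restrict_congr_set hDI]
  conv_rhs => rw [Measure.restrict_congr_set hDI, ← Measure.restrict_congr_set hTD]
  ext S hS
  rw [Measure.map_apply hT.measurable hS, Measure.restrict_apply (hT.measurable hS),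
    Measure.restrict_apply hS,
    ← (key (T ⁻¹' S ∩ D) inter_subset_right ((hT.measurable hS).inter hDo.measurableSet)).2,
    inter_comm, image_inter_preimage, inter_comm]

theorem measurePreserving_volume (hT : IsIntervalExchange a b T B) (hB : (Ioo a b ∩ B).Countable) :
    MeasurePreserving T (volume.restrict (Ioo a b)) (volume.restrict (Ioo a b)) := by
  have : IsFiniteMeasure ((volume : Measure ℝ).restrict (Ioo a b)) := ⟨by simp⟩
  have h := hT.measurePreserving (ν := volume.restrict (Ioo a b))
    (by rw [Measure.restrict_apply_eq_zero' measurableSet_Ioo]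
        exact measure_mono_null inter_subset_left (hB.measure_zero _)) fun x hx hxB => ?_
  · rwa [Measure.restrict_restrict measurableSet_Ioo, inter_self] at h
  · refine ⟨Ioo a b ∩ (fun y => y + (T x - x)) ⁻¹' Ioo a b, ?_, fun A hA hAm => ?_⟩
    · refine inter_mem (isOpen_Ioo.mem_nhds hx) ?_
      refine (by fun_prop : Continuous fun y => y + (T x - x)).continuousAt.preimage_mem_nhds ?_
      rw [add_sub_cancel]
      exact isOpen_Ioo.mem_nhds (hT.mapsTo x hx hxB)
    · have hm : MeasurableSet ((fun y => y + (T x - x)) '' A) :=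
        (Homeomorph.addRight (T x - x)).toMeasurableEquiv.measurableSet_image.2 hAm
      rw [Measure.restrict_apply hm, Measure.restrict_apply hAm,
        inter_eq_left.2 (fun y hy => (hA hy).1), inter_eq_left.2, image_add_right,
        measure_preimage_add_right]
      rintro _ ⟨y, hy, rfl⟩
      exact (hA hy).2

end IsIntervalExchange

/-! ### Boshernitzan's criterion -/

namespace IsIntervalExchange

variable {a b : ℝ} {T : ℝ → ℝ} {B : Set ℝ}

/-- Invariant sets of positive measure are uniformly large: near a density point, a short interval
has `n / 2` disjoint translates among its iterates. -/
theorem le_volume_of_invariant (hT : IsIntervalExchange a b T B) {x₀ : ℝ}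
    (h0 : IsDenseOrbit a b T B x₀) {c : ℝ} (hc : 0 < c)
    (hsep : ∃ᶠ n in atTop, IsSeparatedAt a b T B c n) {E : Set ℝ} (hE : MeasurableSet E)
    (hinv : T ⁻¹' E =ᵐ[volume.restrict (Ioo a b)] E) (hpos : volume (E ∩ Ioo a b) ≠ 0) :
    ENNReal.ofReal (c / 16) ≤ volume (E ∩ Ioo a b) := by
  have hfin := finite_badSet (a := a) (b := b) (T := T) (B := B) hc hsep
  have hcount : (⋃ n, badSet a b T B n).Countable := countable_iUnion fun n => (hfin n).countable
  have hBc : (Ioo a b ∩ B).Countable := by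
    refine hcount.mono fun x hx => mem_iUnion.2 ⟨1, ?_⟩
    exact ⟨hx.1, 0, zero_lt_one, hx.2⟩
  have hMP := hT.measurePreserving_volume hBc
  -- A density point of `E` whose orbit avoids `B`.
  obtain ⟨x, ⟨⟨-, hx⟩, hxb⟩, hdens⟩ : ∃ x, (x ∈ E ∩ Ioo a b ∧ x ∉ ⋃ n, badSet a b T B n) ∧
      ∀ (w : ℕ → ℝ) (δ : ℕ → ℝ), Tendsto δ atTop (𝓝[>] 0) →
        (∀ᶠ j in atTop, x ∈ Metric.closedBall (w j) (2 * δ j)) →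
        Tendsto (fun j => volume (E ∩ Metric.closedBall (w j) (δ j)) /
          volume (Metric.closedBall (w j) (δ j))) atTop (𝓝 1) := by
    have h1 := ae_restrict_of_ae_restrict_of_subset (inter_subset_left (s := E) (t := Ioo a b))
      (IsUnifLocDoublingMeasure.ae_tendsto_measure_inter_div (volume : Measure ℝ) E 2)
    have h2 : ∀ᵐ x ∂(volume.restrict (E ∩ Ioo a b)), x ∈ E ∩ Ioo a b :=
      ae_restrict_mem (hE.inter measurableSet_Ioo)
    have h3 : ∀ᵐ x ∂((volume : Measure ℝ).restrict (E ∩ Ioo a b)), x ∉ ⋃ n, badSet a b T B n :=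
      ae_restrict_of_ae (compl_mem_ae_iff.2 (hcount.measure_zero _))
    have : NeBot (ae ((volume : Measure ℝ).restrict (E ∩ Ioo a b))) := by
      rw [ae_neBot]
      intro h
      exact hpos (Measure.restrict_eq_zero.1 h)
    obtain ⟨x, hx1, hx2, hx3⟩ := (h1.and (h2.and h3)).exists
    exact ⟨x, ⟨hx2, hx3⟩, fun w δ hδ hw => hx1 w δ hδ hw⟩
  obtain ⟨φ, hφm, hφ⟩ := extraction_of_frequently_atTop hsep
  have hφpos : ∀ k, (0:ℝ) < φ k := fun k => by exact_mod_cast (hφ k).1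
  -- The component of `x` has length at least `8 * δ` for `δ = c / (8 * n)`, so it contains the
  -- interval of radius `δ` around `x + 2 * δ` or around `x - 2 * δ`. Lebesgue's density theorem
  -- also holds for such intervals that do not contain `x`.
  have hw : ∀ k, ∃ w, |x - w| ≤ 2 * (c / (8 * φ k)) ∧ ∃ p q, Ioo p q ⊆ Ioo a b ∧
      Disjoint (Ioo p q) (badSet a b T B (φ k)) ∧
      Metric.closedBall w (c / (8 * φ k)) ⊆ Ioo p q := by
    intro k
    obtain ⟨p, q, hxpq, hpq, hd, hlen⟩ := exists_component_of_isSeparatedAt hT.lt hc (hφ k) hx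
      fun h => hxb (mem_iUnion.2 ⟨_, h⟩)
    have e : c / φ k = 8 * (c / (8 * φ k)) := by
      have := hφpos k
      field_simp
    have hδ : 0 < c / (8 * φ k) := by have := hφpos k; positivity
    rw [e] at hlen
    set δ := c / (8 * φ k)
    rcases le_total (4 * δ) (q - x) with h | h
    · refine ⟨x + 2 * δ, ?_, p, q, hpq, hd, ?_⟩
      · rw [sub_add_cancel_left, abs_neg, abs_of_pos (by linarith)]
      · rw [Real.closedBall_eq_Icc]
        exact fun y hy => ⟨by linarith [hy.1, hxpq.1], by linarith [hy.2]⟩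
    · refine ⟨x - 2 * δ, ?_, p, q, hpq, hd, ?_⟩
      · rw [sub_sub_cancel, abs_of_pos (by linarith)]
      · rw [Real.closedBall_eq_Icc]
        exact fun y hy => ⟨by linarith [hy.1], by linarith [hy.2, hxpq.2]⟩
  choose w hwx hw using hw
  have hδlim : Tendsto (fun k => c / (8 * (φ k : ℝ))) atTop (𝓝[>] 0) := by
    refine tendsto_nhdsWithin_iff.2 ⟨?_, Eventually.of_forall fun k => ?_⟩
    · refine tendsto_const_nhds.div_atTop ?_
      exact (tendsto_natCast_atTop_atTop.comp hφm.tendsto_atTop).const_mul_atTop (by norm_num)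
    · have := hφpos k
      exact div_pos hc (by positivity)
  have hlim := hdens w _ hδlim (Eventually.of_forall fun k => by
    rw [Metric.mem_closedBall, Real.dist_eq]; exact hwx k)
  have hhalf : (2⁻¹ : ℝ≥0∞) < 1 := by norm_num
  obtain ⟨k, hk⟩ := (hlim.eventually (lt_mem_nhds hhalf)).exists
  obtain ⟨p, q, hpq, hd, hball⟩ := hw k
  have hn := hφ k
  set n := φ k with hndef
  set V := Metric.closedBall (w k) (c / (8 * (n : ℝ))) with hV
  have hnpos : (0 : ℝ) < n := hφpos k
  have hδpos : 0 < c / (8 * (n : ℝ)) := by positivity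
  have hVvol : volume V = ENNReal.ofReal (c / (4 * n)) := by
    rw [hV, Real.volume_closedBall]
    congr 1
    field_simp
    norm_num
  have hEV : ENNReal.ofReal (c / (8 * n)) ≤ volume (E ∩ V) := by
    have h4 : c / (8 * n) = 2⁻¹ * (c / (4 * n)) := by field_simp; norm_num
    have h5 : 2⁻¹ * volume V ≤ volume (E ∩ V) := by
      have := (ENNReal.lt_div_iff_mul_lt (Or.inl (by rw [hVvol]; positivity))
        (Or.inl (by rw [hVvol]; exact ENNReal.ofReal_ne_top))).1 hk
      exact this.le
    rw [h4, ENNReal.ofReal_mul (by norm_num), ← hVvol]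
    refine le_trans (le_of_eq ?_) h5
    rw [ENNReal.ofReal_inv_of_pos (by norm_num)]
    simp
  have hwV : w k ∈ V := Metric.mem_closedBall_self hδpos.le
  set e : ℕ → ℝ := fun i => T^[i] (w k) - w k with he
  have hTV : ∀ i ≤ n, ∀ y ∈ V, T^[i] y = y + e i := fun i hi y hy =>
    hT.iterate_eq_add hpq hd (hball hwV) (hball hy) hi
  have hVI : ∀ i ≤ n, ∀ y ∈ V, T^[i] y ∈ Ioo a b := fun i hi y hy =>
    hT.iterate_mem (hpq (hball hy))
      (fun h => disjoint_left.1 hd (hball hy) h) hi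
  -- Each translate of `E ∩ V` lies in `E` up to a null set.
  have hmass : ∀ i ≤ n, volume (E ∩ V) ≤ volume (E ∩ (fun y => y + e i) '' V) := by
    intro i hi
    have h1 : T^[i] ⁻¹' E =ᵐ[volume.restrict (Ioo a b)] E :=
      hMP.quasiMeasurePreserving.preimage_iterate_ae_eq i hinv
    have h2 : volume (E ∩ V) = volume (T^[i] ⁻¹' E ∩ V) := by
      refine measure_congr (eventuallyEq_set.2 ?_)
      filter_upwards [(ae_restrict_iff' measurableSet_Ioo).1 h1] with y hy
      refine and_congr_left fun hyV => ?_
      exact (iff_of_eq (hy (hpq (hball hyV)))).symm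
    have h3 : (fun y => y + e i) '' (T^[i] ⁻¹' E ∩ V) ⊆ E ∩ (fun y => y + e i) '' V := by
      rintro _ ⟨y, ⟨hyE, hyV⟩, rfl⟩
      refine ⟨?_, y, hyV, rfl⟩
      change y + e i ∈ E
      rw [← hTV i hi y hyV]
      exact hyE
    rw [h2, ← measure_preimage_add_right volume (-(e i)), ← image_add_right]
    exact measure_mono h3
  have hdisj : ((Finset.range (n / 2 + 1) : Finset ℕ) : Set ℕ).PairwiseDisjoint
      fun i => E ∩ (fun y => y + e i) '' V := by
    have key : ∀ i j, i < j → j ≤ n / 2 →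
        Disjoint ((fun y => y + e i) '' V) ((fun y => y + e j) '' V) := by
      intro i j hij hj
      refine disjoint_left.2 ?_
      rintro _ ⟨y, hy, rfl⟩ ⟨z, hz, hzy⟩
      have h1 : T^[i] y = T^[j] z := by
        rw [hTV i (by omega) y hy, hTV j (by omega) z hz]; exact hzy.symm
      obtain ⟨m, rfl⟩ := Nat.exists_eq_add_of_lt hij
      rw [add_assoc, Function.iterate_add_apply] at h1
      have hzb : T^[m + 1] z ∉ badSet a b T B i :=
        iterate_notMem_badSet (n := n) (hpq (hball hz)) (disjoint_left.1 hd (hball hz)) (by omega)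
      have h2 : y = T^[m + 1] z := hT.iterate_injOn (n := i) le_rfl
        ⟨hpq (hball hy), fun h => disjoint_left.1 hd (hball hy) (badSet_mono (by omega) h)⟩
        ⟨hVI _ (by omega) z hz, hzb⟩ h1
      have h3 := hT.le_abs_iterate_sub h0 hc hn hpq hd (m := m + 1) (by omega) (by omega)
        (hball hz) (h2 ▸ hball hy)
      rw [← h2] at h3
      have h4 : |y - z| ≤ 2 * (c / (8 * n)) := by
        have := Metric.dist_le_diam_of_mem Metric.isBounded_closedBall hy hz
        rw [Real.dist_eq] at this
        exact this.trans (Metric.diam_closedBall hδpos.le)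
      have h5 : c / n = 8 * (c / (8 * n)) := by field_simp
      linarith
    intro i hi j hj hij
    simp only [Finset.coe_range, mem_Iio] at hi hj
    rcases lt_or_gt_of_ne hij with h | h
    · exact (key i j h (by omega)).mono inter_subset_right inter_subset_right
    · exact (key j i h (by omega)).symm.mono inter_subset_right inter_subset_right
  have hmeas : ∀ i ∈ Finset.range (n / 2 + 1),
      MeasurableSet (E ∩ (fun y => y + e i) '' V) := fun i _ => hE.inter
    ((Homeomorph.addRight (e i)).toMeasurableEquiv.measurableSet_image.2 measurableSet_closedBall)
  calc ENNReal.ofReal (c / 16) ≤ ENNReal.ofReal (((n / 2 + 1 : ℕ) : ℝ) * (c / (8 * n))) := by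
        apply ENNReal.ofReal_le_ofReal
        have h6 : (n : ℝ) / 2 ≤ ((n / 2 + 1 : ℕ) : ℝ) := by
          have : n ≤ 2 * (n / 2 + 1) := by omega
          have : (n : ℝ) ≤ 2 * ((n / 2 + 1 : ℕ) : ℝ) := by exact_mod_cast this
          linarith
        calc c / 16 = n / 2 * (c / (8 * n)) := by field_simp; norm_num
          _ ≤ _ := mul_le_mul_of_nonneg_right h6 hδpos.le
    _ = ∑ i ∈ Finset.range (n / 2 + 1), ENNReal.ofReal (c / (8 * n)) := by
        rw [ENNReal.ofReal_mul (Nat.cast_nonneg _), ENNReal.ofReal_natCast]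
        simp
    _ ≤ ∑ i ∈ Finset.range (n / 2 + 1), volume (E ∩ (fun y => y + e i) '' V) := by
        refine Finset.sum_le_sum fun i hi => hEV.trans (hmass i ?_)
        rw [Finset.mem_range] at hi
        omega
    _ = volume (⋃ i ∈ Finset.range (n / 2 + 1), E ∩ (fun y => y + e i) '' V) :=
        (measure_biUnion_finset hdisj hmeas).symm
    _ ≤ volume (E ∩ Ioo a b) := by
        refine measure_mono (iUnion₂_subset fun i hi => ?_)
        rintro _ ⟨hyE, y, hy, rfl⟩
        rw [Finset.mem_range] at hi
        refine ⟨hyE, ?_⟩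
        have := hVI i (by omega) y hy
        rwa [hTV i (by omega) y hy] at this

/-- Asymptotic frequencies of visits cannot be spread over an interval: the level sets of their
limit would be infinitely many disjoint invariant sets of positive measure. -/
theorem false_of_visits_lt (hT : IsIntervalExchange a b T B) {x₀ : ℝ}
    (h0 : IsDenseOrbit a b T B x₀) {c : ℝ} (hc : 0 < c)
    (hsep : ∃ᶠ n in atTop, IsSeparatedAt a b T B c n) {d : ℝ} {m : ℕ} (hdm : d ∈ badSet a b T B m)
    {α₁ α₂ : ℝ} (hα : α₁ < α₂)
    (h1 : ∀ n, ∃ x ∈ Ioo a b, x ∉ badSet a b T B (n + m) ∧ (visits T d n x : ℝ) ≤ n * α₁)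
    (h2 : ∀ n, ∃ x ∈ Ioo a b, x ∉ badSet a b T B (n + m) ∧ n * α₂ ≤ (visits T d n x : ℝ)) :
    False := by
  have hfin := finite_badSet (a := a) (b := b) (T := T) (B := B) hc hsep
  have hBc : (Ioo a b ∩ B).Countable := by
    refine (hfin 1).countable.mono fun x hx => ?_
    exact ⟨hx.1, 0, zero_lt_one, hx.2⟩
  have hMP := hT.measurePreserving_volume hBc
  have : IsFiniteMeasure ((volume : Measure ℝ).restrict (Ioo a b)) := ⟨by simp⟩
  obtain ⟨f, hf, hfT, hlim⟩ := hMP.exists_tendstoInMeasure (measurableSet_Iio (a := d))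
  simp only [← visits_eq_sum] at hlim
  have hpos : ∀ s s', α₁ ≤ s → s < s' → s' ≤ α₂ → volume (f ⁻¹' Ioo s s' ∩ Ioo a b) ≠ 0 := by
    intro s s' hs hss hs' hzero
    set κ := s' - s with hκ
    have hκpos : 0 < κ := by linarith
    -- For large `n`, values in the middle third of `(s, s')` occur with positive probability.
    have hbig : ∀ᶠ n : ℕ in atTop, IsSeparatedAt a b T B c (n + m) →
        ENNReal.ofReal (c * κ / 12) ≤ (volume.restrict (Ioo a b))
          {x | (visits T d n x : ℝ) / n ∈ Icc (s + κ / 3) (s' - κ / 3)} := by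
      filter_upwards [eventually_gt_atTop 0, eventually_ge_atTop m,
        tendsto_natCast_atTop_atTop.eventually_ge_atTop (6 / κ)] with n hn0 hnm hnκ hsn
      have hn0' : (0:ℝ) < n := by exact_mod_cast hn0
      have hnκ' : 6 ≤ n * κ := by rwa [div_le_iff₀ hκpos] at hnκ
      obtain ⟨x₁, hx₁, hx₁b, hv₁⟩ := h1 n
      obtain ⟨x₂, hx₂, hx₂b, hv₂⟩ := h2 n
      have hlow : 0 ≤ n * (s + κ / 3) := by
        have h3 : (0:ℝ) ≤ visits T d n x₁ := Nat.cast_nonneg _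
        have h4 : n * α₁ ≤ n * (s + κ / 3) := by gcongr; linarith
        linarith
      set j₀ := ⌈n * (s + κ / 3)⌉₊ with hj₀
      set N := ⌊n * κ / 3⌋₊ with hN
      have hj₀l : n * (s + κ / 3) ≤ j₀ := Nat.le_ceil _
      have hj₀u : (j₀ : ℝ) < n * (s + κ / 3) + 1 := Nat.ceil_lt_add_one hlow
      have hNl : n * κ / 3 < N + 1 := Nat.lt_floor_add_one _
      have hNu : (N : ℝ) ≤ n * κ / 3 := Nat.floor_le (by positivity)
      have hjs : ∀ i < N, n * (s + κ / 3) ≤ ((j₀ + i : ℕ) : ℝ) ∧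
          ((j₀ + i : ℕ) : ℝ) ≤ n * (s' - κ / 3) := by
        intro i hi
        have hi' : (i : ℝ) + 1 ≤ N := by exact_mod_cast hi
        have h5 : n * (s' - κ / 3) = n * (s + κ / 3) + n * κ / 3 := by rw [hκ]; ring
        push_cast
        exact ⟨by linarith [Nat.cast_nonneg (α := ℝ) i], by linarith⟩
      have hlev : ∀ i < N, ENNReal.ofReal (c / (n + m : ℕ)) ≤
          (volume.restrict (Ioo a b)) {x | visits T d n x = j₀ + i} := by
        intro i hi
        obtain ⟨p, q, hpq, hlen, hval⟩ := hT.exists_interval_visits h0 hc hdm hsn hx₁ hx₁b hx₂ hx₂b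
          (j := j₀ + i) (by
            have h5 : n * α₁ ≤ n * (s + κ / 3) := by gcongr; linarith
            have := (hjs i hi).1
            exact_mod_cast hv₁.trans (h5.trans this)) (by
            have h5 : n * (s' - κ / 3) ≤ n * α₂ := by gcongr; linarith
            have := (hjs i hi).2
            exact_mod_cast this.trans (h5.trans hv₂))
        calc ENNReal.ofReal (c / (n + m : ℕ)) ≤ ENNReal.ofReal (q - p) :=
              ENNReal.ofReal_le_ofReal hlen
          _ = volume (Ioo p q ∩ Ioo a b) := by rw [inter_eq_left.2 hpq, Real.volume_Ioo]
          _ ≤ volume.restrict (Ioo a b) (Ioo p q) := Measure.le_restrict_apply _ _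
          _ ≤ _ := measure_mono fun x hx => hval x hx
      have hmeasv : ∀ j : ℕ, MeasurableSet {x | visits T d n x = j} := by
        intro j
        have := (measurable_visits hT.measurable d n) (measurableSet_singleton (j : ℝ))
        convert this using 1
        ext x
        simp
      calc ENNReal.ofReal (c * κ / 12)
          ≤ ENNReal.ofReal ((N : ℝ) * (c / (n + m : ℕ))) := by
            apply ENNReal.ofReal_le_ofReal
            have h6 : n * κ / 6 ≤ N := by linarith
            have h7 : ((n + m : ℕ) : ℝ) ≤ 2 * n := by
              have : n + m ≤ 2 * n := by omega
              exact_mod_cast this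
            have h8 : (0 : ℝ) < ((n + m : ℕ) : ℝ) := by
              have : 0 < n + m := by omega
              exact_mod_cast this
            calc c * κ / 12 = n * κ / 6 * (c / (2 * n)) := by field_simp; norm_num
              _ ≤ N * (c / (n + m : ℕ)) := by gcongr
        _ = ∑ i ∈ Finset.range N, ENNReal.ofReal (c / (n + m : ℕ)) := by
            rw [ENNReal.ofReal_mul (Nat.cast_nonneg _), ENNReal.ofReal_natCast]
            simp
        _ ≤ ∑ i ∈ Finset.range N, (volume.restrict (Ioo a b)) {x | visits T d n x = j₀ + i} :=
            Finset.sum_le_sum fun i hi => hlev i (Finset.mem_range.1 hi)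
        _ = (volume.restrict (Ioo a b)) (⋃ i ∈ Finset.range N, {x | visits T d n x = j₀ + i}) := by
            refine (measure_biUnion_finset ?_ fun i _ => hmeasv _).symm
            intro i _ j _ hij
            refine disjoint_left.2 fun x hx hx' => hij ?_
            have : j₀ + i = j₀ + j := hx.symm.trans hx'
            omega
        _ ≤ _ := by
            refine measure_mono (iUnion₂_subset fun i hi x hx => ?_)
            have hx' : visits T d n x = j₀ + i := hx
            have := hjs i (Finset.mem_range.1 hi)
            simp only [mem_ofPred_eq, hx']
            exact ⟨by rw [le_div_iff₀ hn0']; linarith, by rw [div_le_iff₀ hn0']; linarith⟩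
    have hsmall : ∀ᶠ n : ℕ in atTop, (volume.restrict (Ioo a b))
        {x | ENNReal.ofReal (κ / 3) ≤ edist ((visits T d n x : ℝ) / n) (f x)} <
          ENNReal.ofReal (c * κ / 12) := by
      refine (hlim (ENNReal.ofReal (κ / 3)) (by simpa using by linarith)).eventually
        (gt_mem_nhds ?_)
      simpa using by positivity
    have hbs := (hbig.and hsmall)
    have hbs' := (tendsto_sub_atTop_nat m).eventually hbs
    obtain ⟨n, hn1, hn2, hn3⟩ := (hsep.and_eventually
      (hbs'.and (eventually_ge_atTop m))).exists
    have hlarge := hn2.1 (by rwa [Nat.sub_add_cancel hn3])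
    refine absurd hn2.2 (not_lt.2 (hlarge.trans ?_))
    rw [← Measure.restrict_apply (hf measurableSet_Ioo)] at hzero
    refine (measure_mono (t := f ⁻¹' Ioo s s' ∪ {x | ENNReal.ofReal (κ / 3) ≤
      edist ((visits T d (n - m) x : ℝ) / ↑(n - m)) (f x)}) ?_).trans
      ((measure_union_le _ _).trans_eq (by rw [hzero, zero_add]))
    intro x hx
    by_cases hfx : f x ∈ Ioo s s'
    · exact Or.inl hfx
    · right
      simp only [mem_ofPred_eq] at hx ⊢
      rw [edist_dist, Real.dist_eq]
      apply ENNReal.ofReal_le_ofReal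
      rw [le_abs]
      by_contra hcon
      push Not at hcon
      exact hfx ⟨by linarith [hx.1], by linarith [hx.2]⟩
  -- Disjoint intervals of values, each of which is taken with positive probability.
  set θ : ℕ → ℝ := fun j => α₁ + (α₂ - α₁) / (j + 1) with hθ
  have hθs : ∀ j, θ (j + 1) < θ j := by
    intro j
    simp only [hθ, add_lt_add_iff_left]
    push_cast
    exact div_lt_div_of_pos_left (by linarith) (by positivity) (by linarith)
  have hθa : StrictAnti θ := strictAnti_nat_of_succ_lt hθs
  have hθl : ∀ j, α₁ ≤ θ j := fun j => by
    have : 0 ≤ (α₂ - α₁) / ((j:ℝ) + 1) := div_nonneg (by linarith) (by positivity)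
    simp only [hθ]; linarith
  have hθu : ∀ j, θ j ≤ α₂ := fun j =>
    (hθa.antitone (Nat.zero_le j)).trans (by simp [hθ])
  have hall : ∀ j, ENNReal.ofReal (c / 16) ≤
      (volume.restrict (Ioo a b)) (f ⁻¹' Ioo (θ (Order.succ j)) (θ j)) := by
    intro j
    rw [Measure.restrict_apply (hf measurableSet_Ioo)]
    refine hT.le_volume_of_invariant h0 hc hsep (hf measurableSet_Ioo) ?_
      (hpos _ _ (hθl _) (hθs j) (hθu _))
    refine eventuallyEq_set.2 ?_
    filter_upwards [hfT] with x hx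
    have hx' : f (T x) = f x := hx
    change f (T x) ∈ Ioo _ _ ↔ f x ∈ Ioo _ _
    rw [hx']
  have hfinite := Measure.finite_const_le_meas_of_disjoint_iUnion (volume.restrict (Ioo a b))
    (ε := ENNReal.ofReal (c / 16)) (by simpa using by positivity)
    (As := fun j : ℕ => f ⁻¹' Ioo (θ (Order.succ j)) (θ j)) (fun j => hf measurableSet_Ioo)
    (fun i j hij => (hθa.antitone.pairwise_disjoint_on_Ioo_succ hij).preimage f)
    (measure_ne_top _ _)
  rw [show {i | ENNReal.ofReal (c / 16) ≤ (volume.restrict (Ioo a b))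
    (f ⁻¹' Ioo (θ (Order.succ i)) (θ i))} = univ from eq_univ_of_forall hall] at hfinite
  exact infinite_univ hfinite

/-- The number of visits is sometimes at most, and sometimes at least, the average given by an
invariant measure. -/
theorem exists_visits_le_and_le (hT : IsIntervalExchange a b T B) {m : Measure ℝ}
    [IsFiniteMeasure m] (hm : m ≠ 0) (hI : m (Ioo a b)ᶜ = 0) (hMP : MeasurePreserving T m m)
    {N : Set ℝ} (hN : m N = 0) (d : ℝ) (n : ℕ) :
    (∃ x ∈ Ioo a b, x ∉ N ∧ (visits T d n x : ℝ) ≤ n * (m.real (Iio d) / m.real univ)) ∧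
    ∃ x ∈ Ioo a b, x ∉ N ∧ n * (m.real (Iio d) / m.real univ) ≤ visits T d n x := by
  have hN' : m (N ∪ (Ioo a b)ᶜ) = 0 := measure_union_null hN hI
  obtain ⟨x, hx, hxv⟩ := exists_notMem_null_le_average hm (integrable_visits hT.measurable d n) hN'
  obtain ⟨y, hy, hyv⟩ := exists_notMem_null_average_le hm (integrable_visits hT.measurable d n) hN'
  rw [average_visits hMP] at hxv hyv
  rw [mem_union, not_or, notMem_compl_iff] at hx hy
  exact ⟨⟨x, hx.2, hx.1, hxv⟩, y, hy.2, hy.1, hyv⟩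

/-- Boshernitzan's criterion: if for infinitely many `n` the discontinuities of the `n`-th iterate
are `c / n`-separated, then an interval exchange has only one invariant measure. -/
theorem eq_smul_volume (hT : IsIntervalExchange a b T B) {x₀ : ℝ}
    (h0 : IsDenseOrbit a b T B x₀) {c : ℝ} (hc : 0 < c)
    (hsep : ∃ᶠ n in atTop, IsSeparatedAt a b T B c n)
    (hdense : ∀ u v, a ≤ u → u < v → v ≤ b → ∃ n, ∃ x ∈ badSet a b T B n, x ∈ Ioo u v)
    {ν : Measure ℝ} [IsFiniteMeasure ν] (hatom : ∀ x ∈ Ioo a b, ν {x} = 0)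
    (hν : ∀ x ∈ Ioo a b, x ∉ B → ∃ U ∈ 𝓝 x, ∀ A ⊆ U, MeasurableSet A →
      ν ((fun y => y + (T x - x)) '' A) = ν A) :
    ∃ k : ℝ≥0, ν.restrict (Ioo a b) = k • volume.restrict (Ioo a b) := by
  have hfin := finite_badSet (a := a) (b := b) (T := T) (B := B) hc hsep
  have hBc : (Ioo a b ∩ B).Countable := by
    refine (hfin 1).countable.mono fun x hx => ?_
    exact ⟨hx.1, 0, zero_lt_one, hx.2⟩
  have hnull : ∀ {S : Set ℝ}, S ⊆ Ioo a b → S.Countable → ν S = 0 := by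
    intro S hS hSc
    rw [← biUnion_of_singleton S]
    exact (measure_biUnion_null_iff hSc).2 fun x hx => hatom x (hS hx)
  set m₁ := ν.restrict (Ioo a b) with hm₁
  set m₂ := (volume : Measure ℝ).restrict (Ioo a b) with hm₂
  have : IsFiniteMeasure m₂ := ⟨by simp [hm₂]⟩
  have hMP₁ : MeasurePreserving T m₁ m₁ := hT.measurePreserving (hnull inter_subset_left hBc) hν
  have hMP₂ : MeasurePreserving T m₂ m₂ := hT.measurePreserving_volume hBc
  have hb₁ : ∀ n, m₁ (badSet a b T B n) = 0 := fun n => by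
    rw [hm₁, Measure.restrict_apply_eq_zero' measurableSet_Ioo]
    exact hnull inter_subset_right ((hfin n).countable.mono inter_subset_left)
  have hb₂ : ∀ n, m₂ (badSet a b T B n) = 0 := fun n => (hfin n).measure_zero _
  have hI₁ : m₁ (Ioo a b)ᶜ = 0 := by
    rw [hm₁, Measure.restrict_apply measurableSet_Ioo.compl, compl_inter_self, measure_empty]
  have hI₂ : m₂ (Ioo a b)ᶜ = 0 := by
    rw [hm₂, Measure.restrict_apply measurableSet_Ioo.compl, compl_inter_self, measure_empty]
  have hab := hT.lt
  have hm₂ne : m₂ ≠ 0 := by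
    rw [hm₂, Ne, Measure.restrict_eq_zero, Real.volume_Ioo]
    simpa using hab
  by_cases hm₁ne : m₁ = 0
  · exact ⟨0, by rw [hm₁ne, zero_smul]⟩
  have hpos₁ : 0 < m₁.real univ := by
    rw [measureReal_def]
    exact ENNReal.toReal_pos (by simpa using hm₁ne) (measure_ne_top _ _)
  have hpos₂ : 0 < m₂.real univ := by
    rw [measureReal_def]
    exact ENNReal.toReal_pos (by simpa using hm₂ne) (measure_ne_top _ _)
  -- The two measures have the same frequencies to the left of bad points.
  have hfreq : ∀ n, ∀ d ∈ badSet a b T B n,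
      m₁.real (Iio d) / m₁.real univ = m₂.real (Iio d) / m₂.real univ := by
    intro n d hd
    have e₁ := fun k => hT.exists_visits_le_and_le hm₁ne hI₁ hMP₁ (hb₁ (k + n)) d k
    have e₂ := fun k => hT.exists_visits_le_and_le hm₂ne hI₂ hMP₂ (hb₂ (k + n)) d k
    rcases lt_trichotomy (m₁.real (Iio d) / m₁.real univ) (m₂.real (Iio d) / m₂.real univ)
      with h | h | h
    · exact (hT.false_of_visits_lt h0 hc hsep hd h (fun k => (e₁ k).1) fun k => (e₂ k).2).elim
    · exact h
    · exact (hT.false_of_visits_lt h0 hc hsep hd h (fun k => (e₂ k).1) fun k => (e₁ k).2).elim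
  set k := m₁.real univ / m₂.real univ with hk
  have hkpos : 0 < k := div_pos hpos₁ hpos₂
  have hfreq' : ∀ n, ∀ d ∈ badSet a b T B n, m₁.real (Iio d) = k * m₂.real (Iio d) := by
    intro n d hd
    have := hfreq n d hd
    rw [div_eq_div_iff hpos₁.ne' hpos₂.ne'] at this
    rw [hk]
    field_simp
    linarith
  have hm₂Iio : ∀ y ∈ Icc a b, m₂.real (Iio y) = y - a := by
    intro y hy
    rw [measureReal_def, hm₂, Measure.restrict_apply measurableSet_Iio]
    have : Iio y ∩ Ioo a b = Ioo a y := by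
      ext z; simp only [mem_inter_iff, mem_Iio, mem_Ioo]
      exact ⟨fun h => ⟨h.2.1, h.1⟩, fun h => ⟨h.2, h.1, h.2.trans_le hy.2⟩⟩
    rw [this, Real.volume_Ioo, ENNReal.toReal_ofReal (by linarith [hy.1])]
  have hm₂Iic : ∀ y ∈ Icc a b, m₂.real (Iic y) = y - a := by
    intro y hy
    rw [← hm₂Iio y hy]
    exact measureReal_congr Iio_ae_eq_Iic.symm
  -- Since bad points are dense, the distribution functions are proportional.
  have hmid : ∀ y ∈ Ioo a b, m₁.real (Iic y) = k * (y - a) := by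
    intro y hy
    refine le_antisymm (le_of_forall_pos_le_add fun ε hε => ?_)
      (le_of_forall_pos_le_add fun ε hε => ?_)
    · obtain ⟨n, d, hd, hdy⟩ := hdense y (min b (y + ε / k)) hy.1.le
        (lt_min hy.2 (by linarith [div_pos hε hkpos])) (min_le_left _ _)
      calc m₁.real (Iic y) ≤ m₁.real (Iio d) := measureReal_mono (Iic_subset_Iio.2 hdy.1)
        _ = k * (d - a) := by rw [hfreq' n d hd, hm₂Iio d ⟨hd.1.1.le, hd.1.2.le⟩]
        _ ≤ k * (y + ε / k - a) := by
          have := hdy.2.trans_le (min_le_right _ _)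
          gcongr
        _ = k * (y - a) + ε := by field_simp; ring
    · obtain ⟨n, d, hd, hdy⟩ := hdense (max a (y - ε / k)) y (le_max_left _ _)
        (max_lt hy.1 (by linarith [div_pos hε hkpos])) hy.2.le
      calc k * (y - a) = k * (y - ε / k - a) + ε := by field_simp; ring
        _ ≤ k * (d - a) + ε := by
          have := (le_max_right a (y - ε / k)).trans_lt hdy.1
          gcongr
        _ = m₁.real (Iio d) + ε := by rw [hfreq' n d hd, hm₂Iio d ⟨hd.1.1.le, hd.1.2.le⟩]
        _ ≤ m₁.real (Iic y) + ε := by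
          gcongr
          · exact measure_ne_top _ _
          · exact fun z hz => (hz.trans hdy.2).le
  have hkm : ∀ S, m₁.real S = k * m₂.real S → m₁ S = k.toNNReal • m₂ S := by
    intro S hS
    rw [ENNReal.smul_def, smul_eq_mul, ← ENNReal.toReal_eq_toReal_iff' (measure_ne_top _ _)
      (ENNReal.mul_ne_top ENNReal.coe_ne_top (measure_ne_top _ _)), ENNReal.toReal_mul,
      ENNReal.coe_toReal, Real.coe_toNNReal _ hkpos.le]
    exact hS
  refine ⟨k.toNNReal, Measure.ext_of_Iic _ _ fun y => ?_⟩
  rw [Measure.smul_apply]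
  rcases le_or_gt y a with hya | hya
  · have : Iic y ⊆ (Ioo a b)ᶜ := fun z hz h => absurd (h.1.trans_le (le_trans hz hya)) (lt_irrefl _)
    rw [measure_mono_null this hI₁, measure_mono_null this hI₂, smul_zero]
  rcases lt_or_ge y b with hyb | hyb
  · exact hkm _ (by rw [hmid y ⟨hya, hyb⟩, hm₂Iic y ⟨hya.le, hyb.le⟩])
  · have hfull : ∀ m : Measure ℝ, m (Ioo a b)ᶜ = 0 → m.real (Iic y) = m.real univ := by
      intro m hm
      refine measureReal_congr (ae_eq_univ.2 (measure_mono_null ?_ hm))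
      exact compl_subset_compl.2 fun z hz => hz.2.le.trans hyb
    refine hkm _ ?_
    rw [hfull _ hI₁, hfull _ hI₂, hk]
    field_simp

end IsIntervalExchange

/-! ### The first return map to a horizontal arc -/

namespace FlatStructure

variable {X : Type*} [TopologicalSpace X] {F : FlatStructure X}

/-- The leaf through the point `x` of the horizontal arc `t ↦ exp p t` runs upwards for the time `s`
to the point `y` of the open arc over `(a, b)`, and does not meet the closed arc in between. -/
structure IsFirstReturn (F : FlatStructure X) (p : X) (a b x s y : ℝ) : Prop where
  pos : 0 < s
  mem_flowDom : s ∈ F.flowDom (F.exp p x)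
  mem_Ioo : y ∈ Ioo a b
  flow_eq : F.flow (F.exp p x) s = F.exp p y
  flow_ne : ∀ s' ∈ Ioo 0 s, ∀ z ∈ Icc a b, F.flow (F.exp p x) s' ≠ F.exp p z

theorem mem_flowDom_of_le {q : X} {s t : ℝ} (ht : t ∈ F.flowDom q) (hs : s ∈ Icc 0 t) :
    s ∈ F.flowDom q :=
  (ordConnected_flowDom q).out (zero_mem_flowDom_of_mem ht) ht hs

theorem abs_lt_of_mem_Icc {a b r x : ℝ} (ha : |a| < r / 2) (hb : |b| < r / 2) (hx : x ∈ Icc a b) :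
    |x| < r / 2 := by
  rw [abs_lt] at *
  exact ⟨by linarith [hx.1], by linarith [hx.2]⟩

theorem IsFirstReturn.eq_of_eq {p : X} {r : ℝ} (hD : F.IsDisc p r) {a b x s y s' y' : ℝ}
    (ha : |a| < r / 2) (hb : |b| < r / 2) (h : F.IsFirstReturn p a b x s y)
    (h' : F.IsFirstReturn p a b x s' y') : s = s' ∧ y = y' := by
  have hs : s = s' := by
    rcases lt_trichotomy s s' with hlt | heq | hlt
    · exact absurd h.flow_eq (h'.flow_ne s ⟨h.pos, hlt⟩ y (Ioo_subset_Icc_self h.mem_Ioo))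
    · exact heq
    · exact absurd h'.flow_eq (h.flow_ne s' ⟨h'.pos, hlt⟩ y' (Ioo_subset_Icc_self h'.mem_Ioo))
  subst hs
  refine ⟨rfl, ?_⟩
  have := h.flow_eq.symm.trans h'.flow_eq
  have := hD.injOn (hD.coe_mem (abs_lt_of_mem_Icc ha hb (Ioo_subset_Icc_self h.mem_Ioo)))
    (hD.coe_mem (abs_lt_of_mem_Icc ha hb (Ioo_subset_Icc_self h'.mem_Ioo))) this
  exact_mod_cast this

open scoped Classical in
/-- The first return map of the vertical flow to the horizontal arc over `(a, b)`, where the return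
time is at most `H`. Its value is `0` where there is no return. -/
def returnMap (F : FlatStructure X) (p : X) (a b H : ℝ) (x : ℝ) : ℝ :=
  if h : x ∈ Ioo a b ∧ ∃ y, ∃ s ≤ H, F.IsFirstReturn p a b x s y then h.2.choose else 0

/-- The points of the horizontal arc over `(a, b)` that do not return within the time `H`, or meet
an end of the arc first. -/
def noReturn (F : FlatStructure X) (p : X) (a b H : ℝ) : Set ℝ :=
  {x | ¬ ∃ y, ∃ s ≤ H, F.IsFirstReturn p a b x s y}

theorem exists_isFirstReturn {p : X} {a b H x : ℝ} (hx : x ∈ Ioo a b)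
    (h : x ∉ F.noReturn p a b H) : ∃ s ≤ H, F.IsFirstReturn p a b x s (F.returnMap p a b H x) := by
  have hx' : x ∈ Ioo a b ∧ ∃ y, ∃ s ≤ H, F.IsFirstReturn p a b x s y := ⟨hx, not_not.1 h⟩
  rw [returnMap, dif_pos hx']
  exact hx'.2.choose_spec

/-- The open box of height `r / 2` over a horizontal arc. -/
def box (F : FlatStructure X) (p : X) (r u v : ℝ) : Set X :=
  F.exp p '' (Ioo u v ×ℂ Ioo (-(r / 4)) (r / 4))

theorem IsDisc.mem_box {p : X} {r : ℝ} (hD : F.IsDisc p r) {u v x : ℝ} (hx : x ∈ Ioo u v) :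
    F.exp p x ∈ F.box p r u v := by
  have := hD.pos
  exact ⟨x, ⟨by simpa using hx, ⟨by simp; linarith, by simp; linarith⟩⟩, rfl⟩

section T2
variable [T2Space X]

/-- The horizontal arc through `p` is compatible with the exponential maps at its points. -/
theorem IsDisc.exp_exp_coe {p : X} {r : ℝ} (hD : F.IsDisc p r) (hF : F.IsTranslation) {x y : ℝ}
    (hx : |x| < r / 2) (hy : |y| < r / 2) :
    ((y - x : ℝ) : ℂ) ∈ F.dom (F.exp p x) ∧ F.exp (F.exp p x) ((y - x : ℝ) : ℂ) = F.exp p y := by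
  rw [Complex.ofReal_sub]
  exact exp_exp_of_convex hF (convex_ball (0:ℂ) r) hD.subset_dom (hD.coe_mem hx) (hD.coe_mem hy)

theorem IsDisc.notMem_sing {p : X} {r : ℝ} (hD : F.IsDisc p r) (hF : F.IsTranslation) {x : ℝ}
    (hx : |x| < r / 2) : F.exp p x ∉ F.sing :=
  exp_notMem_sing hF (hD.subset_dom (hD.coe_mem hx))

namespace IsFirstReturn

/-- There are no short returns. -/
theorem le_time {p : X} {r : ℝ} (hD : F.IsDisc p r) (hF : F.IsTranslation) {a b x s y : ℝ}
    (ha : |a| < r / 2) (hb : |b| < r / 2) (hx : |x| < r / 2) (h : F.IsFirstReturn p a b x s y) :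
    r / 2 ≤ s := by
  by_contra! hcon
  have := hD.eq_of_flow_eq hF hx (abs_lt_of_mem_Icc ha hb (Ioo_subset_Icc_self h.mem_Ioo))
    (by rwa [abs_of_pos h.pos]) h.flow_eq
  exact h.pos.ne' this.2

/-- The return map is injective. -/
theorem inj {p : X} {r : ℝ} (hD : F.IsDisc p r) (hF : F.IsTranslation) {a b x x' s s' y : ℝ}
    (ha : |a| < r / 2) (hb : |b| < r / 2) (hx : x ∈ Ioo a b) (hx' : x' ∈ Ioo a b)
    (h : F.IsFirstReturn p a b x s y) (h' : F.IsFirstReturn p a b x' s' y) : x = x' := by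
  have key : ∀ {x x' s s'}, x ∈ Ioo a b → x' ∈ Ioo a b → F.IsFirstReturn p a b x s y →
      F.IsFirstReturn p a b x' s' y → s ≤ s' → x = x' := by
    intro x x' s s' hx hx' h h' hss
    have h1 := flow_neg hF h.mem_flowDom
    rw [h.flow_eq, ← h'.flow_eq] at h1
    have h2 := flow_add hF h'.mem_flowDom h1.1
    rw [h1.2] at h2
    rcases hss.eq_or_lt with rfl | hlt
    · rw [add_neg_cancel, flow_zero] at h2
      have := hD.injOn (hD.coe_mem (abs_lt_of_mem_Icc ha hb (Ioo_subset_Icc_self hx')))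
        (hD.coe_mem (abs_lt_of_mem_Icc ha hb (Ioo_subset_Icc_self hx))) h2.2
      exact_mod_cast this.symm
    · exact absurd h2.2 (h'.flow_ne _ ⟨by linarith, by linarith [h.pos]⟩ x
        (Ioo_subset_Icc_self hx))
  rcases le_total s s' with hs | hs
  · exact key hx hx' h h' hs
  · exact (key hx' hx h' h hs).symm

/-- Leaves near a leaf from one point of the arc to another go from the arc to the arc in the same
time. -/
theorem eventually_flow_eq {p : X} {r : ℝ} (hD : F.IsDisc p r) (hF : F.IsTranslation) {x s y : ℝ}
    (hx : |x| < r / 2) (hy : |y| < r / 2) (hs : s ∈ F.flowDom (F.exp p x))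
    (h : F.flow (F.exp p x) s = F.exp p y) :
    ∀ᶠ w in 𝓝 x, |w| < r / 2 ∧ |w + (y - x)| < r / 2 ∧ s ∈ F.flowDom (F.exp p w) ∧
      F.flow (F.exp p w) s = F.exp p ((w + (y - x) : ℝ) : ℂ) := by
  have hc : Tendsto (fun w : ℝ => ((w - x : ℝ) : ℂ)) (𝓝 x) (𝓝 0) := by
    have := (by fun_prop : Continuous fun w : ℝ => ((w - x : ℝ) : ℂ)).tendsto x
    rwa [sub_self, Complex.ofReal_zero] at this
  have h1 : ∀ᶠ w in 𝓝 x, |w| < r / 2 := continuous_abs.continuousAt.eventually (gt_mem_nhds hx)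
  have h2 : ∀ᶠ w in 𝓝 x, |w + (y - x)| < r / 2 := by
    refine (by fun_prop : Continuous fun w => |w + (y - x)|).continuousAt.eventually
      (gt_mem_nhds ?_)
    change |x + (y - x)| < r / 2
    rwa [add_sub_cancel]
  filter_upwards [h1, h2, hc.eventually (flow_box hF hs)] with w h1 h2 h3
  have e1 := hD.exp_exp_coe hF hx h1
  have e2 := hD.exp_exp_coe hF hy h2
  rw [show w + (y - x) - y = w - x by ring] at e2
  rw [e1.2, h, e2.2] at h3
  exact ⟨h1, h2, h3.2.1, h3.2.2.2.1.trans h3.2.2.2.2.2.symm⟩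

/-- Nearby points return at the same time, and the return map is locally a translation. -/
theorem eventually {p : X} {r : ℝ} (hD : F.IsDisc p r) (hF : F.IsTranslation) {a b x s y : ℝ}
    (ha : |a| < r / 2) (hb : |b| < r / 2) (hx : |x| < r / 2) (h : F.IsFirstReturn p a b x s y) :
    ∀ᶠ w in 𝓝 x, F.IsFirstReturn p a b w s (w + (y - x)) := by
  have hy := abs_lt_of_mem_Icc ha hb (Ioo_subset_Icc_self h.mem_Ioo)
  have hbox := eventually_flow_eq hD hF hx hy h.mem_flowDom h.flow_eq
  have hr := hD.pos
  have hIoo : ∀ᶠ w in 𝓝 x, w + (y - x) ∈ Ioo a b := by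
    refine (by fun_prop : Continuous fun w => w + (y - x)).continuousAt.eventually
      (isOpen_Ioo.mem_nhds ?_)
    change x + (y - x) ∈ Ioo a b
    rw [add_sub_cancel]
    exact h.mem_Ioo
  have hcont : Continuous fun v : ℝ × ℝ => (⟨v.1, v.2⟩ : ℂ) := by
    have : (fun v : ℝ × ℝ => (⟨v.1, v.2⟩ : ℂ)) = fun v : ℝ × ℝ => (v.1 : ℂ) + v.2 * Complex.I := by
      funext v; apply Complex.ext <;> simp
    rw [this]; fun_prop
  have hcl : IsClosed ((fun z : ℝ => F.exp p z) '' Icc a b) := by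
    refine (isCompact_Icc.image_of_continuousOn ?_).isClosed
    exact (exp_continuousOn hF p).comp Complex.continuous_ofReal.continuousOn
      fun z hz => hD.subset_dom (hD.coe_mem (abs_lt_of_mem_Icc ha hb hz))
  have hne : ∀ᶠ w : ℝ in 𝓝 x, ∀ s' ∈ Icc 0 s, s' ∈ Ioo 0 s → ∀ z ∈ Icc a b,
      F.flow (F.exp p w) s' ≠ F.exp p z := by
    refine isCompact_Icc.eventually_forall_of_forall_eventually fun σ hσ => ?_
    have h1 : ∀ᶠ v : ℝ × ℝ in 𝓝 (x, σ), |v.1| < r / 2 := by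
      have : Continuous fun v : ℝ × ℝ => |v.1| := by fun_prop
      exact this.continuousAt.eventually (gt_mem_nhds hx)
    have hsmall : ∀ σ' : ℝ, ∀ᶠ v : ℝ × ℝ in 𝓝 (x, σ'), |v.2 - σ'| < r / 2 := fun σ' => by
      have : Continuous fun v : ℝ × ℝ => |v.2 - σ'| := by fun_prop
      refine this.continuousAt.eventually (gt_mem_nhds ?_)
      simpa using hr
    -- At both ends of the time interval use that there are no short returns, and in between that
    -- the closed arc is compact.
    rcases hσ.1.eq_or_lt with rfl | hσ0
    · filter_upwards [h1, hsmall 0] with v h1 h2 hv z hz heq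
      rw [sub_zero] at h2
      exact hv.1.ne' (hD.eq_of_flow_eq hF h1 (abs_lt_of_mem_Icc ha hb hz) h2 heq).2
    rcases hσ.2.eq_or_lt with rfl | hσs
    · filter_upwards [h1, hsmall σ, continuous_fst.continuousAt.eventually hbox]
        with v h1 h2 h3 hv z hz heq
      have h4 := flow_sub hF h3.2.2.1 (mem_flowDom_of_le h3.2.2.1 (Ioo_subset_Icc_self hv))
      rw [h3.2.2.2, heq] at h4
      have := (hD.eq_of_flow_eq hF h3.2.1 (abs_lt_of_mem_Icc ha hb hz) h2 h4.2).2
      linarith [hv.2]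
    · have hcol : (⟨x, σ⟩ : ℂ) ∈ F.columns p := ⟨hD.subset_dom (hD.coe_mem hx),
        mem_flowDom_of_le h.mem_flowDom hσ⟩
      have hca : ContinuousAt (fun v : ℝ × ℝ => F.flow (F.exp p v.1) v.2) (x, σ) :=
        ContinuousAt.comp (f := fun v : ℝ × ℝ => (⟨v.1, v.2⟩ : ℂ)) (x := (x, σ))
          ((isDev_columns hF p).continuousOn.continuousAt ((isOpen_columns hF p).mem_nhds hcol))
          hcont.continuousAt
      have hno : F.flow (F.exp p x) σ ∉ (fun z : ℝ => F.exp p z) '' Icc a b := by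
        rintro ⟨z, hz, hzeq⟩
        exact h.flow_ne σ ⟨hσ0, hσs⟩ z hz hzeq.symm
      filter_upwards [hca.eventually (hcl.isOpen_compl.mem_nhds hno)] with v hv _ z hz heq
      exact hv ⟨z, hz, heq.symm⟩
  filter_upwards [hbox, hIoo, hne] with w h1 h2 h3
  exact ⟨h.pos, h1.2.2.1, h2, h1.2.2.2, fun s' hs' => h3 s' (Ioo_subset_Icc_self hs') hs'⟩

end IsFirstReturn

theorem IsDisc.eventually_returnMap {p : X} {r : ℝ} (hD : F.IsDisc p r) (hF : F.IsTranslation)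
    {a b H x : ℝ} (ha : |a| < r / 2) (hb : |b| < r / 2) (hx : x ∈ Ioo a b)
    (h : x ∉ F.noReturn p a b H) :
    ∀ᶠ w in 𝓝 x, w ∉ F.noReturn p a b H ∧
      F.returnMap p a b H w = w + (F.returnMap p a b H x - x) := by
  obtain ⟨s, hs, hret⟩ := exists_isFirstReturn hx h
  filter_upwards [hret.eventually hD hF ha hb (abs_lt_of_mem_Icc ha hb (Ioo_subset_Icc_self hx)),
    isOpen_Ioo.mem_nhds hx] with w hw hwI
  have hwn : w ∉ F.noReturn p a b H := not_not.2 ⟨_, s, hs, hw⟩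
  obtain ⟨s', -, hret'⟩ := exists_isFirstReturn hwI hwn
  exact ⟨hwn, (hret'.eq_of_eq hD ha hb hw).2⟩

/-- The first return map is an interval exchange. -/
theorem IsDisc.isIntervalExchange {p : X} {r : ℝ} (hD : F.IsDisc p r) (hF : F.IsTranslation)
    {a b H : ℝ} (ha : |a| < r / 2) (hb : |b| < r / 2) (hab : a < b) :
    IsIntervalExchange a b (F.returnMap p a b H) (F.noReturn p a b H) where
  lt := hab
  measurable := by
    classical
    set G := Ioo a b \ F.noReturn p a b H with hG
    have hGo : IsOpen G := by
      rw [isOpen_iff_mem_nhds]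
      rintro x ⟨hx, hxn⟩
      filter_upwards [isOpen_Ioo.mem_nhds hx, hD.eventually_returnMap hF ha hb hx hxn] with w h1 h2
      exact ⟨h1, h2.1⟩
    have heq : F.returnMap p a b H = G.piecewise (F.returnMap p a b H) fun _ => 0 := by
      funext x
      by_cases hx : x ∈ G
      · rw [piecewise_eq_of_mem _ _ _ hx]
      · rw [piecewise_eq_of_notMem _ _ _ hx, returnMap, dif_neg]
        rintro ⟨h1, h2⟩
        exact hx ⟨h1, not_not.2 h2⟩
    rw [heq]
    refine ContinuousOn.measurable_piecewise (fun x hx => ContinuousAt.continuousWithinAt ?_)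
      continuousOn_const hGo.measurableSet
    have h1 := hD.eventually_returnMap hF ha hb hx.1 hx.2
    refine ContinuousAt.congr (f := fun w => w + (F.returnMap p a b H x - x)) (by fun_prop) ?_
    filter_upwards [h1] with w hw using hw.2.symm
  mapsTo x hx hxn := by
    obtain ⟨s, -, h⟩ := exists_isFirstReturn hx hxn
    exact h.mem_Ioo
  injOn := by
    rintro x ⟨hx, hxn⟩ x' ⟨hx', hxn'⟩ heq
    obtain ⟨s, -, h⟩ := exists_isFirstReturn hx hxn
    obtain ⟨s', -, h'⟩ := exists_isFirstReturn hx' hxn'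
    rw [← heq] at h'
    exact h.inj hD hF ha hb hx hx' h'
  eventually x hx hxn := hD.eventually_returnMap hF ha hb hx hxn

open IsIntervalExchange in
/-- The first `k` returns of a point take place in a time between `k r / 2` and `k H`, and are its
only visits to the arc during this time. -/
theorem IsDisc.exists_iterate {p : X} {r : ℝ} (hD : F.IsDisc p r) (hF : F.IsTranslation)
    {a b H : ℝ} (ha : |a| < r / 2) (hb : |b| < r / 2) (hab : a < b) {x : ℝ} (hx : x ∈ Ioo a b)
    (k : ℕ) (hk : x ∉ badSet a b (F.returnMap p a b H) (F.noReturn p a b H) k) :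
    ∃ S, k * (r / 2) ≤ S ∧ S ≤ k * H ∧ S ∈ F.flowDom (F.exp p x) ∧
      F.flow (F.exp p x) S = F.exp p ((F.returnMap p a b H)^[k] x : ℝ) ∧
      ∀ τ ∈ Icc 0 S, ∀ z ∈ Icc a b, F.flow (F.exp p x) τ = F.exp p z →
        ∃ i, (F.returnMap p a b H)^[i] x = z := by
  have hT := hD.isIntervalExchange (H := H) hF ha hb hab
  have habs : ∀ z ∈ Icc a b, |z| < r / 2 := fun z hz => abs_lt_of_mem_Icc ha hb hz
  induction k with
  | zero =>
    refine ⟨0, by simp, by simp, zero_mem_flowDom hF (hD.notMem_sing hF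
      (habs x (Ioo_subset_Icc_self hx))), by simp [flow_zero], fun τ hτ z hz h => ⟨0, ?_⟩⟩
    have hτ0 : τ = 0 := le_antisymm hτ.2 hτ.1
    rw [hτ0, flow_zero] at h
    have := hD.injOn (hD.coe_mem (habs x (Ioo_subset_Icc_self hx))) (hD.coe_mem (habs z hz)) h
    exact_mod_cast this
  | succ k ih =>
    obtain ⟨S, h1, h2, h3, h4, h5⟩ := ih (fun h => hk (badSet_mono (Nat.le_succ k) h))
    have hxk := hT.iterate_mem hx hk (Nat.le_succ k)
    obtain ⟨s, hs, hret⟩ := exists_isFirstReturn hxk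
      (iterate_notMem hx hk (Nat.lt_succ_self k))
    have hle := hret.le_time hD hF ha hb (habs _ (Ioo_subset_Icc_self hxk))
    have hmem := hret.mem_flowDom
    have hfl := hret.flow_eq
    rw [← h4] at hmem hfl
    obtain ⟨h6, h7⟩ := flow_add hF h3 hmem
    have hS0 : 0 ≤ S := le_trans (by have := hD.pos; positivity) h1
    refine ⟨S + s, by push_cast; linarith, by push_cast; linarith, h6, ?_, ?_⟩
    · rw [h7, hfl, Function.iterate_succ_apply']
    · intro τ hτ z hz hz'
      rcases le_or_gt τ S with hτS | hτS
      · exact h5 τ ⟨hτ.1, hτS⟩ z hz hz'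
      · have h8 := (flow_sub hF h3 (mem_flowDom_of_le h6 hτ)).2
        rw [h4, hz'] at h8
        rcases hτ.2.eq_or_lt with rfl | hlt
        · refine ⟨k + 1, ?_⟩
          rw [h7, hfl] at hz'
          rw [Function.iterate_succ_apply']
          have := hD.injOn (hD.coe_mem (habs _ (Ioo_subset_Icc_self hret.mem_Ioo)))
            (hD.coe_mem (habs z hz)) hz'
          exact_mod_cast this
        · exact absurd h8 (hret.flow_ne _ ⟨by linarith, by linarith⟩ z hz)

/-- A leaf in the box crosses the arc at nearly the same time. -/
theorem IsDisc.exists_of_mem_box {p : X} {r : ℝ} (hD : F.IsDisc p r) (hF : F.IsTranslation)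
    {u v : ℝ} (hu : |u| < r / 2) (hv : |v| < r / 2) {q : X} {s : ℝ} (hs : s ∈ F.flowDom q)
    (h : F.flow q s ∈ F.box p r u v) : ∃ x ∈ Ioo u v, ∃ s', |s' - s| < r / 4 ∧
      s' ∈ F.flowDom q ∧ F.flow q s' = F.exp p x := by
  obtain ⟨z, ⟨hz1, hz2⟩, hz⟩ := h
  have hr := hD.pos
  have hx := abs_lt_of_mem_Icc hu hv (Ioo_subset_Icc_self hz1)
  have hy : |z.im| < r / 4 := abs_lt.2 hz2
  have h1 := hD.flow_eq hF hx (y := z.im) (by linarith)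
  have h2 := flow_neg hF h1.1
  rw [h1.2, show (⟨z.re, z.im⟩ : ℂ) = z from rfl, hz] at h2
  have h3 := flow_add hF hs h2.1
  refine ⟨z.re, hz1, s + -z.im, ?_, h3.1, h3.2.trans h2.2⟩
  rwa [add_sub_cancel_left, abs_neg]

theorem IsDisc.isOpen_box {p : X} {r : ℝ} (hD : F.IsDisc p r) (hF : F.IsTranslation) {u v : ℝ}
    (hu : |u| < r / 2) (hv : |v| < r / 2) : IsOpen (F.box p r u v) := by
  refine isOpen_image_exp hF (fun z hz => hD.subset_dom ?_) (isOpen_Ioo.reProdIm isOpen_Ioo)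
  have hr := hD.pos
  refine mk_mem_ball (x := z.re) (y := z.im)
    (abs_lt_of_mem_Icc hu hv (Ioo_subset_Icc_self hz.1)) ?_
  have : |z.im| < r / 4 := abs_lt.2 hz.2
  linarith

section Compact
variable [CompactSpace X]

/-- Long upward segments cross a given horizontal arc. -/
theorem IsDisc.exists_hit_up {p : X} {r : ℝ} (hD : F.IsDisc p r) (hF : F.IsTranslation)
    (hN : F.NoVerticalSaddle) {u v : ℝ} (hu : |u| < r / 2) (hv : |v| < r / 2) (huv : u < v) :
    ∃ H > 0, ∀ q, H ∈ F.flowDom q → ∃ s ∈ Ioc 0 H, ∃ x ∈ Ioo u v, F.flow q s = F.exp p x := by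
  have hr := hD.pos
  have hm : (u + v) / 2 ∈ Ioo u v := ⟨by linarith, by linarith⟩
  obtain ⟨H, hH, h⟩ := exists_uniform_flow_mem hF hN (hD.isOpen_box hF hu hv) (hD.mem_box hm)
    (hD.notMem_sing hF (abs_lt_of_mem_Icc hu hv (Ioo_subset_Icc_self hm)))
  refine ⟨H + r, by positivity, fun q hq => ?_⟩
  have h1 : r / 2 ∈ F.flowDom q := mem_flowDom_of_le hq ⟨by linarith, by linarith⟩
  have h2 := flow_sub hF h1 (mem_flowDom_of_le hq (s := r / 2 + H) ⟨by linarith, by linarith⟩)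
  rw [add_sub_cancel_left] at h2
  obtain ⟨s, hs, hsO⟩ := h _ h2.1
  obtain ⟨x, hx, s', hss, hs', hxe⟩ := hD.exists_of_mem_box hF hu hv (mem_flowDom_of_le h2.1 hs) hsO
  have h3 := flow_add hF h1 hs'
  rw [abs_lt] at hss
  exact ⟨r / 2 + s', ⟨by linarith [hs.1], by linarith [hs.2]⟩, x, hx, h3.2.trans hxe⟩

/-- Long downward segments cross a given horizontal arc. -/
theorem IsDisc.exists_hit_down {p : X} {r : ℝ} (hD : F.IsDisc p r) (hF : F.IsTranslation)
    (hN : F.NoVerticalSaddle) {u v : ℝ} (hu : |u| < r / 2) (hv : |v| < r / 2) (huv : u < v) :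
    ∃ H > 0, ∀ q, -H ∈ F.flowDom q → ∃ s ∈ Ioc 0 H, -s ∈ F.flowDom q ∧
      ∃ x ∈ Ioo u v, F.flow q (-s) = F.exp p x := by
  have hr := hD.pos
  have hm : (u + v) / 2 ∈ Ioo u v := ⟨by linarith, by linarith⟩
  obtain ⟨H, hH, h⟩ := exists_uniform_flow_mem_down hF hN (hD.isOpen_box hF hu hv) (hD.mem_box hm)
    (hD.notMem_sing hF (abs_lt_of_mem_Icc hu hv (Ioo_subset_Icc_self hm)))
  refine ⟨H + r, by positivity, fun q hq => ?_⟩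
  have hin : ∀ s ∈ Icc 0 (H + r), -s ∈ F.flowDom q := fun s hs =>
    (ordConnected_flowDom q).out hq (zero_mem_flowDom_of_mem hq)
      ⟨by linarith [hs.2], by linarith [hs.1]⟩
  have h1 : -(r / 2) ∈ F.flowDom q := hin _ ⟨by linarith, by linarith⟩
  have h2 : ∀ s ∈ Icc 0 H, -s ∈ F.flowDom (F.flow q (-(r / 2))) := fun s hs => by
    have := (flow_sub hF h1 (hin (r / 2 + s) ⟨by linarith [hs.1], by linarith [hs.2]⟩)).1
    rwa [show -(r / 2 + s) - -(r / 2) = -s by ring] at this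
  obtain ⟨s, hs, hsO⟩ := h _ (h2 H ⟨hH.le, le_rfl⟩)
  obtain ⟨x, hx, s', hss, hs', hxe⟩ := hD.exists_of_mem_box hF hu hv (h2 s hs) hsO
  have h3 := flow_add hF h1 hs'
  rw [abs_lt] at hss
  refine ⟨r / 2 - s', ⟨by linarith [hs.1], by linarith [hs.2]⟩, ?_⟩
  rw [show -(r / 2 - s') = -(r / 2) + s' by ring]
  exact ⟨h3.1, x, hx, h3.2.trans hxe⟩

/-- In every horizontal arc there are points whose upward leaf ends in a singular point. -/
theorem IsDisc.exists_blocked {p : X} {r : ℝ} (hD : F.IsDisc p r) (hF : F.IsTranslation)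
    (hN : F.NoVerticalSaddle) {u v : ℝ} (hu : |u| < r / 2) (hv : |v| < r / 2) (huv : u < v) :
    ∃ x ∈ Ioo u v, ∃ S > 0, S ∉ F.flowDom (F.exp p x) := by
  obtain ⟨H, hH, h⟩ := hD.exists_hit_down hF hN hu hv huv
  obtain ⟨q, hq, τ, hτ, hτq⟩ := exists_exit_up hF
  have hdown : Iic 0 ⊆ F.flowDom q := (hN q hq).resolve_left fun h => hτq (h hτ.le)
  obtain ⟨s, hs, hsq, x, hx, hxe⟩ := h q (hdown (by simp [hH.le]))
  refine ⟨x, hx, s + τ, by linarith [hs.1], fun hmem => hτq ?_⟩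
  have h1 := flow_neg hF hsq
  rw [neg_neg, hxe] at h1
  have h2 := (flow_sub hF h1.1 hmem).1
  rwa [h1.2, add_sub_cancel_left] at h2

end Compact
end T2
end FlatStructure

/-! ### Separation of the discontinuities of the return map -/

namespace FlatStructure

open IsIntervalExchange

variable {X : Type*} [TopologicalSpace X] [T2Space X] {F : FlatStructure X}

/-- A point that runs for a long time returns, unless it first meets an end of the arc. -/
theorem IsDisc.notMem_noReturn {p : X} {r : ℝ} (hD : F.IsDisc p r) (hF : F.IsTranslation)
    {a b H m : ℝ} (ha : |a| < r / 2) (hb : |b| < r / 2) (hH : 0 < H) (hm : 0 < m)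
    (hma : m ∉ F.flowDom (F.exp p a)) (hmb : m ∉ F.flowDom (F.exp p b))
    (hhit : ∀ q, H ∈ F.flowDom q → ∃ s ∈ Ioc 0 H, ∃ x ∈ Ioo a b, F.flow q s = F.exp p x) {y : ℝ}
    (hy : y ∈ Ioo a b) (hd : H + m ∈ F.flowDom (F.exp p y)) : y ∉ F.noReturn p a b H := by
  have habs : ∀ z ∈ Icc a b, |z| < r / 2 := fun z hz => abs_lt_of_mem_Icc ha hb hz
  have hya := habs y (Ioo_subset_Icc_self hy)
  have hHd : H ∈ F.flowDom (F.exp p y) := mem_flowDom_of_le hd ⟨hH.le, by linarith⟩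
  have hβ : ContinuousOn (fun z : ℝ => F.exp p z) (Icc a b) :=
    (exp_continuousOn hF p).comp Complex.continuous_ofReal.continuousOn
      fun z hz => hD.subset_dom (hD.coe_mem (habs z hz))
  have hcl : IsClosed ((fun z : ℝ => F.exp p z) '' Icc a b) :=
    (isCompact_Icc.image_of_continuousOn hβ).isClosed
  have hfc : ContinuousOn (F.flow (F.exp p y)) (Icc (r / 2) H) :=
    (flow_continuousOn hF _).mono fun s hs => mem_flowDom_of_le hHd
      ⟨by linarith [hs.1, hD.pos], hs.2⟩
  have hge : ∀ s ∈ Ioc 0 H, ∀ z ∈ Icc a b, F.flow (F.exp p y) s = F.exp p z → r / 2 ≤ s := by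
    intro s hs z hz h
    by_contra! hcon
    have := (hD.eq_of_flow_eq hF hya (habs z hz) (by rwa [abs_of_pos hs.1]) h).2
    exact hs.1.ne' this
  have hA := hfc.preimage_isClosed_of_isClosed isClosed_Icc hcl
  obtain ⟨s, hs, x, hx, hsx⟩ := hhit _ hHd
  obtain ⟨s₀, ⟨hs₀, z, hz, hsz⟩, hmin⟩ := (isCompact_Icc.of_isClosed_subset hA
    inter_subset_left).exists_isLeast ⟨s, ⟨hge s hs x (Ioo_subset_Icc_self hx) hsx, hs.2⟩, x,
      Ioo_subset_Icc_self hx, hsx.symm⟩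
  have hs₀0 : 0 < s₀ := by linarith [hs₀.1, hD.pos]
  have hs₀d := mem_flowDom_of_le hHd ⟨hs₀0.le, hs₀.2⟩
  have hrest : m ∈ F.flowDom (F.exp p z) := by
    have h1 := (flow_sub hF hs₀d hd).1
    rw [← hsz] at h1
    exact mem_flowDom_of_le h1 ⟨hm.le, by linarith [hs₀.2]⟩
  have hzI : z ∈ Ioo a b := by
    refine ⟨lt_of_le_of_ne hz.1 fun h => hma (h ▸ hrest),
      lt_of_le_of_ne hz.2 fun h => hmb (h ▸ hrest)⟩
  refine not_not.2 ⟨z, s₀, hs₀.2, hs₀0, hs₀d, hzI, hsz.symm, fun s' hs' w hw h => ?_⟩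
  have hs'I : s' ∈ Ioc 0 H := ⟨hs'.1, hs'.2.le.trans hs₀.2⟩
  exact absurd (hmin ⟨⟨hge s' hs'I w hw h, hs'I.2⟩, w, hw, h.symm⟩) (not_le.2 hs'.2)

/-- The discontinuities of the `n`-th iterate run into a singular point in bounded time. -/
theorem IsDisc.notMem_flowDom_of_mem_badSet {p : X} {r : ℝ} (hD : F.IsDisc p r)
    (hF : F.IsTranslation) {a b H m : ℝ} (ha : |a| < r / 2) (hb : |b| < r / 2) (hab : a < b)
    (hH : 0 < H) (hm : 0 < m)
    (hma : m ∉ F.flowDom (F.exp p a)) (hmb : m ∉ F.flowDom (F.exp p b))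
    (hhit : ∀ q, H ∈ F.flowDom q → ∃ s ∈ Ioc 0 H, ∃ x ∈ Ioo a b, F.flow q s = F.exp p x) {x : ℝ}
    {n : ℕ} (hx : x ∈ badSet a b (F.returnMap p a b H) (F.noReturn p a b H) n) :
    n * H + m ∉ F.flowDom (F.exp p x) := by
  classical
  intro hd
  obtain ⟨hxI, hex⟩ := hx
  obtain ⟨hkn, hkB⟩ := Nat.find_spec hex
  set k := Nat.find hex with hk
  have hxk : x ∉ badSet a b (F.returnMap p a b H) (F.noReturn p a b H) k := by
    rintro ⟨-, j, hj, hjB⟩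
    exact Nat.find_min hex hj ⟨hj.trans hkn, hjB⟩
  obtain ⟨S, hS1, hS2, hS3, hS4, -⟩ := hD.exists_iterate hF ha hb hab hxI k hxk
  have hxkI := (hD.isIntervalExchange (H := H) hF ha hb hab).iterate_mem hxI hxk le_rfl
  have h1 := (flow_sub hF hS3 hd).1
  rw [hS4] at h1
  -- After `k < n` returns a time of at least `H + m` is left.
  have h2 : (k : ℝ) + 1 ≤ n := by exact_mod_cast hkn
  have h3 : H + m ≤ n * H + m - S := by nlinarith
  exact hD.notMem_noReturn hF ha hb hH hm hma hmb hhit hxkI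
    (mem_flowDom_of_le h1 ⟨by linarith, h3⟩) hkB

/-- A point whose upward leaf is finite does not return forever. -/
theorem IsDisc.exists_mem_badSet {p : X} {r : ℝ} (hD : F.IsDisc p r)
    (hF : F.IsTranslation) {a b H : ℝ} (ha : |a| < r / 2) (hb : |b| < r / 2) (hab : a < b) {x S : ℝ}
    (hx : x ∈ Ioo a b) (hS : 0 < S) (hxS : S ∉ F.flowDom (F.exp p x)) :
    ∃ n, x ∈ badSet a b (F.returnMap p a b H) (F.noReturn p a b H) n := by
  by_contra! hcon
  obtain ⟨k, hk⟩ := exists_nat_ge (S / (r / 2))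
  obtain ⟨T, hT, -, hTd, -⟩ := hD.exists_iterate hF ha hb hab hx k (hcon k)
  rw [div_le_iff₀ (by have := hD.pos; positivity)] at hk
  exact hxS (mem_flowDom_of_le hTd ⟨hS.le, hk.trans hT⟩)

/-- A point that returns forever has a dense orbit, since its leaf crosses every part of the arc. -/
theorem IsDisc.isDenseOrbit [CompactSpace X] {p : X} {r : ℝ} (hD : F.IsDisc p r)
    (hF : F.IsTranslation) (hN : F.NoVerticalSaddle) {a b H : ℝ} (ha : |a| < r / 2)
    (hb : |b| < r / 2) (hab : a < b) {x : ℝ} (hx : x ∈ Ioo a b)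
    (hxb : ∀ n, x ∉ badSet a b (F.returnMap p a b H) (F.noReturn p a b H) n) :
    IsDenseOrbit a b (F.returnMap p a b H) (F.noReturn p a b H) x := by
  refine ⟨hx, fun k => iterate_notMem hx (hxb (k + 1)) (Nat.lt_succ_self k), ?_⟩
  intro u v hu huv hv
  have huI : u ∈ Icc a b := ⟨hu, huv.le.trans hv⟩
  have hvI : v ∈ Icc a b := ⟨hu.trans huv.le, hv⟩
  obtain ⟨H', hH', hhit⟩ := hD.exists_hit_up hF hN (abs_lt_of_mem_Icc ha hb huI)
    (abs_lt_of_mem_Icc ha hb hvI) huv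
  obtain ⟨k, hk⟩ := exists_nat_ge (H' / (r / 2))
  obtain ⟨S, hS, -, hSd, -, hall⟩ := hD.exists_iterate hF ha hb hab hx k (hxb k)
  rw [div_le_iff₀ (by have := hD.pos; positivity)] at hk
  obtain ⟨s, hs, z, hz, hsz⟩ := hhit _ (mem_flowDom_of_le hSd ⟨hH'.le, hk.trans hS⟩)
  obtain ⟨i, hi⟩ := hall s ⟨hs.1.le, hs.2.trans (hk.trans hS)⟩ z
    ⟨hu.trans hz.1.le, hz.2.le.trans hv⟩ hsz
  exact ⟨i, hi ▸ hz⟩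

/-- Two points that run into singular points within a time `S` cannot be close together, if at the
time `t` with `e ^ (t / 2) = 2 S / ε` no saddle connection is shorter than `ε`. -/
theorem IsDisc.le_sub_of_blocked [CompactSpace X] {p : X} {r : ℝ} (hD : F.IsDisc p r)
    (hF : F.IsTranslation) {ε t : ℝ} (hε : 0 < ε)
    (ht : ∀ γ v, F.IsSaddleConnection γ v → ε ≤ ‖teichmullerMap t v‖) {x y : ℝ} (hx : |x| < r / 2)
    (hy : |y| < r / 2) (hxy : x < y) (hxS : ε / 2 * Real.exp (t / 2) ∉ F.flowDom (F.exp p x))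
    (hyS : ε / 2 * Real.exp (t / 2) ∉ F.flowDom (F.exp p y)) :
    ε / 2 * Real.exp (-t / 2) ≤ y - x := by
  obtain ⟨γ, v, hγ, h1, h2⟩ := hD.exists_saddle_of_blocked hF (by positivity) hx hy hxy hxS hyS
  have h3 := (ht γ v hγ).trans (Complex.norm_le_abs_re_add_abs_im _)
  have e1 : (teichmullerMap t v).re = Real.exp (t / 2) * v.re := rfl
  have e2 : (teichmullerMap t v).im = Real.exp (-t / 2) * v.im := rfl
  have e3 : Real.exp (-t / 2) * Real.exp (t / 2) = 1 := by
    rw [← Real.exp_add]; simp [neg_div]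
  rw [e1, e2, abs_mul, abs_mul, abs_of_pos (Real.exp_pos _), abs_of_pos (Real.exp_pos _)] at h3
  have p1 := Real.exp_pos (t / 2)
  have p2 := Real.exp_pos (-t / 2)
  set u := Real.exp (t / 2)
  set w := Real.exp (-t / 2)
  have h4 : w * |v.im| ≤ ε / 2 := by
    calc w * |v.im| ≤ w * (ε / 2 * u) := by gcongr
      _ = ε / 2 * (w * u) := by ring
      _ = ε / 2 := by rw [e3, mul_one]
  have h5 : ε / 2 ≤ u * (y - x) := by
    have : u * |v.re| ≤ u * (y - x) := by gcongr
    linarith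
  calc ε / 2 * w ≤ u * (y - x) * w := by gcongr
    _ = (w * u) * (y - x) := by ring
    _ = y - x := by rw [e3, one_mul]

/-- The first return map to a suitable arc in a given disc satisfies the hypotheses of
Boshernitzan's criterion if the lengths of the saddle connections are bounded below at arbitrarily
large times of the Teichmüller flow. -/
theorem IsDisc.exists_arc [CompactSpace X] {p : X} {r : ℝ} (hD : F.IsDisc p r)
    (hF : F.IsTranslation) (hN : F.NoVerticalSaddle) {ε : ℝ} (hε : 0 < ε)
    (hsys : ∃ᶠ t : ℝ in atTop, ∀ γ v, F.IsSaddleConnection γ v → ε ≤ ‖teichmullerMap t v‖) :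
    ∃ a b H : ℝ, a < b ∧ |a| < r / 2 ∧ |b| < r / 2 ∧
      (∃ x₀, IsDenseOrbit a b (F.returnMap p a b H) (F.noReturn p a b H) x₀) ∧
      (∃ c > 0, ∃ᶠ n in atTop,
        IsSeparatedAt a b (F.returnMap p a b H) (F.noReturn p a b H) c n) ∧
      ∀ u v, a ≤ u → u < v → v ≤ b →
        ∃ n, ∃ x ∈ badSet a b (F.returnMap p a b H) (F.noReturn p a b H) n, x ∈ Ioo u v := by
  have hr := hD.pos
  have hq : |-(r / 4)| < r / 2 := by rw [abs_neg, abs_of_pos (by linarith)]; linarith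
  have hq' : |r / 4| < r / 2 := by rw [abs_of_pos (by linarith)]; linarith
  -- The ends of the arc are chosen to run into singular points, so that a point which runs into an
  -- end also runs into a singular point.
  obtain ⟨a, haI, Sa, hSa, hSa'⟩ := hD.exists_blocked hF hN hq (v := 0) (by simpa) (by linarith)
  obtain ⟨b, hbI, Sb, hSb, hSb'⟩ := hD.exists_blocked hF hN (u := 0) (by simpa) hq' (by linarith)
  have ha : |a| < r / 2 := abs_lt.2 ⟨by linarith [haI.1], by linarith [haI.2]⟩
  have hb : |b| < r / 2 := abs_lt.2 ⟨by linarith [hbI.1], by linarith [hbI.2]⟩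
  have hab : a < b := haI.2.trans hbI.1
  obtain ⟨H, hH, hhit⟩ := hD.exists_hit_up hF hN ha hb hab
  set m := max Sa Sb with hm
  have hm0 : 0 < m := lt_max_of_lt_left hSa
  have hma : m ∉ F.flowDom (F.exp p a) := fun h =>
    hSa' (mem_flowDom_of_le h ⟨hSa.le, le_max_left _ _⟩)
  have hmb : m ∉ F.flowDom (F.exp p b) := fun h =>
    hSb' (mem_flowDom_of_le h ⟨hSb.le, le_max_right _ _⟩)
  have hbad := fun n x => hD.notMem_flowDom_of_mem_badSet (x := x) (n := n) hF ha hb hab hH hm0 hma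
    hmb hhit
  have habs : ∀ z ∈ Icc a b, |z| < r / 2 := fun z hz => abs_lt_of_mem_Icc ha hb hz
  refine ⟨a, b, H, hab, ha, hb, ?_, ⟨ε ^ 2 / (4 * (2 * H + m)), by positivity, ?_⟩, ?_⟩
  · have hc : (⋃ n, badSet a b (F.returnMap p a b H) (F.noReturn p a b H) n).Countable := by
      refine countable_iUnion fun n => ((hD.finite_blocked hF (S := n * H + m)
        (by positivity)).subset fun x hx => ?_).countable
      exact ⟨habs x (Ioo_subset_Icc_self hx.1), hbad n x hx⟩
    obtain ⟨x₀, hx₀, hx₀b⟩ : (Ioo a b \ ⋃ n, badSet a b (F.returnMap p a b H)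
        (F.noReturn p a b H) n).Nonempty := by
      rw [sdiff_nonempty]
      exact fun h => not_le.2 hab (Cardinal.Real.Ioo_countable_iff.1 (hc.mono h))
    exact ⟨x₀, hD.isDenseOrbit hF hN ha hb hab hx₀ fun n hn => hx₀b (mem_iUnion.2 ⟨n, hn⟩)⟩
  · -- The time `t` controls the iterate of order `(ε / 2 * e ^ (t / 2) - m) / H`.
    have htend : Tendsto (fun t : ℝ => ⌊(ε / 2 * Real.exp (t / 2) - m) / H⌋₊) atTop atTop := by
      refine tendsto_nat_floor_atTop.comp (Tendsto.atTop_div_const hH ?_)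
      refine tendsto_atTop_add_const_right _ _ (Tendsto.const_mul_atTop (by positivity) ?_)
      exact Real.tendsto_exp_atTop.comp (tendsto_id.atTop_div_const (by norm_num))
    refine htend.frequently ((hsys.and_eventually (htend.eventually_ge_atTop 1)).mono ?_)
    rintro t ⟨ht, hn1⟩
    set S := ε / 2 * Real.exp (t / 2) with hS
    set n := ⌊(S - m) / H⌋₊ with hn
    have hn1' : (1 : ℝ) ≤ n := by exact_mod_cast hn1
    have hpos : 0 ≤ (S - m) / H := by
      by_contra! hcon
      rw [hn, Nat.floor_of_nonpos hcon.le] at hn1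
      exact absurd hn1 (by norm_num)
    have hnS : n * H + m ≤ S := by
      have := Nat.floor_le hpos
      rw [le_div_iff₀ hH] at this
      linarith
    have hSn : S ≤ n * (2 * H + m) := by
      have := Nat.lt_floor_add_one ((S - m) / H)
      rw [div_lt_iff₀ hH] at this
      nlinarith
    have hS0 : 0 < S := by positivity
    have hblock : ∀ x ∈ badSet a b (F.returnMap p a b H) (F.noReturn p a b H) n ∪ {a, b},
        |x| < r / 2 ∧ S ∉ F.flowDom (F.exp p x) := by
      rintro x (hx | hx)
      · exact ⟨habs x (Ioo_subset_Icc_self hx.1), fun h => hbad n x hx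
          (mem_flowDom_of_le h ⟨by positivity, hnS⟩)⟩
      · have hmS : m ≤ S := le_trans (by nlinarith) hnS
        rcases hx with rfl | hx
        · exact ⟨ha, fun h => hma (mem_flowDom_of_le h ⟨hm0.le, hmS⟩)⟩
        · rw [mem_singleton_iff] at hx
          subst hx
          exact ⟨hb, fun h => hmb (mem_flowDom_of_le h ⟨hm0.le, hmS⟩)⟩
    refine ⟨hn1, fun x hx y hy hxy => ?_⟩
    refine le_trans ?_ (hD.le_sub_of_blocked hF hε ht (hblock x hx).1 (hblock y hy).1 hxy
      (hblock x hx).2 (hblock y hy).2)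
    have e1 : ε / 2 * Real.exp (-t / 2) = ε ^ 2 / (4 * S) := by
      rw [hS, neg_div, Real.exp_neg]
      field_simp
      norm_num
    rw [e1, div_div]
    exact div_le_div_of_nonneg_left (sq_nonneg _) (by positivity) (by linarith)
  · intro u v hu huv hv
    obtain ⟨x, hx, S, hS, hxS⟩ := hD.exists_blocked hF hN (habs u ⟨hu, huv.le.trans hv⟩)
      (habs v ⟨hu.trans huv.le, hv⟩) huv
    obtain ⟨n, hn⟩ := hD.exists_mem_badSet (H := H) hF ha hb hab
      ⟨hu.trans_lt hx.1, hx.2.trans_le hv⟩ hS hxS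
    exact ⟨n, x, hn, hx⟩

end FlatStructure

/-! ### Transverse measures -/

namespace FlatStructure

variable {X : Type*} [TopologicalSpace X] {F : FlatStructure X}

/-- The length of horizontal arcs, as a transverse measure. -/
def lengthMeasure (F : FlatStructure X) : F.TransverseMeasure where
  meas I := volume.restrict (Icc I.a I.b)
  finite I := ⟨by simp⟩
  carried I := by
    rw [Measure.restrict_apply measurableSet_Icc.compl, compl_inter_self, measure_empty]
  subarc I J h1 h2 _ := by
    rw [Measure.restrict_restrict measurableSet_Icc, inter_eq_left.2 (Icc_subset_Icc h1 h2)]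
  invariant I J R c d k _ _ ha hb _ _ := by
    have h := (measurePreserving_add_right volume k).restrict_preimage
      (measurableSet_Icc (a := J.a) (b := J.b))
    rw [ha, hb, preimage_add_const_Icc, add_sub_cancel_right, add_sub_cancel_right] at h
    rw [ha, hb, h.map_eq]

/-- The part of a horizontal arc over a smaller interval. -/
def HorizontalArc.sub (I : F.HorizontalArc) (u v : ℝ) (huv : u ≤ v) (hu : I.a ≤ u) (hv : v ≤ I.b) :
    F.HorizontalArc where
  path := I.path
  a := u
  b := v
  le := huv
  straight := isDev_line_iff.1 ((isDev_line_iff.2 I.straight).mono (Icc_subset_Icc hu hv))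

theorem HorizontalArc.isDev (I : F.HorizontalArc) :
    F.IsDev I.path (fun s : ℝ => (s : ℂ)) (Icc I.a I.b) :=
  (isDev_line_iff.2 I.straight).congr_dev 0 (by simp)

theorem TransverseMeasure.meas_sub (ν : F.TransverseMeasure) (I : F.HorizontalArc) (u v : ℝ)
    (huv : u ≤ v) (hu : I.a ≤ u) (hv : v ≤ I.b) :
    ν.meas (I.sub u v huv hu hv) = (ν.meas I).restrict (Icc u v) :=
  ν.subarc I (I.sub u v huv hu hv) hu hv fun _ _ => rfl

/-- Opposite edges of a rectangle carry the same measure, whichever of them is at the top. -/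
theorem TransverseMeasure.meas_eq_map (ν : F.TransverseMeasure) {I J : F.HorizontalArc} {R : ℂ → X}
    {c d k : ℝ} (hR : F.IsRectangle R I.a I.b (min c d) (max c d)) (ha : J.a = I.a + k)
    (hb : J.b = I.b + k) (hI : ∀ s ∈ Icc I.a I.b, I.path s = R ⟨s, c⟩)
    (hJ : ∀ s ∈ Icc I.a I.b, J.path (s + k) = R ⟨s, d⟩) :
    ν.meas J = (ν.meas I).map (fun s => s + k) := by
  rcases le_total c d with h | h
  · rw [min_eq_left h, max_eq_right h] at hR
    exact ν.invariant I J R c d k h hR ha hb hI hJ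
  · rw [min_eq_right h, max_eq_left h] at hR
    have hR' : F.IsRectangle (fun z => R (z - k)) J.a J.b d c := by
      rw [← isDev_rectangle_iff] at hR ⊢
      refine (hR.comp (f := fun z : ℂ => z - k) (by fun_prop) ?_).congr_dev k (by simp)
      rintro z ⟨hz1, hz2⟩
      rw [mem_preimage, mem_Icc] at hz1 hz2
      refine ⟨⟨?_, ?_⟩, ⟨?_, ?_⟩⟩ <;> simp <;> linarith
    have e : ∀ s y : ℝ, (⟨s, y⟩ : ℂ) - k = ⟨s - k, y⟩ := fun s y => by
      apply Complex.ext <;> simp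
    have := ν.invariant J I (fun z => R (z - k)) d c (-k) h hR' (by linarith) (by linarith) ?_ ?_
    · rw [this, Measure.map_map (by fun_prop) (by fun_prop)]
      simp [Function.comp_def]
    · intro s hs
      have := hJ (s - k) ⟨by linarith [hs.1], by linarith [hs.2]⟩
      rw [sub_add_cancel] at this
      rw [this, e]
    · intro s hs
      have := hI (s + -k) ⟨by linarith [hs.1], by linarith [hs.2]⟩
      rw [this, e, sub_eq_add_neg]

section T2
variable [T2Space X]

/-- Arcs that are joined by a vertical segment carry the same measure near its ends. The first end
may be an endpoint of the arc `I`, which is why the interval around it is cut off. -/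
theorem exists_slide (hF : F.IsTranslation) (I J : F.HorizontalArc) {s₀ s₁ σ : ℝ}
    (hs₀ : s₀ ∈ Icc I.a I.b) (hs₁ : s₁ ∈ Ioo J.a J.b) (hσ : σ ∈ F.flowDom (I.path s₀))
    (h : F.flow (I.path s₀) σ = J.path s₁) :
    ∃ δ > 0, ∃ u v, Icc u v = Icc I.a I.b ∩ Icc (s₀ - δ) (s₀ + δ) ∧
      Icc (u + (s₁ - s₀)) (v + (s₁ - s₀)) ⊆ Ioo J.a J.b ∧ ∀ ν : F.TransverseMeasure,
        (ν.meas J).restrict (Icc (u + (s₁ - s₀)) (v + (s₁ - s₀))) =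
          ((ν.meas I).restrict (Icc u v)).map fun s => s + (s₁ - s₀) := by
  set q := I.path s₀ with hq
  obtain ⟨δ₀, hδ₀, hsub⟩ := (isCompact_segment 0 (σ • Complex.I)).exists_thickening_subset_open
    (isOpen_dom q) (segment_subset_dom hσ)
  obtain ⟨δ, hδ, hδδ₀, hδa, hδb⟩ : ∃ δ > 0, δ < δ₀ ∧ δ < s₁ - J.a ∧ δ < J.b - s₁ := by
    have hpos : 0 < min δ₀ (min (s₁ - J.a) (J.b - s₁)) :=
      lt_min hδ₀ (lt_min (by linarith [hs₁.1]) (by linarith [hs₁.2]))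
    obtain ⟨δ, h1, h2⟩ := exists_between hpos
    exact ⟨δ, h1, (lt_min_iff.1 h2).1, (lt_min_iff.1 (lt_min_iff.1 h2).2).1,
      (lt_min_iff.1 (lt_min_iff.1 h2).2).2⟩
  set k := s₁ - s₀ with hk
  set u := max I.a (s₀ - δ) with hu
  set v := min I.b (s₀ + δ) with hv
  have hIa : I.a ≤ u := le_max_left _ _
  have hIb : v ≤ I.b := min_le_left _ _
  have hua : s₀ - δ ≤ u := le_max_right _ _
  have hvb : v ≤ s₀ + δ := min_le_right _ _
  have hus : u ≤ s₀ := max_le hs₀.1 (by linarith)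
  have hsv : s₀ ≤ v := le_min hs₀.2 (by linarith)
  have huv : u ≤ v := hus.trans hsv
  refine ⟨δ, hδ, u, v, by rw [Icc_inter_Icc], fun z hz => ⟨by linarith [hz.1], by linarith [hz.2]⟩,
    fun ν => ?_⟩
  -- The rectangle swept out by the vertical segment.
  have hmaps : MapsTo (fun z : ℂ => z - s₀) (Icc u v ×ℂ Icc (min 0 σ) (max 0 σ)) (F.dom q) := by
    rintro z ⟨hz1, hz2⟩
    refine hsub (Metric.mem_thickening_iff.2 ⟨z.im • Complex.I, ?_, ?_⟩)
    · have hseg : z.im ∈ segment ℝ 0 σ := by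
        rw [segment_eq_uIcc, uIcc]
        exact hz2
      obtain ⟨θ, θ', h0, h1, h2, h3⟩ := hseg
      refine ⟨θ, θ', h0, h1, h2, ?_⟩
      rw [← h3]
      module
    · rw [dist_eq_norm]
      have e : z - s₀ - z.im • Complex.I = ((z.re - s₀ : ℝ) : ℂ) := by
        apply Complex.ext <;> simp
      rw [e, Complex.norm_real, Real.norm_eq_abs]
      refine lt_of_le_of_lt (abs_le.2 ⟨?_, ?_⟩) hδδ₀ <;> linarith [hz1.1, hz1.2]
  have hR : F.IsDev (fun z => F.exp q (z - s₀)) id (Icc u v ×ℂ Icc (min 0 σ) (max 0 σ)) :=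
    ((isDev_exp hF q).comp (f := fun z : ℂ => z - s₀) (by fun_prop) hmaps).congr_dev s₀ (by simp)
  have hedge : ∀ y ∈ Icc (min 0 σ) (max 0 σ),
      F.IsDev (fun s : ℝ => F.exp q (⟨s, y⟩ - s₀)) (fun s : ℝ => (s : ℂ)) (Icc u v) := by
    intro y hy
    refine (hR.comp (f := fun s : ℝ => (⟨s, y⟩ : ℂ)) (C' := Icc u v) ?_
      (fun s hs => ⟨hs, hy⟩)).congr_dev (-(y * Complex.I)) ?_
    · have : (fun s : ℝ => (⟨s, y⟩ : ℂ)) = fun s : ℝ => (s : ℂ) + y * Complex.I := by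
        funext s; apply Complex.ext <;> simp
      rw [this]; fun_prop
    · intro s _
      apply Complex.ext <;> simp
  have hbot : EqOn I.path (fun s : ℝ => F.exp q (⟨s, 0⟩ - s₀)) (Icc u v) := by
    refine (I.isDev.mono (Icc_subset_Icc hIa hIb)).eqOn hF (hedge 0 ⟨min_le_left _ _,
      le_max_left _ _⟩) isPreconnected_Icc (z₀ := s₀) ⟨hus, hsv⟩ ?_
    have : (⟨s₀, 0⟩ : ℂ) - s₀ = 0 := by apply Complex.ext <;> simp
    rw [this, exp_zero]
  have htop : EqOn (fun s => J.path (s + k)) (fun s : ℝ => F.exp q (⟨s, σ⟩ - s₀)) (Icc u v) := by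
    have hJ : F.IsDev (fun s => J.path (s + k)) (fun s : ℝ => (s : ℂ)) (Icc u v) :=
      (J.isDev.comp (f := fun s : ℝ => s + k) (C' := Icc u v) (by fun_prop) fun s hs =>
        ⟨by linarith [hs.1], by linarith [hs.2]⟩).congr_dev (-k) (by simp)
    refine hJ.eqOn hF (hedge σ ⟨min_le_right _ _, le_max_right _ _⟩) isPreconnected_Icc (z₀ := s₀)
      ⟨hus, hsv⟩ ?_
    have : (⟨s₀, σ⟩ : ℂ) - s₀ = σ • Complex.I := by apply Complex.ext <;> simp
    rw [this, hk, add_sub_cancel]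
    exact h.symm
  rw [← ν.meas_sub I u v huv hIa hIb, ← ν.meas_sub J (u + k) (v + k) (by linarith) (by linarith)
    (by linarith)]
  exact ν.meas_eq_map (I := I.sub u v huv hIa hIb) (isDev_rectangle_iff.1 hR) rfl rfl hbot htop

/-- The horizontal arc `s ↦ exp p s` over the interval `[a, b]`. -/
def IsDisc.arc {p : X} {r : ℝ} (hD : F.IsDisc p r) (hF : F.IsTranslation) {a b : ℝ}
    (ha : |a| < r / 2) (hb : |b| < r / 2) (hab : a ≤ b) : F.HorizontalArc where
  path s := F.exp p s
  a := a
  b := b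
  le := hab
  straight := isDev_line_iff.1 (((isDev_exp hF p).comp (f := fun s : ℝ => (s : ℂ)) (by fun_prop)
    fun s hs => hD.subset_dom (hD.coe_mem (abs_lt_of_mem_Icc ha hb hs))).congr_dev 0 (by simp))

/-- Points of an arc on the same leaf have neighbourhoods that correspond by a translation which
preserves every transverse measure. -/
theorem TransverseMeasure.exists_image_eq (ν : F.TransverseMeasure) (hF : F.IsTranslation)
    (I : F.HorizontalArc) {x y σ : ℝ} (hx : x ∈ Ioo I.a I.b) (hy : y ∈ Ioo I.a I.b)
    (hσ : σ ∈ F.flowDom (I.path x)) (h : F.flow (I.path x) σ = I.path y) :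
    ∃ U ∈ 𝓝 x, ∀ A ⊆ U, MeasurableSet A → ν.meas I ((fun z => z + (y - x)) '' A) = ν.meas I A := by
  obtain ⟨δ, hδ, u, v, huv, hsub, hν⟩ := exists_slide hF I I (Ioo_subset_Icc_self hx) hy hσ h
  have hU : Icc u v ∈ 𝓝 x := by
    rw [huv]
    exact inter_mem (Icc_mem_nhds hx.1 hx.2) (Icc_mem_nhds (by linarith) (by linarith))
  refine ⟨_, hU, fun A hA hAm => ?_⟩
  have himg : MeasurableSet ((fun z => z + (y - x)) '' A) :=
    (Homeomorph.addRight (y - x)).toMeasurableEquiv.measurableSet_image.2 hAm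
  have h1 : (ν.meas I).restrict (Icc (u + (y - x)) (v + (y - x))) ((fun z => z + (y - x)) '' A) =
      ν.meas I ((fun z => z + (y - x)) '' A) := by
    rw [Measure.restrict_apply himg, inter_eq_left.2]
    rintro _ ⟨z, hz, rfl⟩
    exact ⟨by linarith [(hA hz).1], by linarith [(hA hz).2]⟩
  rw [← h1, hν ν, Measure.map_apply (by fun_prop) himg,
    preimage_image_eq _ (add_left_injective (y - x)), Measure.restrict_apply hAm,
    inter_eq_left.2 hA]

section Compact
variable [CompactSpace X]

/-- Every leaf crosses a given horizontal arc infinitely often. -/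
theorem IsDisc.infinite_hits {p : X} {r : ℝ} (hD : F.IsDisc p r) (hF : F.IsTranslation)
    (hN : F.NoVerticalSaddle) {u v : ℝ} (hu : |u| < r / 2) (hv : |v| < r / 2) (huv : u < v) {q : X}
    (hq : q ∉ F.sing) :
    {x | x ∈ Ioo u v ∧ ∃ σ ∈ F.flowDom q, F.flow q σ = F.exp p x}.Infinite := by
  have key : ∀ (y σ : ℕ → ℝ), (∀ n, σ n ∈ F.flowDom q) → (∀ n, F.flow q (σ n) = F.exp p (y n)) →
      (∀ n, y n ∈ Ioo u v) → (∀ m n, m < n → σ m ≠ σ n) →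
      {x | x ∈ Ioo u v ∧ ∃ σ ∈ F.flowDom q, F.flow q σ = F.exp p x}.Infinite := by
    intro y σ h1 h2 h3 h4
    refine infinite_of_injective_forall_mem (f := y) (fun m n hmn => ?_)
      fun n => ⟨h3 n, σ n, h1 n, h2 n⟩
    have hne : ∀ i j, σ i < σ j → y i ≠ y j := by
      intro i j hij hyij
      have h5 := flow_sub hF (h1 i) (h1 j)
      refine flow_ne_self hF hN (sub_pos.2 hij) h5.1 ?_
      rw [h5.2, h2, h2, hyij]
    by_contra hcon
    have : σ m ≠ σ n := by
      rcases lt_or_gt_of_ne hcon with h | h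
      · exact h4 _ _ h
      · exact (h4 _ _ h).symm
    rcases lt_or_gt_of_ne this with h | h
    · exact hne _ _ h hmn
    · exact hne _ _ h hmn.symm
  rcases hN q hq with hray | hray
  · obtain ⟨H, hH, hhit⟩ := hD.exists_hit_up hF hN hu hv huv
    have : ∀ n : ℕ, ∃ y σ, σ ∈ F.flowDom q ∧ F.flow q σ = F.exp p (y : ℝ) ∧ y ∈ Ioo u v ∧
        n * H < σ ∧ σ ≤ (n + 1) * H := by
      intro n
      have h1 := flow_sub hF (s := n * H) (t := (n + 1) * H) (hray (by simp; positivity))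
        (hray (by simp; positivity))
      rw [show ((n : ℝ) + 1) * H - n * H = H by ring] at h1
      obtain ⟨s, hs, x, hx, hsx⟩ := hhit _ h1.1
      have h2 := flow_add hF (s := n * H) (hray (by simp; positivity)) (mem_flowDom_of_le h1.1
        (Ioc_subset_Icc_self hs))
      exact ⟨x, _, h2.1, h2.2.trans hsx, hx, by linarith [hs.1], by linarith [hs.2]⟩
    choose y σ h1 h2 h3 h4 h5 using this
    refine key y σ h1 h2 h3 fun m n hmn => (lt_of_le_of_lt (h5 m) (lt_of_le_of_lt ?_ (h4 n))).ne
    have : (m : ℝ) + 1 ≤ n := by exact_mod_cast hmn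
    gcongr
  · obtain ⟨H, hH, hhit⟩ := hD.exists_hit_down hF hN hu hv huv
    have : ∀ n : ℕ, ∃ y σ, σ ∈ F.flowDom q ∧ F.flow q σ = F.exp p (y : ℝ) ∧ y ∈ Ioo u v ∧
        n * H < -σ ∧ -σ ≤ (n + 1) * H := by
      intro n
      have hn : ∀ m : ℝ, 0 ≤ m → -(m * H) ∈ F.flowDom q := fun m hm =>
        hray (by simp; positivity)
      have h1 := flow_sub hF (hn n (by positivity)) (hn (n + 1) (by positivity))
      rw [show -(((n : ℝ) + 1) * H) - -(n * H) = -H by ring] at h1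
      obtain ⟨s, hs, hsd, x, hx, hsx⟩ := hhit _ h1.1
      have h2 := flow_add hF (hn n (by positivity)) hsd
      exact ⟨x, _, h2.1, h2.2.trans hsx, hx, by linarith [hs.1], by linarith [hs.2]⟩
    choose y σ h1 h2 h3 h4 h5 using this
    refine key y σ h1 h2 h3 fun m n hmn heq => ?_
    have h6 := lt_of_le_of_lt (h5 m) (lt_of_le_of_lt ?_ (h4 n))
    · rw [heq] at h6
      exact lt_irrefl _ h6
    · have : (m : ℝ) + 1 ≤ n := by exact_mod_cast hmn
      gcongr

/-- A transverse measure has no atoms, since leaves are not closed and cross each arc infinitely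
often. -/
theorem IsDisc.meas_singleton {p : X} {r : ℝ} (hD : F.IsDisc p r) (hF : F.IsTranslation)
    (hN : F.NoVerticalSaddle) {a b : ℝ} (ha : |a| < r / 2) (hb : |b| < r / 2) (hab : a < b)
    (ν : F.TransverseMeasure) {x : ℝ} (hx : x ∈ Ioo a b) :
    ν.meas (hD.arc hF ha hb hab.le) {x} = 0 := by
  set I := hD.arc hF ha hb hab.le with hI
  have := ν.finite I
  by_contra hne
  have hxs : I.path x ∉ F.sing := I.straight.notMem_sing x (Ioo_subset_Icc_self hx)
  have hinf := hD.infinite_hits hF hN ha hb hab hxs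
  have heq : ∀ y ∈ {y | y ∈ Ioo a b ∧ ∃ σ ∈ F.flowDom (I.path x), F.flow (I.path x) σ = F.exp p y},
      ν.meas I {y} = ν.meas I {x} := by
    rintro y ⟨hy, σ, hσ, hσy⟩
    obtain ⟨U, hU, hν⟩ := ν.exists_image_eq hF I hx hy hσ hσy
    have := hν {x} (singleton_subset_iff.2 (mem_of_mem_nhds hU)) (measurableSet_singleton x)
    rwa [image_singleton, add_sub_cancel] at this
  set y := hinf.natEmbedding with hy
  have hfin := Measure.finite_const_le_meas_of_disjoint_iUnion (ν.meas I) (pos_iff_ne_zero.2 hne)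
    (As := fun n : ℕ => {(y n : ℝ)}) (fun n => measurableSet_singleton _) (fun m n hmn => by
      simp only [Function.onFun, disjoint_singleton]
      exact fun h => hmn (y.injective (Subtype.ext h))) (measure_ne_top _ _)
  refine infinite_univ (hfin.subset fun n _ => ?_)
  exact (heq _ (y n).2).ge

/-- A transverse measure is determined up to a multiple by its restriction to one arc. -/
theorem IsDisc.meas_eq_smul {p : X} {r : ℝ} (hD : F.IsDisc p r) (hF : F.IsTranslation)
    (hN : F.NoVerticalSaddle) {a b : ℝ} (ha : |a| < r / 2) (hb : |b| < r / 2) (hab : a < b)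
    (μ ν : F.TransverseMeasure) {c : ℝ≥0}
    (h : (ν.meas (hD.arc hF ha hb hab.le)).restrict (Ioo a b) =
      c • (μ.meas (hD.arc hF ha hb hab.le)).restrict (Ioo a b)) (K : F.HorizontalArc) :
    ν.meas K = c • μ.meas K := by
  set I := hD.arc hF ha hb hab.le with hI
  have hloc : ∀ s ∈ Icc K.a K.b, ∃ V ∈ 𝓝[Icc K.a K.b] s, MeasurableSet V ∧
      (ν.meas K).restrict V = (c • μ.meas K).restrict V := by
    intro s hs
    obtain ⟨x, hx, σ, hσ, hσx⟩ := (hD.infinite_hits hF hN ha hb hab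
      (K.straight.notMem_sing s hs)).nonempty
    obtain ⟨δ, hδ, u, v, huv, hsub, hslide⟩ := exists_slide hF K I hs hx hσ hσx
    refine ⟨Icc u v, ?_, measurableSet_Icc, ?_⟩
    · rw [huv]
      exact inter_mem self_mem_nhdsWithin (mem_nhdsWithin_of_mem_nhds
        (Icc_mem_nhds (by linarith) (by linarith)))
    · have e1 := hslide ν
      have e2 := hslide μ
      have e3 := congrArg (fun m => m.restrict (Icc (u + (x - s)) (v + (x - s)))) h
      simp only [Measure.restrict_smul, Measure.restrict_restrict measurableSet_Icc] at e3
      have hsub' : Icc (u + (x - s)) (v + (x - s)) ∩ Ioo a b = Icc (u + (x - s)) (v + (x - s)) :=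
        inter_eq_left.2 hsub
      rw [hsub', e1, e2, ← Measure.map_smul] at e3
      rw [Measure.restrict_smul]
      exact (Homeomorph.addRight (x - s)).toMeasurableEquiv.map_measurableEquiv_injective e3
  choose! V hV hVm hVeq using hloc
  obtain ⟨t, htK, htc, hcov⟩ := TopologicalSpace.countable_cover_nhdsWithin hV
  have h1 : (ν.meas K).restrict (⋃ s ∈ t, V s) = (c • μ.meas K).restrict (⋃ s ∈ t, V s) :=
    (Measure.restrict_biUnion_congr htc).2 fun s hs => hVeq s (htK hs)
  have hfull : ∀ m : Measure ℝ, m (Icc K.a K.b)ᶜ = 0 → m.restrict (⋃ s ∈ t, V s) = m := fun m hm =>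
    Measure.restrict_eq_self_of_ae_mem (measure_mono_null (compl_subset_compl.2 hcov) hm)
  rwa [hfull _ (ν.carried K), hfull _ (by rw [Measure.smul_apply, μ.carried K, smul_zero])] at h1

/-- Masur's criterion for flat structures given by charts, in terms of the holonomies of saddle
connections. -/
theorem IsTranslation.verticalUniquelyErgodic (hF : F.IsTranslation) (hN : F.NoVerticalSaddle)
    {ε : ℝ} (hε : 0 < ε)
    (hsys : ∃ᶠ t : ℝ in atTop, ∀ γ v, F.IsSaddleConnection γ v → ε ≤ ‖teichmullerMap t v‖) :
    F.VerticalUniquelyErgodic := by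
  obtain ⟨p, hp, -⟩ := exists_exit_up hF
  obtain ⟨r, hr, hsub, hinj, -⟩ := exists_disc hF hp
  have hD : F.IsDisc p r := ⟨hr, hsub, hinj⟩
  obtain ⟨a, b, H, hab, ha, hb, ⟨x₀, hx₀⟩, ⟨c, hc, hsep⟩, hdense⟩ := hD.exists_arc hF hN hε hsys
  refine ⟨F.lengthMeasure, ⟨hD.arc hF ha hb hab.le, ?_⟩, fun ν => ?_⟩
  · change (volume : Measure ℝ).restrict (Icc a b) ≠ 0
    rw [Ne, Measure.restrict_eq_zero, Real.volume_Icc]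
    simpa using hab
  · set I := hD.arc hF ha hb hab.le with hI
    have := ν.finite I
    obtain ⟨k, hk⟩ := (hD.isIntervalExchange (H := H) hF ha hb hab).eq_smul_volume hx₀ hc hsep
      hdense (ν := ν.meas I) (fun x hx => hD.meas_singleton hF hN ha hb hab ν hx) fun x hx hxn => by
        obtain ⟨s, -, hret⟩ := exists_isFirstReturn hx hxn
        exact ν.exists_image_eq hF I hx hret.mem_Ioo hret.mem_flowDom hret.flow_eq
    refine ⟨k, hD.meas_eq_smul hF hN ha hb hab _ ν ?_⟩
    rw [hk]
    change _ = k • ((volume : Measure ℝ).restrict (Icc a b)).restrict (Ioo a b)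
    rw [Measure.restrict_restrict measurableSet_Ioo, inter_eq_left.2 Ioo_subset_Icc_self]

end Compact
end T2
end FlatStructure

/-! ### Zeros and primitives of a holomorphic form -/

/-- Removing finitely many points does not disconnect a space in which this holds locally. -/
theorem Set.Finite.isPreconnected_compl {X : Type*} [TopologicalSpace X] [T1Space X]
    [PreconnectedSpace X] [∀ x : X, NeBot (𝓝[≠] x)] {S : Set X} (hS : S.Finite)
    (h : ∀ x ∈ S, ∃ U ∈ 𝓝 x, U \ {x} ⊆ Sᶜ ∧ IsPreconnected (U \ {x})) : IsPreconnected Sᶜ := by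
  intro u v hu hv huv hne_u hne_v
  by_contra hcon
  rw [not_nonempty_iff_eq_empty] at hcon
  -- The points with a punctured neighbourhood in `u`, respectively in `v`, separate the space.
  have hopen : ∀ w : Set X, IsOpen {x | ∀ᶠ y in 𝓝[≠] x, y ∈ w} := by
    intro w
    rw [isOpen_iff_mem_nhds]
    intro x hx
    have hx' : ∀ᶠ y in 𝓝 x, y ≠ x → y ∈ w := eventually_nhdsWithin_iff.1 hx
    filter_upwards [eventually_eventually_nhds.2 hx'] with y hy
    rcases eq_or_ne y x with rfl | hyx
    · exact hx
    · change ∀ᶠ z in 𝓝[≠] y, z ∈ w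
      filter_upwards [mem_nhdsWithin_of_mem_nhds hy,
        mem_nhdsWithin_of_mem_nhds (isOpen_ne.mem_nhds hyx)] with z hz hzx
      exact hz hzx
  have hmono : ∀ w : Set X, IsOpen w → ∀ x ∈ w, ∀ᶠ y in 𝓝[≠] x, y ∈ w := fun w hw x hx =>
    mem_nhdsWithin_of_mem_nhds (hw.mem_nhds hx)
  obtain ⟨x, -, hxu, hxv⟩ := isPreconnected_univ _ _ (hopen u) (hopen v) (by
    intro x _
    by_cases hx : x ∈ S
    · obtain ⟨U, hU, hUS, hUc⟩ := h x hx
      have hUx : U \ {x} ∈ 𝓝[≠] x := sdiff_mem_nhdsWithin_compl hU _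
      have hsub := hUc.subset_or_subset hu hv
      have hd : ¬ ((U \ {x}) ∩ (u ∩ v)).Nonempty := fun ⟨y, hy, hyuv⟩ => by
        have : y ∈ Sᶜ ∩ (u ∩ v) := ⟨hUS hy, hyuv⟩
        rw [hcon] at this
        exact this
      rcases isPreconnected_iff_subset_of_disjoint.1 hUc u v hu hv (hUS.trans huv)
        (not_nonempty_iff_eq_empty.1 hd) with h | h
      · exact Or.inl (mem_of_superset hUx h)
      · exact Or.inr (mem_of_superset hUx h)
    · exact (huv hx).imp (hmono u hu x) (hmono v hv x))
    (hne_u.mono fun x hx => ⟨mem_univ x, hmono u hu x hx.2⟩)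
    (hne_v.mono fun x hx => ⟨mem_univ x, hmono v hv x hx.2⟩)
  have hxS : ∀ᶠ y in 𝓝[≠] x, y ∉ S := by
    have : (S \ {x}).Finite := hS.subset sdiff_subset
    filter_upwards [mem_nhdsWithin_of_mem_nhds (this.isClosed.isOpen_compl.mem_nhds (by simp :
      x ∈ (S \ {x})ᶜ)), self_mem_nhdsWithin] with y hy hyx hyS
    exact hy ⟨hyS, hyx⟩
  have hxu' : ∀ᶠ y in 𝓝[≠] x, y ∈ u := hxu
  have hxv' : ∀ᶠ y in 𝓝[≠] x, y ∈ v := hxv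
  obtain ⟨y, ⟨hy1, hy2⟩, hy3⟩ := ((hxu'.and hxv').and hxS).exists
  have : y ∈ Sᶜ ∩ (u ∩ v) := ⟨hy3, hy1, hy2⟩
  rw [hcon] at this
  exact this

theorem Complex.isPreconnected_ball_sdiff_singleton (c : ℂ) {r : ℝ} (hr : 0 < r) :
    IsPreconnected (Metric.ball c r \ {c}) := by
  have h := (isPathConnected_compl_singleton_of_one_lt_rank (E := ℂ)
    (by rw [Complex.rank_real_complex]; norm_num) 0).isConnected.isPreconnected
  set e := OpenPartialHomeomorph.univBall c r with he
  have hs : e.source = univ := OpenPartialHomeomorph.univBall_source c r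
  have ht : e.target = Metric.ball c r := OpenPartialHomeomorph.univBall_target c hr
  have h0 : e 0 = c := OpenPartialHomeomorph.univBall_apply_zero c r
  have himg : Metric.ball c r \ {c} = e '' {0}ᶜ := by
    ext z
    constructor
    · rintro ⟨hz, hzc⟩
      rw [← ht] at hz
      refine ⟨e.symm z, fun h => hzc ?_, e.right_inv hz⟩
      rw [mem_singleton_iff] at h
      rw [mem_singleton_iff, ← e.right_inv hz, h, h0]
    · rintro ⟨w, hw, rfl⟩
      refine ⟨ht ▸ e.map_source (hs ▸ mem_univ w), fun h => hw ?_⟩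
      exact e.injOn (hs ▸ mem_univ w) (hs ▸ mem_univ 0) ((mem_singleton_iff.1 h).trans h0.symm)
  rw [himg]
  exact h.image _ (e.continuousOn.mono (hs ▸ subset_univ _))

namespace HolomorphicOneForm

variable {X : Type*} [TopologicalSpace X] [ChartedSpace ℂ X] (η : HolomorphicOneForm X)

/-- The coefficient `f` of a holomorphic form `f(z) dz` in a chart. -/
def coeff (e : OpenPartialHomeomorph X ℂ) (z : ℂ) : ℂ :=
  η.form (e.symm z) (mfderiv 𝓘(ℂ) 𝓘(ℂ) e.symm z (1 : ℂ))

variable {η}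

theorem differentiableOn_coeff {e : OpenPartialHomeomorph X ℂ} (he : e ∈ atlas ℂ X) :
    DifferentiableOn ℂ (η.coeff e) e.target :=
  η.holomorphic e he

theorem neBot_nhdsNE (x : X) : NeBot (𝓝[≠] x) := by
  set e := chartAt ℂ x with he
  have hx : x ∈ e.source := mem_chart_source ℂ x
  have h : Tendsto e.symm (𝓝[≠] (e x)) (𝓝[≠] x) := by
    refine tendsto_nhdsWithin_iff.2 ⟨?_, ?_⟩
    · have := (e.continuousAt_symm (e.map_source hx)).tendsto
      rw [e.left_inv hx] at this
      exact this.mono_left nhdsWithin_le_nhds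
    · filter_upwards [self_mem_nhdsWithin,
        mem_nhdsWithin_of_mem_nhds (e.open_target.mem_nhds (e.map_source hx))] with z hz hzt h
      exact hz (by rw [mem_singleton_iff, ← e.right_inv hzt, mem_singleton_iff.1 h])
  exact h.neBot

theorem tendsto_chart_nhdsNE (x : X) :
    Tendsto (chartAt ℂ x) (𝓝[≠] x) (𝓝[≠] (chartAt ℂ x x)) := by
  set e := chartAt ℂ x with he
  have hx : x ∈ e.source := mem_chart_source ℂ x
  refine tendsto_nhdsWithin_iff.2 ⟨(e.continuousAt hx).tendsto.mono_left nhdsWithin_le_nhds, ?_⟩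
  filter_upwards [self_mem_nhdsWithin, mem_nhdsWithin_of_mem_nhds (e.open_source.mem_nhds hx)]
    with y hy hys h
  exact hy (e.injOn hys hx h)

theorem exists_primitive {e : OpenPartialHomeomorph X ℂ} (he : e ∈ atlas ℂ X) {c : ℂ}
    (hc : c ∈ e.target) :
    ∃ r > 0, Metric.ball c r ⊆ e.target ∧ ∃ g : ℂ → ℂ,
      ∀ z ∈ Metric.ball c r, HasDerivAt g (η.coeff e z) z := by
  obtain ⟨r, hr, hsub⟩ := Metric.isOpen_iff.1 e.open_target c hc
  exact ⟨r, hr, hsub, ((differentiableOn_coeff he).mono hsub).isExactOn_ball⟩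

section Manifold
variable [IsManifold 𝓘(ℂ) ω X] {e : OpenPartialHomeomorph X ℂ}

/-- In a chart `e` the form is its coefficient times the differential of `e`. The linear maps `A`
and `L` replace the two differentials in order to have tangent spaces identified with `ℂ`. -/
theorem coeff_mul (he : e ∈ atlas ℂ X) {z : ℂ} (hz : z ∈ e.target) {A L : ℂ →L[ℂ] ℂ}
    (hA : A = mfderiv 𝓘(ℂ) 𝓘(ℂ) e (e.symm z)) (hL : L = η.form (e.symm z)) (w : ℂ) :
    η.coeff e z * A w = L w := by
  have : IsManifold 𝓘(ℂ) 1 X := IsManifold.of_le (n := ω) le_top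
  have hinv := (mdifferentiable_of_mem_atlas (I := 𝓘(ℂ)) he).comp_symm_deriv hz
  set b : ℂ := mfderiv 𝓘(ℂ) 𝓘(ℂ) e.symm z (1 : ℂ) with hb
  have h1 : A b = 1 := hA ▸ DFunLike.congr_fun hinv (1 : ℂ)
  have hLb : η.coeff e z = L b := hL ▸ rfl
  have hb0 : b ≠ 0 := by
    intro h
    rw [h, map_zero] at h1
    exact zero_ne_one h1
  have hw : w = (w / b) • b := by rw [smul_eq_mul, div_mul_cancel₀ _ hb0]
  have hAw : A w = w / b := by
    conv_lhs => rw [hw]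
    rw [map_smul, h1, smul_eq_mul, mul_one]
  rw [hAw, hLb]
  conv_rhs => rw [hw]
  rw [map_smul, smul_eq_mul, mul_comm]

theorem coeff_eq_zero_iff (he : e ∈ atlas ℂ X) {z : ℂ} (hz : z ∈ e.target) :
    η.coeff e z = 0 ↔ η.form (e.symm z) = 0 := by
  constructor
  · intro h
    refine ContinuousLinearMap.ext fun w => ?_
    refine (coeff_mul he hz rfl rfl w).symm.trans ?_
    rw [h, zero_mul]
    rfl
  · intro h
    rw [coeff, h]
    rfl

/-- A primitive of the coefficient is a primitive of the form. -/
theorem hasMFDerivAt_of_coeff (he : e ∈ atlas ℂ X) {g : ℂ → ℂ} {x : X} (hx : x ∈ e.source)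
    (hg : HasDerivAt g (η.coeff e (e x)) (e x)) :
    HasMFDerivAt 𝓘(ℂ) 𝓘(ℂ) (g ∘ e) x (η.form x) := by
  have : IsManifold 𝓘(ℂ) 1 X := IsManifold.of_le (n := ω) le_top
  have key : ∀ z ∈ e.target, HasDerivAt g (η.coeff e z) z →
      HasMFDerivAt 𝓘(ℂ) 𝓘(ℂ) (g ∘ e) (e.symm z) (η.form (e.symm z)) := by
    intro z hz hg
    have h1 : HasMFDerivAt 𝓘(ℂ) 𝓘(ℂ) e (e.symm z) (mfderiv 𝓘(ℂ) 𝓘(ℂ) e (e.symm z)) :=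
      (mdifferentiableAt_atlas he (e.map_target hz)).hasMFDerivAt
    have hg' : HasDerivAt g (η.coeff e (e (e.symm z))) (e (e.symm z)) := by rwa [e.right_inv hz]
    have h2 := hasMFDerivAt_iff_hasFDerivAt.2 hg'.hasFDerivAt
    have h3 := h2.comp (e.symm z) h1
    refine h3.congr_mfderiv (ContinuousLinearMap.ext fun w => ?_)
    refine Eq.trans ?_ (coeff_mul he hz rfl rfl w)
    have e1 : η.coeff e (e (e.symm z)) = η.coeff e z := by rw [e.right_inv hz]
    rw [e1]
    exact mul_comm (G := ℂ) _ _
  have := key (e x) (e.map_source hx) hg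
  rwa [e.left_inv hx] at this

/-- Two primitives of the form differ locally by a constant. -/
theorem eventually_sub_eq {G₁ G₂ : X → ℂ} {x : X}
    (h₁ : ∀ᶠ y in 𝓝 x, HasMFDerivAt 𝓘(ℂ) 𝓘(ℂ) G₁ y (η.form y))
    (h₂ : ∀ᶠ y in 𝓝 x, HasMFDerivAt 𝓘(ℂ) 𝓘(ℂ) G₂ y (η.form y)) :
    ∀ᶠ y in 𝓝 x, G₁ y - G₁ x = G₂ y - G₂ x := by
  have : IsManifold 𝓘(ℂ) 1 X := IsManifold.of_le (n := ω) le_top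
  set e := chartAt ℂ x with he
  have hx : x ∈ e.source := mem_chart_source ℂ x
  have hsymm : Tendsto e.symm (𝓝 (e x)) (𝓝 x) := by
    have := (e.continuousAt_symm (e.map_source hx)).tendsto
    rwa [e.left_inv hx] at this
  have hev : ∀ᶠ z in 𝓝 (e x), z ∈ e.target ∧ HasDerivAt
      (fun z => G₁ (e.symm z) - G₂ (e.symm z)) 0 z := by
    filter_upwards [hsymm.eventually (h₁.and h₂), e.open_target.mem_nhds (e.map_source hx)]
      with z hz hzt
    refine ⟨hzt, ?_⟩
    have h3 : HasMFDerivAt 𝓘(ℂ) 𝓘(ℂ) e.symm z (mfderiv 𝓘(ℂ) 𝓘(ℂ) e.symm z) :=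
      (mdifferentiableAt_atlas_symm (chart_mem_atlas ℂ x) hzt).hasMFDerivAt
    have h4 := hasMFDerivAt_iff_hasFDerivAt.1 (hz.1.comp z h3)
    have h5 := hasMFDerivAt_iff_hasFDerivAt.1 (hz.2.comp z h3)
    have h6 : HasFDerivAt (fun z => G₁ (e.symm z) - G₂ (e.symm z)) (0 : ℂ →L[ℂ] ℂ) z :=
      (h4.sub h5).congr_fderiv (sub_self _)
    simpa using h6.hasDerivAt
  obtain ⟨ρ, hρ, hball⟩ := Metric.eventually_nhds_iff_ball.1 hev
  filter_upwards [(e.continuousAt hx).eventually (Metric.ball_mem_nhds _ hρ),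
    e.open_source.mem_nhds hx] with y hy hys
  have hconst := (convex_ball (e x) ρ).is_const_of_fderivWithin_eq_zero (𝕜 := ℂ)
    (f := fun z => G₁ (e.symm z) - G₂ (e.symm z))
    (fun z hz => (hball z hz).2.differentiableAt.differentiableWithinAt) (fun z hz => by
      rw [fderivWithin_of_isOpen Metric.isOpen_ball hz]
      have := (hball z hz).2.hasFDerivAt.fderiv
      rw [this]
      ext; simp) hy (Metric.mem_ball_self hρ)
  simp only [e.left_inv hx, e.left_inv hys] at hconst
  linear_combination hconst

theorem eventually_zero_or (x : X) :
    (∀ᶠ y in 𝓝 x, η.form y = 0) ∨ ∀ᶠ y in 𝓝[≠] x, η.form y ≠ 0 := by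
  set e := chartAt ℂ x with he
  have hx : x ∈ e.source := mem_chart_source ℂ x
  have hea : e ∈ atlas ℂ X := chart_mem_atlas ℂ x
  have han : AnalyticAt ℂ (η.coeff e) (e x) :=
    (differentiableOn_coeff hea).analyticAt (e.open_target.mem_nhds (e.map_source hx))
  have hiff : ∀ y ∈ e.source, (η.coeff e (e y) = 0 ↔ η.form y = 0) := by
    intro y hy
    have := coeff_eq_zero_iff (η := η) hea (e.map_source hy)
    rwa [e.left_inv hy] at this
  rcases han.eventually_eq_zero_or_eventually_ne_zero with h | h
  · left
    filter_upwards [(e.continuousAt hx).eventually h, e.open_source.mem_nhds hx] with y hy hys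
    exact (hiff y hys).1 hy
  · right
    filter_upwards [(tendsto_chart_nhdsNE x).eventually h,
      mem_nhdsWithin_of_mem_nhds (e.open_source.mem_nhds hx)] with y hy hys
    exact fun h => hy ((hiff y hys).2 h)

variable (η) in
/-- The zeros of a nonzero holomorphic form are isolated. -/
theorem eventually_ne_zero [PreconnectedSpace X] (hη : ∃ x, η.form x ≠ 0) (x : X) :
    ∀ᶠ y in 𝓝[≠] x, η.form y ≠ 0 := by
  have : ∀ x : X, NeBot (𝓝[≠] x) := neBot_nhdsNE
  have hclopen : IsClopen {x : X | ∀ᶠ y in 𝓝 x, η.form y = 0} := by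
    refine ⟨⟨?_⟩, isOpen_setOfPred_eventually_nhds⟩
    rw [isOpen_iff_mem_nhds]
    intro x hx
    have h := eventually_nhdsWithin_iff.1 ((eventually_zero_or x).resolve_left hx)
    filter_upwards [h] with y hy hyS
    rcases eq_or_ne y x with rfl | hne
    · exact hx hyS
    · exact hy hne hyS.self_of_nhds
  rcases isClopen_iff.1 hclopen with h | h
  · refine (eventually_zero_or x).resolve_left fun hx => ?_
    have : x ∈ {x : X | ∀ᶠ y in 𝓝 x, η.form y = 0} := hx
    rw [h] at this
    exact this
  · obtain ⟨y, hy⟩ := hη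
    have : y ∈ {x : X | ∀ᶠ y in 𝓝 x, η.form y = 0} := h ▸ mem_univ y
    exact (hy this.self_of_nhds).elim

theorem finite_zeros [CompactSpace X] [PreconnectedSpace X] (hη : ∃ x, η.form x ≠ 0) :
    {x | η.form x = 0}.Finite := by
  have h := fun x => eventually_nhdsWithin_iff.1 (η.eventually_ne_zero hη x)
  obtain ⟨t, ht⟩ := CompactSpace.elim_nhds_subcover
    (fun x => {y | y ∈ ({x}ᶜ : Set X) → η.form y ≠ 0}) h
  refine t.finite_toSet.subset fun y hy => ?_
  have : y ∈ ⋃ x ∈ t, {y | y ∈ ({x}ᶜ : Set X) → η.form y ≠ 0} := ht ▸ mem_univ y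
  obtain ⟨x, hx, hyx⟩ := mem_iUnion₂.1 this
  by_contra hcon
  exact hyx (fun h => hcon (by rw [mem_singleton_iff.1 h]; exact hx)) hy

theorem isPreconnected_compl_zeros [T2Space X] [CompactSpace X] [PreconnectedSpace X]
    (hη : ∃ x, η.form x ≠ 0) : IsPreconnected {x | η.form x = 0}ᶜ := by
  have : ∀ x : X, NeBot (𝓝[≠] x) := neBot_nhdsNE
  refine (finite_zeros hη).isPreconnected_compl fun x _ => ?_
  set e := chartAt ℂ x with he
  have hx : x ∈ e.source := mem_chart_source ℂ x
  have h := eventually_nhdsWithin_iff.1 (η.eventually_ne_zero hη x)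
  have hsymm : Tendsto e.symm (𝓝 (e x)) (𝓝 x) := by
    have := (e.continuousAt_symm (e.map_source hx)).tendsto
    rwa [e.left_inv hx] at this
  obtain ⟨r, hr, hball⟩ := Metric.eventually_nhds_iff_ball.1
    ((hsymm.eventually h).and (e.open_target.mem_nhds (e.map_source hx)))
  have himg : (e.source ∩ e ⁻¹' Metric.ball (e x) r) \ {x} =
      e.symm '' (Metric.ball (e x) r \ {e x}) := by
    ext y
    constructor
    · rintro ⟨⟨hys, hy⟩, hyx⟩
      exact ⟨e y, ⟨hy, fun h => hyx (e.injOn hys hx h)⟩, e.left_inv hys⟩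
    · rintro ⟨z, ⟨hz, hzx⟩, rfl⟩
      have hzt := (hball z hz).2
      refine ⟨⟨e.map_target hzt, by rw [mem_preimage, e.right_inv hzt]; exact hz⟩, fun h => hzx ?_⟩
      rw [mem_singleton_iff, ← e.right_inv hzt, mem_singleton_iff.1 h]
  refine ⟨e.source ∩ e ⁻¹' Metric.ball (e x) r, ?_, ?_, ?_⟩
  · exact inter_mem (e.open_source.mem_nhds hx)
      ((e.continuousAt hx).preimage_mem_nhds (Metric.ball_mem_nhds _ hr))
  · rintro y ⟨⟨hys, hy⟩, hyx⟩ h0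
    have := (hball (e y) hy).1
    rw [e.left_inv hys] at this
    exact this hyx h0
  · rw [himg]
    exact (Complex.isPreconnected_ball_sdiff_singleton _ hr).image _
      (e.continuousOn_symm.mono fun z hz => (hball z hz.1).2)

/-- Natural parameters exist around each point that is not a zero. -/
theorem exists_natural_parameter {x : X} (hx0 : η.form x ≠ 0) :
    ∃ φ ∈ η.flat.charts, x ∈ φ.source := by
  set e := chartAt ℂ x with he
  have hx : x ∈ e.source := mem_chart_source ℂ x
  have hea : e ∈ atlas ℂ X := chart_mem_atlas ℂ x
  obtain ⟨r, hr, hsub, g, hg⟩ := exists_primitive (η := η) hea (e.map_source hx)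
  have hne : η.coeff e (e x) ≠ 0 := by
    intro h
    have := (coeff_eq_zero_iff hea (e.map_source hx)).1 h
    rw [e.left_inv hx] at this
    exact hx0 this
  have hgd : DifferentiableOn ℂ g (Metric.ball (e x) r) := fun z hz =>
    (hg z hz).differentiableAt.differentiableWithinAt
  have han : AnalyticAt ℂ g (e x) := hgd.analyticAt (Metric.ball_mem_nhds _ hr)
  have hstrict : HasStrictDerivAt g (η.coeff e (e x)) (e x) := by
    have := han.hasStrictDerivAt
    rwa [(hg _ (Metric.mem_ball_self hr)).deriv] at this
  set ψ := (hstrict.hasStrictFDerivAt_equiv hne).toOpenPartialHomeomorph g with hψ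
  refine ⟨e.trans (ψ.restr (Metric.ball (e x) r)), ?_, ?_⟩
  · intro y hy
    rw [OpenPartialHomeomorph.trans_source,
      OpenPartialHomeomorph.restr_source' _ _ Metric.isOpen_ball] at hy
    exact hasMFDerivAt_of_coeff hea hy.1 (hg _ hy.2.2)
  · rw [OpenPartialHomeomorph.trans_source,
      OpenPartialHomeomorph.restr_source' _ _ Metric.isOpen_ball]
    exact ⟨hx, (hstrict.hasStrictFDerivAt_equiv hne).mem_toOpenPartialHomeomorph_source,
      Metric.mem_ball_self hr⟩

theorem flat_compat {φ ψ : OpenPartialHomeomorph X ℂ} (hφ : φ ∈ η.flat.charts)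
    (hψ : ψ ∈ η.flat.charts) {x : X} (hxφ : x ∈ φ.source) (hxψ : x ∈ ψ.source) :
    ∀ᶠ y in 𝓝 x, φ y - φ x = ψ y - ψ x := by
  refine eventually_sub_eq (η := η) ?_ ?_
  · filter_upwards [φ.open_source.mem_nhds hxφ] with y hy using hφ y hy
  · filter_upwards [ψ.open_source.mem_nhds hxψ] with y hy using hψ y hy

end Manifold
end HolomorphicOneForm

/-! ### The flat structure of a holomorphic form -/

theorem IsCompact.finite_of_eventually_nhdsNE {E : Type*} [TopologicalSpace E] {K S : Set E}
    (hK : IsCompact K) (hS : S ⊆ K) (h : ∀ z ∈ K, ∀ᶠ w in 𝓝[≠] z, w ∉ S) : S.Finite := by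
  obtain ⟨t, -, ht⟩ := hK.elim_nhds_subcover (fun z => {w | w ∈ ({z}ᶜ : Set E) → w ∉ S})
    fun z hz => eventually_nhdsWithin_iff.1 (h z hz)
  refine t.finite_toSet.subset fun w hw => ?_
  obtain ⟨z, hz, hwz⟩ := mem_iUnion₂.1 (ht (hS hw))
  by_contra hcon
  exact hwz (fun h => hcon (by rw [mem_singleton_iff.1 h]; exact hz)) hw

namespace HolomorphicOneForm

variable {X : Type*} [TopologicalSpace X] [ChartedSpace ℂ X] [IsManifold 𝓘(ℂ) ω X]
  {η : HolomorphicOneForm X}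

/-- The values of a primitive of a function with isolated zeros are isolated. -/
theorem _root_.HasDerivAt.eventually_ne_of_eventually_ne {f g : ℂ → ℂ} {z : ℂ}
    (hg : ∀ᶠ w in 𝓝 z, HasDerivAt g (f w) w) (hf : ∀ᶠ w in 𝓝[≠] z, f w ≠ 0) (k : ℂ) :
    ∀ᶠ w in 𝓝[≠] z, g w ≠ k := by
  have han : AnalyticAt ℂ (fun w => g w - k) z := by
    obtain ⟨r, hr, hball⟩ := Metric.eventually_nhds_iff_ball.1 hg
    have : DifferentiableOn ℂ (fun w => g w - k) (Metric.ball z r) := fun w hw =>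
      ((hball w hw).differentiableAt.sub_const k).differentiableWithinAt
    exact this.analyticAt (Metric.ball_mem_nhds z hr)
  rcases han.eventually_eq_zero_or_eventually_ne_zero with h | h
  · exfalso
    have h0 : ∀ᶠ w in 𝓝[≠] z, f w = 0 := by
      filter_upwards [mem_nhdsWithin_of_mem_nhds hg,
        mem_nhdsWithin_of_mem_nhds (eventually_eventually_nhds.2 h)] with w hw hw0
      have h1 : g =ᶠ[𝓝 w] fun _ => k := hw0.mono fun u hu => sub_eq_zero.1 hu
      exact hw.unique ((hasDerivAt_const w k).congr_of_eventuallyEq h1)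
    obtain ⟨w, hw1, hw2⟩ := (h0.and hf).exists
    exact hw2 hw1
  · exact h.mono fun w hw => sub_ne_zero.1 hw

/-- Around each point, in particular around a zero, the form has a primitive with finite fibres
which is open at the point. -/
theorem exists_open_primitive [T2Space X] [PreconnectedSpace X] (hη : ∃ x, η.form x ≠ 0)
    (p : X) :
    ∃ (U : Set X) (G : X → ℂ), IsOpen U ∧ p ∈ U ∧ ContinuousOn G (closure U) ∧
      (∀ x ∈ closure U, x ≠ p → η.form x ≠ 0 ∧ G x ≠ G p) ∧ (∀ c, (U ∩ G ⁻¹' {c}).Finite) ∧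
      𝓝 (G p) ≤ map G (𝓝 p) ∧ ∀ x ∈ U, HasMFDerivAt 𝓘(ℂ) 𝓘(ℂ) G x (η.form x) := by
  set e := chartAt ℂ p with he
  have hp : p ∈ e.source := mem_chart_source ℂ p
  have hea : e ∈ atlas ℂ X := chart_mem_atlas ℂ p
  obtain ⟨r, hr, hsub, g, hg⟩ := exists_primitive (η := η) hea (e.map_source hp)
  have hcoeff : ∀ z ∈ e.target, ∀ᶠ w in 𝓝[≠] z, η.coeff e w ≠ 0 := by
    intro z hz
    have han : AnalyticAt ℂ (η.coeff e) z :=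
      (differentiableOn_coeff hea).analyticAt (e.open_target.mem_nhds hz)
    refine han.eventually_eq_zero_or_eventually_ne_zero.resolve_left fun h => ?_
    have := neBot_nhdsNE (e.symm z)
    have h1 : ∀ᶠ y in 𝓝 (e.symm z), η.form y = 0 := by
      have hc := (e.continuousAt (e.map_target hz)).tendsto
      rw [e.right_inv hz] at hc
      filter_upwards [hc.eventually h, e.open_source.mem_nhds (e.map_target hz)] with y hy hys
      have := (coeff_eq_zero_iff hea (e.map_source hys)).1 hy
      rwa [e.left_inv hys] at this
    obtain ⟨y, hy1, hy2⟩ := ((h1.filter_mono nhdsWithin_le_nhds).and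
      (η.eventually_ne_zero hη (e.symm z))).exists
    exact hy2 hy1
  have hval : ∀ z ∈ Metric.ball (e p) r, ∀ k, ∀ᶠ w in 𝓝[≠] z, g w ≠ k := fun z hz k =>
    HasDerivAt.eventually_ne_of_eventually_ne
      (by filter_upwards [Metric.isOpen_ball.mem_nhds hz] with w hw using hg w hw)
      (hcoeff z (hsub hz)) k
  have hc0 := Metric.mem_ball_self (x := e p) hr
  obtain ⟨r', hr', hball⟩ := Metric.eventually_nhds_iff_ball.1 (eventually_nhdsWithin_iff.1
    ((hcoeff _ (hsub hc0)).and (hval _ hc0 (g (e p)))))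
  obtain ⟨ρ, hρ, hρr, hρr'⟩ : ∃ ρ > 0, ρ < r ∧ ρ < r' := by
    obtain ⟨ρ, h1, h2⟩ := exists_between (lt_min hr hr')
    exact ⟨ρ, h1, (lt_min_iff.1 h2).1, (lt_min_iff.1 h2).2⟩
  have hcb : Metric.closedBall (e p) ρ ⊆ Metric.ball (e p) r := Metric.closedBall_subset_ball hρr
  have hcb' : Metric.closedBall (e p) ρ ⊆ Metric.ball (e p) r' := Metric.closedBall_subset_ball hρr'
  have hgc : ContinuousOn g (Metric.ball (e p) r) := fun z hz =>
    (hg z hz).continuousAt.continuousWithinAt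
  set U := e.source ∩ e ⁻¹' Metric.ball (e p) ρ with hU
  have hcl : closure U ⊆ e.source ∩ e ⁻¹' Metric.closedBall (e p) ρ := by
    have hK : IsCompact (e.symm '' Metric.closedBall (e p) ρ) :=
      (isCompact_closedBall _ _).image_of_continuousOn
        (e.continuousOn_symm.mono (hcb.trans hsub))
    refine (closure_minimal ?_ hK.isClosed).trans ?_
    · rintro x ⟨hx, hxb⟩
      exact ⟨e x, Metric.ball_subset_closedBall hxb, e.left_inv hx⟩
    · rintro _ ⟨z, hz, rfl⟩
      have hzt := hsub (hcb hz)
      exact ⟨e.map_target hzt, by rw [mem_preimage, e.right_inv hzt]; exact hz⟩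
  refine ⟨U, g ∘ e, e.isOpen_inter_preimage Metric.isOpen_ball, ⟨hp, Metric.mem_ball_self hρ⟩,
    ?_, ?_, fun k => ?_, ?_, ?_⟩
  · exact hgc.comp (e.continuousOn.mono fun x hx => (hcl hx).1) fun x hx => hcb (hcl hx).2
  · intro x hx hxp
    obtain ⟨hxs, hxb⟩ := hcl hx
    have := hball (e x) (hcb' hxb) fun h => hxp (e.injOn hxs hp h)
    refine ⟨fun h0 => this.1 ?_, this.2⟩
    rw [coeff_eq_zero_iff hea (e.map_source hxs), e.left_inv hxs]
    exact h0
  · have hfin : (Metric.closedBall (e p) ρ ∩ g ⁻¹' {k}).Finite :=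
      (isCompact_closedBall _ _).finite_of_eventually_nhdsNE inter_subset_left fun z hz =>
        (hval z (hcb hz) k).mono fun w hw hwk => hw hwk.2
    refine Finite.of_injOn (f := e) ?_ (e.injOn.mono fun x hx => hx.1.1) hfin
    rintro x ⟨⟨-, hxb⟩, hxk⟩
    exact ⟨Metric.ball_subset_closedBall hxb, hxk⟩
  · have han : AnalyticAt ℂ g (e p) := by
      have : DifferentiableOn ℂ g (Metric.ball (e p) r) := fun z hz =>
        (hg z hz).differentiableAt.differentiableWithinAt
      exact this.analyticAt (Metric.ball_mem_nhds _ hr)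
    have hopen := han.eventually_constant_or_nhds_le_map_nhds.resolve_left fun h => by
      obtain ⟨w, hw1, hw2⟩ := ((h.filter_mono nhdsWithin_le_nhds).and (hval _ hc0 (g (e p)))).exists
      exact hw2 hw1
    rwa [← e.map_nhds_eq hp, map_map] at hopen
  · rintro x ⟨hx, hxb⟩
    exact hasMFDerivAt_of_coeff hea hx (hg _ (hcb (Metric.ball_subset_closedBall hxb)))

/-- The flat structure of a nonzero holomorphic form with zeros on a closed Riemann surface is a
translation structure. -/
theorem isTranslation_flat [T2Space X] [CompactSpace X] [PreconnectedSpace X]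
    (hη : ∃ x, η.form x ≠ 0) (hzero : ∃ x, η.form x = 0) : η.flat.IsTranslation where
  finite_sing := finite_zeros hη
  nonempty_sing := hzero
  preconnected := isPreconnected_compl_zeros hη
  exists_chart _ hx := exists_natural_parameter hx
  compat _ hφ _ hψ _ hx hx' := flat_compat hφ hψ hx hx'
  primitive p _ := by
    obtain ⟨U, G, h1, h2, h3, h4, h5, h6, h7⟩ := exists_open_primitive hη p
    refine ⟨U, G, h1, h2, h3, h4, h5, h6, fun x hx _ φ hφ hxφ => ?_⟩
    refine eventually_sub_eq (η := η) ?_ ?_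
    · filter_upwards [h1.mem_nhds hx] with y hy using h7 y hy
    · filter_upwards [φ.open_source.mem_nhds hxφ] with y hy using hφ y hy

end HolomorphicOneForm

/-! ### Saddle connections along the Teichmüller flow -/

namespace FlatStructure

variable {X : Type*} [TopologicalSpace X] {F : FlatStructure X}

theorem _root_.teichmullerMap_line (t : ℝ) (z v : ℂ) (s : ℝ) :
    teichmullerMap t (z + (s : ℂ) * v) = teichmullerMap t z + (s : ℂ) * teichmullerMap t v := by
  have h : ∀ w, teichmullerMap t w = ⟨Real.exp (t / 2) * w.re, Real.exp (-t / 2) * w.im⟩ :=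
    fun _ => rfl
  rw [h, h, h]
  apply Complex.ext <;> simp <;> ring

/-- Saddle connections remain saddle connections along the Teichmüller flow. -/
theorem IsSaddleConnection.evolve {γ : ℝ → X} {v : ℂ} (h : F.IsSaddleConnection γ v) (t : ℝ) :
    (F.evolve t).IsSaddleConnection γ (teichmullerMap t v) where
  ne_zero h0 := by
    have h1 : teichmullerMap t 0 = 0 := by
      have := teichmullerMap_line t 0 0 1
      simpa using this
    exact h.ne_zero ((teichmullerMap t).injective (h0.trans h1.symm))
  continuousOn := h.continuousOn
  start_mem := h.start_mem
  end_mem := h.end_mem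
  straight := by
    refine ⟨h.straight.continuousOn, h.straight.notMem_sing, ?_⟩
    rintro s hs _ ⟨φ, hφ, rfl⟩ hx
    filter_upwards [h.straight.straight s hs φ hφ (by simpa using hx)] with u hu
    simp only [OpenPartialHomeomorph.transHomeomorph_apply, Function.comp_apply]
    rw [hu, teichmullerMap_line]

/-- If the shortest saddle connection does not tend to zero, then all saddle connections are longer
than a constant at arbitrarily large times. -/
theorem exists_frequently_le
    (h : ¬ Tendsto (fun t : ℝ => (F.evolve t).shortestSaddle) atTop (𝓝 0)) :
    ∃ ε > 0, ∃ᶠ t : ℝ in atTop, ∀ γ v, F.IsSaddleConnection γ v → ε ≤ ‖teichmullerMap t v‖ := by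
  rw [ENNReal.tendsto_nhds_zero] at h
  push Not at h
  obtain ⟨ε, hε, hfreq⟩ := h
  have htop : ε ≠ ⊤ := by
    obtain ⟨t, ht⟩ := hfreq.exists
    exact ht.ne_top
  refine ⟨ε.toReal, ENNReal.toReal_pos hε.ne' htop, hfreq.mono fun t ht γ v hγ => ?_⟩
  have h1 : (F.evolve t).shortestSaddle ≤ ENNReal.ofReal ‖teichmullerMap t v‖ :=
    sInf_le ⟨γ, _, hγ.evolve t, rfl⟩
  exact ENNReal.toReal_le_of_le_ofReal (norm_nonneg _) (ht.le.trans h1)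

/-- Vertical saddle connections are contracted to zero by the Teichmüller flow. -/
theorem noVerticalSaddle_of_frequently [T2Space X] [CompactSpace X] (hF : F.IsTranslation) {ε : ℝ}
    (hε : 0 < ε)
    (hsys : ∃ᶠ t : ℝ in atTop, ∀ γ v, F.IsSaddleConnection γ v → ε ≤ ‖teichmullerMap t v‖) :
    F.NoVerticalSaddle := by
  intro q hq
  by_contra! hcon
  obtain ⟨s₁, hs₁, hs₁q⟩ := not_subset.1 hcon.1
  obtain ⟨s₂, hs₂, hs₂q⟩ := not_subset.1 hcon.2
  have h0 := zero_mem_flowDom hF hq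
  have hs₁0 : 0 < s₁ := lt_of_le_of_ne hs₁ fun h => hs₁q (h ▸ h0)
  have hs₂0 : s₂ < 0 := lt_of_le_of_ne hs₂ fun h => hs₂q (h ▸ h0)
  obtain ⟨β, hβ, hβq, hβ'⟩ := exists_exit_flow hF hq hs₁0 hs₁q
  obtain ⟨α, hα, hαq, hα'⟩ := exists_exit (zero_mem_dom hF hq) (v := s₂ • Complex.I) hs₂q
  have hα0 : 0 < α * -s₂ := mul_pos hα.1 (by linarith)
  obtain ⟨γ, hγ⟩ := exists_saddle hF hq (v := Complex.I) hα0 hβ.1 hβ' hβq (fun s hs => by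
    have := hα' (s / -s₂) ⟨div_nonneg hs.1 (by linarith), (div_lt_iff₀ (by linarith)).2 hs.2⟩
    rw [smul_smul] at this
    have e : s / -s₂ * s₂ = -s := by
      have : s₂ ≠ 0 := hs₂0.ne
      field_simp
    rwa [e] at this) (by rwa [smul_smul, ← neg_mul_eq_mul_neg, neg_neg] at *)
  set T := α * -s₂ + β with hT
  have hnorm : ∀ t, ‖teichmullerMap t (T • Complex.I)‖ = Real.exp (-t / 2) * |T| := by
    intro t
    have : teichmullerMap t (T • Complex.I) = ((Real.exp (-t / 2) * T : ℝ) : ℂ) * Complex.I := by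
      have h : teichmullerMap t (T • Complex.I) = ⟨Real.exp (t / 2) * (T • Complex.I).re,
        Real.exp (-t / 2) * (T • Complex.I).im⟩ := rfl
      rw [h]
      apply Complex.ext <;> simp [-Complex.ofReal_mul, -Complex.ofReal_exp]
    rw [this, norm_mul, Complex.norm_I, mul_one, Complex.norm_real, norm_mul, Real.norm_eq_abs,
      Real.norm_eq_abs, abs_of_pos (Real.exp_pos _)]
  have hlim : Tendsto (fun t : ℝ => ‖teichmullerMap t (T • Complex.I)‖) atTop (𝓝 0) := by
    simp only [hnorm]
    have h1 : Tendsto (fun t : ℝ => Real.exp (-t / 2)) atTop (𝓝 0) := by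
      refine Real.tendsto_exp_atBot.comp ?_
      simp only [neg_div]
      exact tendsto_neg_atTop_atBot.comp (tendsto_id.atTop_div_const (by norm_num))
    simpa using h1.mul_const |T|
  obtain ⟨t, ht1, ht2⟩ := (hsys.and_eventually (hlim.eventually (gt_mem_nhds hε))).exists
  exact absurd (ht1 γ _ hγ) (not_le.2 ht2)

end FlatStructure

end

theorem theorem1p2 {X : Type*} [TopologicalSpace X] [T2Space X] [CompactSpace X] [ConnectedSpace X]
    [ChartedSpace ℂ X] [IsManifold 𝓘(ℂ) ω X]
    (η : HolomorphicOneForm X) (hη : ∃ x, η.form x ≠ 0) (hzero : ∃ x, η.form x = 0)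
    (hℓ : ¬ Tendsto (fun t : ℝ => (η.flat.evolve t).shortestSaddle) atTop (𝓝 0)) :
    η.flat.VerticalUniquelyErgodic := by
  have hF := HolomorphicOneForm.isTranslation_flat hη hzero
  obtain ⟨ε, hε, hsys⟩ := FlatStructure.exists_frequently_le hℓ
  exact hF.verticalUniquelyErgodic
    (FlatStructure.noVerticalSaddle_of_frequently hF hε hsys) hε hsys
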